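/- **The language.** Types are $\tau ::= R \mid I \mid \tau * \tau$, and terms are $$e ::= x \mid e+e \mid \alpha\cdot e \mid \underline\beta \mid (e,e) \mid () \mid \mathtt{let}\ x=e\ \mathtt{in}\ e \mid \mathtt{let}\ (x,y)=e\ \mathtt{in}\ e \mid \mathrm{normal}() \mid e =:= e \qquad(\alpha,\beta\in\mathbb R),$$ with the evident typing; $+$, $\alpha\cdot$, $\underline\beta$ and $\mathrm{normal}()$ have type $R$, and $s=:=t$ has type $I$ for $s,t:R$. **Operational semantics.** Values are $v ::= x \mid (v,v) \mid v+v \mid \alpha\cdot v\mid\underline\beta\mid ()$. Reduction contexts are $$C ::= [-] \mid C+e \mid v+C \mid \alpha\cdot C \mid (C,e) \mid (v,C) \mid C=:=e \mid v=:=C \mid \mathtt{let}\ x=C\ \mathtt{in}\ e \mid \mathtt{let}\ (x,y)=C\ \mathtt{in}\ e.$$ A configuration is $\bot$, or a pair $(e,\psi)$ of a term $e$ with latent variables $z_1,\dots,z_r:R$ and a Gaussian distribution $\psi$ on $\mathbb R^r$ (given by mean and positive semidefinite covariance). The reductions are: - $(C[\mathrm{normal}()],\psi)\to(C[z_{r+1}],\psi\otimes\mathcal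 N(0,1))$; - $(C[\mathtt{let}\ x=v\ \mathtt{in}\ e],\psi)\to(C[e[v/x]],\psi)$ and $(C[\mathtt{let}\ (x,y)=(v,w)\ \mathtt{in}\ e],\psi)\to(C[e[v/x,w/y]],\psi)$; - for $X\sim\psi$ and $Z=v(X)-w(X)$: if $0$ lies in the support of $Z$, then $(C[v=:=w],\psi)\to(C[()],\psi|_{v=w})$, where $\psi|_{v=w}$ is the law of $X$ given $Z=0$, computed by the formula $\mu'=\mu_1+\Sigma_{12}\Sigma_{22}^+(a-\mu_2)$, $\Sigma'=\Sigma_{11}-\Sigma_{12}\Sigma_{22}^+\Sigma_{21}$ for $X_1\mid X_2=a$ with $(X_1,X_2)\sim\mathcal N(\mu,\Sigma)$ ($^+$ is the Moore–Penrose pseudoinverse; here $X_1=X$, $X_2=Z$, $a=0$); otherwise $(C[v=:=w],\psi)\to\bot$. Terms $\Gamma\vdash e_1,e_2:\tau$ are *contextually equivalent*, $e_1\approx e_2$, if for every well-typed program context $K[-]$ (a term with one hole, which may capture variables) such that $K[e_1],K[e_2]$ are closed, and all $i,j\in\{1,2\}$, where $!$ is the unique distribution on $\mathbb R^0$: if $(K[e_i],!)\to^*(v_i,\psi_i)$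 with $v_i$ a value, then $(K[e_j],!)\to^*(v_j,\psi_j)$ for some value $v_j$ and some $\psi_j$ with $(v_i)_*\psi_i=(v_j)_*\psi_j$; and if $(K[e_i],!)\to^*\bot$, then $(K[e_j],!)\to^*\bot$. **Denotational semantics.** The symmetric monoidal category $\mathsf{Gauss}$ has objects the spaces $\mathbb R^n$, tensor product $\mathbb R^m\otimes\mathbb R^n=\mathbb R^{m+n}$ with unit $I=\mathbb R^0$, and morphisms $\mathbb R^m\to\mathbb R^n$ the triples $(A,b,\Sigma)$, $\Sigma$ positive semidefinite, read as $x\mapsto Ax+b+\mathcal N(\Sigma)$; composition is $(A,b,\Sigma)\circ(C,d,\Xi)=(AC,Ad+b,A\Xi A^T+\Sigma)$, the tensor of morphisms is blockwise, and there are affine copy, delete and projection maps. For states $\mu,\nu:I\to X$, write $f=_\mu g$ if $\langle\mathrm{id},f\rangle\mu=\langle\mathrm{id},g\rangle\mu$, and $\mu\ll\nu$ if $f=_\nu g$ implies $f=_\mu g$ for all $f,g:X\to Y$. A conditional of $\psi:I\to X\otimes K$ is a morphism $\psi|_K:K\to X$ with $\langle\psi|_K,\mathrm{id}_K\rangle\psi_K=\psi$,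 where $\psi_K$ is the marginal on $K$. A morphism $X\rightsquigarrow Y$ of $\mathsf{Obs}(\mathsf{Gauss})$ is a triple $(K,f,o)$ with $f:X\to Y\otimes K$ in $\mathsf{Gauss}$ and $o\in K$ (a deterministic state). Composition is $(K',f',o')\bullet(K,f,o)=(K'\otimes K,(f'\otimes\mathrm{id}_K)f,o'\otimes o)$; the tensor product likewise combines the parts and collects the observations; $J(f)=(I,f,!)$; and the conditioning effect $(=:=o):K\rightsquigarrow I$ is $(K,\mathrm{id}_K,o)$. For states, $(K,\psi,o)\sim(K',\psi',o')$ means that either $o\ll\psi_K$, $o'\ll\psi'_{K'}$ and $\psi|_K(o)=\psi'|_{K'}(o')$, or $o\not\ll\psi_K$ and $o'\not\ll\psi'_{K'}$. For $f,g:X\rightsquigarrow Y$, $f\approx g$ means $(\mathrm{id}_A\otimes f)\bullet\psi\sim(\mathrm{id}_A\otimes g)\bullet\psi$ for all $A$ and all states $\psi:I\rightsquigarrow A\otimes X$. Then $\mathsf{Cond}(\mathsf{Gauss})=\mathsf{Obs}(\mathsf{Gauss})/{\approx}$. Types and contexts denote objects via $[\![R]\!]=\mathbb R$, $[\![I]\!]=\mathbb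 R^0$ and $\otimes$. A term $\Gamma\vdash e:\tau$ denotes a morphism $[\![e]\!]:[\![\Gamma]\!]\rightsquigarrow[\![\tau]\!]$ of $\mathsf{Cond}(\mathsf{Gauss})$, by the standard interpretation of variables, pairs and $\mathtt{let}$ through copying, deleting, tensor and composition, with $+$, $\alpha\cdot$, $\underline\beta$, $\mathrm{normal}()$ interpreted by the evident morphisms of $\mathsf{Gauss}$ (via $J$), and $s=:=t$ interpreted as $(s-t)=:=0$. **Proposition (Full abstraction).** For all terms $\Gamma\vdash e_1,e_2:\tau$: $[\![e_1]\!]=[\![e_2]\!]$ in $\mathsf{Cond}(\mathsf{Gauss})$ if and only if $e_1\approx e_2$. -/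

import Mathlib

noncomputable section

open Matrix

namespace GaussLang

/-! ## The Markov category `Gauss`

Objects are the affine spaces `ℝ^X` for finite index types `X`; `X = Fin n` is the object `n`.
The tensor product of `X` and `Y` is `X ⊕ Y` (as `ℝ^(X ⊕ Y) = ℝ^X × ℝ^Y`), and the unit is `Empty`
(as `ℝ^Empty` is the one-point space `ℝ^0`). -/

/-- A morphism `X → Y` of `Gauss`: the stochastic map `x ↦ A x + b + N(Σ)`, with `Σ` a positive
semidefinite covariance matrix. -/
@[ext]
structure GaussHom (X Y : Type) where
  A : Matrix Y X ℝ
  b : Y → ℝ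
  cov : Matrix Y Y ℝ
  psd : cov.PosSemidef

/-- A Gaussian distribution on `ℝ^X`, given by its mean `b` and its covariance matrix `cov`, is a
state of `Gauss`, that is a morphism from the unit (the matrix `A` then has no entries). -/
abbrev State (X : Type) := GaussHom Empty X

namespace GaussHom

/-- The deterministic morphism `x ↦ A x + b`. -/
def affine {X Y : Type} (A : Matrix Y X ℝ) (b : Y → ℝ) : GaussHom X Y where
  A := A
  b := b
  cov := 0
  psd := PosSemidef.zero

/-- The deterministic state at the point `o`. -/
def point {X : Type} (o : X → ℝ) : State X := affine 0 o

/-- The deterministic linear map `ℝ^X → ℝ^Y`, `x ↦ x ∘ σ`. All structural maps (identities,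
symmetries, copying, deleting, projections, reassociations) are of this form. -/
def reindex {X Y : Type} [DecidableEq X] (σ : Y → X) : GaussHom X Y :=
  affine (Matrix.of fun y x => if σ y = x then 1 else 0) 0

protected def id (X : Type) [DecidableEq X] : GaussHom X X := reindex (fun x => x)

/-- Sequential composition `g ∘ f`. -/
def comp {X Y Z : Type} [Fintype Y] [Fintype Z] (g : GaussHom Y Z) (f : GaussHom X Y) :
    GaussHom X Z where
  A := g.A * f.A
  b := g.A *ᵥ f.b + g.b
  cov := g.A * f.cov * g.Aᵀ + g.cov
  psd := by
    have h := f.psd.mul_mul_conjTranspose_same g.A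
    rw [conjTranspose_eq_transpose_of_trivial] at h
    exact h.add g.psd

theorem posSemidef_fromBlocks {X Y : Type} [Fintype X] [Fintype Y] {S : Matrix X X ℝ}
    {T : Matrix Y Y ℝ} (hS : S.PosSemidef) (hT : T.PosSemidef) :
    (fromBlocks S 0 0 T).PosSemidef := by
  rw [posSemidef_iff_dotProduct_mulVec] at hS hT ⊢
  refine ⟨?_, fun x => ?_⟩
  · rw [isHermitian_fromBlocks_iff]
    exact ⟨hS.1, by simp, by simp, hT.1⟩
  · have h1 := hS.2 (x ∘ Sum.inl)
    have h2 := hT.2 (x ∘ Sum.inr)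
    have h3 : star x = Sum.elim (star (x ∘ Sum.inl)) (star (x ∘ Sum.inr)) := by
      ext i; cases i <;> rfl
    rw [fromBlocks_mulVec, h3, sumElim_dotProduct_sumElim]
    simpa using add_nonneg h1 h2

/-- Parallel composition `f ⊗ g`. -/
def tensor {X Y X' Y' : Type} [Fintype Y] [Fintype Y'] (f : GaussHom X Y) (g : GaussHom X' Y') :
    GaussHom (X ⊕ X') (Y ⊕ Y') where
  A := fromBlocks f.A 0 0 g.A
  b := Sum.elim f.b g.b
  cov := fromBlocks f.cov 0 0 g.cov
  psd := posSemidef_fromBlocks f.psd g.psd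

/-- `copy : X → X ⊗ X`, `x ↦ (x, x)`. -/
def copy (X : Type) [DecidableEq X] : GaussHom X (X ⊕ X) :=
  reindex (Sum.elim (fun x => x) (fun x => x))

/-- `del : X → I`, `x ↦ ()`. -/
def del (X : Type) [DecidableEq X] : GaussHom X Empty := reindex Empty.elim

/-- Projections `X ⊗ Y → X` and `X ⊗ Y → Y`. -/
def proj₁ (X Y : Type) [DecidableEq X] [DecidableEq Y] : GaussHom (X ⊕ Y) X := reindex Sum.inl
def proj₂ (X Y : Type) [DecidableEq X] [DecidableEq Y] : GaussHom (X ⊕ Y) Y := reindex Sum.inr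

/-- Tupling `⟨f, g⟩ = (f ⊗ g) ∘ copy`. -/
def tuple {X Y Z : Type} [Fintype X] [DecidableEq X] [Fintype Y] [Fintype Z]
    (f : GaussHom X Y) (g : GaussHom X Z) : GaussHom X (Y ⊕ Z) :=
  (f.tensor g).comp (copy X)

/-- The standard normal distribution `N(1) : I → R`. -/
def stdNormal : State Unit where
  A := 0
  b := 0
  cov := 1
  psd := PosSemidef.one

/-- Addition, subtraction and scaling on `R = ℝ^Unit`, and constants. -/
def addHom : GaussHom (Unit ⊕ Unit) Unit := affine (fromCols 1 1) 0
def subHom : GaussHom (Unit ⊕ Unit) Unit := affine (fromCols 1 (-1)) 0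
def smulHom (α : ℝ) : GaussHom Unit Unit := affine (α • 1) 0
def constHom (β : ℝ) : State Unit := point (fun _ => β)

/-- `f =_μ g`: almost sure equality with respect to `μ`. -/
def AEEq {X Y : Type} [Fintype X] [DecidableEq X] [Fintype Y]
    (μ : State X) (f g : GaussHom X Y) : Prop :=
  ((GaussHom.id X).tuple f).comp μ = ((GaussHom.id X).tuple g).comp μ

/-- `μ ≪ ν`: every `ν`-almost sure equality of parallel morphisms is a `μ`-almost sure equality. -/
def AbsCont {X : Type} [Fintype X] [DecidableEq X] (μ ν : State X) : Prop :=
  ∀ (Y : Type) [Fintype Y] (f g : GaussHom X Y), AEEq ν f g → AEEq μ f g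

/-- The marginal on `K` of a distribution on `X ⊗ K`. -/
def marginal₂ {X K : Type} [Fintype X] [DecidableEq X] [Fintype K] [DecidableEq K]
    (ψ : State (X ⊕ K)) : State K :=
  (proj₂ X K).comp ψ

/-- `c : K → X` is a conditional distribution of `ψ : I → X ⊗ K` with respect to `K`: sampling `k`
from the marginal `ψ_K` and then `x` from `c k` gives `(x, k)` the joint distribution `ψ`. -/
def IsConditional {X K : Type} [Fintype X] [DecidableEq X] [Fintype K] [DecidableEq K]
    (ψ : State (X ⊕ K)) (c : GaussHom K X) : Prop :=
  (c.tuple (GaussHom.id K)).comp (marginal₂ ψ) = ψ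

theorem tuple_eq {X Y Z : Type} [Fintype X] [DecidableEq X] [Fintype Y] [Fintype Z]
    (f : GaussHom X Y) (g : GaussHom X Z) :
    f.tuple g = ⟨fromRows f.A g.A, Sum.elim f.b g.b, fromBlocks f.cov 0 0 g.cov,
      posSemidef_fromBlocks f.psd g.psd⟩ := by
  have h : (copy X).A = fromRows 1 1 := by
    ext i j
    rcases i with i | i <;> simp [copy, reindex, affine, Matrix.one_apply] <;> rfl
  ext1
  · simp [tuple, comp, tensor, h, fromBlocks_mul_fromRows]
  · simp [tuple, comp, tensor, copy, reindex, affine]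
  · simp [tuple, comp, tensor, copy, reindex, affine]

theorem marginal₂_b {X K : Type} [Fintype X] [DecidableEq X] [Fintype K] [DecidableEq K]
    (ψ : State (X ⊕ K)) : (marginal₂ ψ).b = ψ.b ∘ Sum.inr := by
  ext k
  simp [marginal₂, proj₂, reindex, comp, affine, mulVec, dotProduct]

theorem marginal₂_cov {X K : Type} [Fintype X] [DecidableEq X] [Fintype K] [DecidableEq K]
    (ψ : State (X ⊕ K)) : (marginal₂ ψ).cov = ψ.cov.toBlocks₂₂ := by
  ext k l
  simp [marginal₂, proj₂, reindex, comp, affine, Matrix.mul_apply, toBlocks₂₂]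

theorem exists_mul_eq {X K : Type} [Fintype X] [DecidableEq X] [Fintype K] [DecidableEq K]
    (S : Matrix (X ⊕ K) (X ⊕ K) ℝ) (hS : S.PosSemidef) :
    ∃ M : Matrix X K ℝ, M * S.toBlocks₂₂ = S.toBlocks₁₂ := by
  obtain ⟨B, hB⟩ : ∃ B : Matrix (X ⊕ K) (X ⊕ K) ℝ, S = Bᵀ * B := by
    open scoped MatrixOrder ComplexOrder in
    obtain ⟨B, hB⟩ := (CStarAlgebra.nonneg_iff_eq_star_mul_self (a := S)).1 hS.nonneg
    exact ⟨B, by rw [hB, star_eq_conjTranspose, conjTranspose_eq_transpose_of_trivial]⟩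
  set C : Matrix (X ⊕ K) K ℝ := B.submatrix _root_.id Sum.inr with hC
  set D : Matrix (X ⊕ K) X ℝ := B.submatrix _root_.id Sum.inl with hD
  have h22 : S.toBlocks₂₂ = Cᵀ * C := by
    ext i j; simp [hB, hC, toBlocks₂₂, mul_apply]
  have h12 : S.toBlocks₁₂ = Dᵀ * C := by
    ext i j; simp [hB, hC, hD, toBlocks₁₂, mul_apply]
  have hr : LinearMap.range (Cᵀ * C).mulVecLin = LinearMap.range Cᵀ.mulVecLin := by
    apply Submodule.eq_of_le_of_finrank_eq
    · rw [mulVecLin_mul]; exact LinearMap.range_comp_le_range _ _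
    · have h1 := rank_transpose_mul_self C
      have h2 := rank_transpose C
      unfold Matrix.rank at h1 h2
      rw [h1, ← h2]
  have hcol : ∀ x : X, ∃ m : K → ℝ, (Cᵀ * C) *ᵥ m = Cᵀ *ᵥ (fun i => D i x) := by
    intro x
    have : Cᵀ.mulVecLin (fun i => D i x) ∈ LinearMap.range (Cᵀ * C).mulVecLin := by
      rw [hr]; exact ⟨_, rfl⟩
    exact this
  choose m hm using hcol
  refine ⟨Matrix.of m, ?_⟩
  rw [h22, h12, ← transpose_inj]
  rw [transpose_mul, transpose_mul, transpose_mul, transpose_transpose, transpose_transpose]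
  ext k x
  have := congrFun (hm x) k
  simpa [mul_apply, mulVec, dotProduct] using this

theorem exists_isConditional {X K : Type} [Fintype X] [DecidableEq X] [Fintype K] [DecidableEq K]
    (ψ : State (X ⊕ K)) : ∃ c : GaussHom K X, IsConditional ψ c := by
  obtain ⟨M, hM⟩ := exists_mul_eq ψ.cov ψ.psd
  have hsymm : ψ.covᵀ = ψ.cov := by
    simpa [conjTranspose_eq_transpose_of_trivial] using ψ.psd.1.eq
  have h21 : ψ.cov.toBlocks₁₂ᵀ = ψ.cov.toBlocks₂₁ := by
    ext i j; exact congrFun (congrFun hsymm _) _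
  have h22 : ψ.cov.toBlocks₂₂ᵀ = ψ.cov.toBlocks₂₂ := by
    ext i j; exact congrFun (congrFun hsymm _) _
  have hM' : ψ.cov.toBlocks₂₂ * Mᵀ = ψ.cov.toBlocks₂₁ := by
    rw [← h21, ← hM, transpose_mul, h22]
  have hpsd : (ψ.cov.toBlocks₁₁ - M * ψ.cov.toBlocks₂₁).PosSemidef := by
    have h := ψ.psd.mul_mul_conjTranspose_same (fromCols (1 : Matrix X X ℝ) (-M))
    rw [conjTranspose_eq_transpose_of_trivial, ← fromBlocks_toBlocks ψ.cov,
      fromCols_mul_fromBlocks, transpose_fromCols, fromCols_mul_fromRows] at h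
    convert h using 1
    simp [hM, sub_eq_add_neg]
  refine ⟨⟨M, ψ.b ∘ Sum.inl - M *ᵥ (ψ.b ∘ Sum.inr), _, hpsd⟩, ?_⟩
  rw [IsConditional, tuple_eq]
  have hid : (GaussHom.id K).A = 1 := by ext i j; simp [GaussHom.id, reindex, affine, one_apply]
  ext1
  · ext i j; exact j.elim
  · simp only [comp, marginal₂_b, hid, fromRows_mulVec]
    ext i; rcases i with i | i <;> simp [GaussHom.id, reindex, affine]
  · simp only [comp, marginal₂_cov, hid]
    conv_rhs => rw [← fromBlocks_toBlocks ψ.cov]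
    rw [fromRows_mul, transpose_fromRows, fromRows_mul_fromCols, fromBlocks_add, hM]
    simp [GaussHom.id, reindex, affine, hM', ← hM, Matrix.mul_assoc]

/-- The conditional distribution `ψ|_K : K → X` of `ψ : I → X ⊗ K`. It is unique up to
`ψ_K`-almost sure equality, so that its value at a point `o ≪ ψ_K` does not depend on the choice. -/
def conditional {X K : Type} [Fintype X] [DecidableEq X] [Fintype K] [DecidableEq K]
    (ψ : State (X ⊕ K)) : GaussHom K X :=
  Classical.choose (exists_isConditional ψ)

/-- The support `b + col(Σ)` of a Gaussian distribution. -/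
def support {X : Type} [Fintype X] (ψ : State X) : Set (X → ℝ) :=
  {x | ∃ y : X → ℝ, x = ψ.b + ψ.cov *ᵥ y}

end GaussHom

/-! ## `Obs(Gauss)` and `Cond(Gauss)` -/

/-- A morphism `X ⇝ Y` of `Obs(Gauss)`: a morphism `f : X → Y ⊗ K` together with an observation
`o`, a deterministic state of `K`. It stands for `let (y, k) = f(x) in (k =:= o); y`. -/
structure ObsHom (X Y : Type) : Type 1 where
  K : Type
  [fintypeK : Fintype K]
  [decEqK : DecidableEq K]
  f : GaussHom X (Y ⊕ K)
  o : K → ℝ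

attribute [instance] ObsHom.fintypeK ObsHom.decEqK

namespace ObsHom

/-- The functor `J : Gauss → Obs(Gauss)`, `f ↦ (I, f, !)`. -/
def J {X Y : Type} [Fintype Y] [DecidableEq Y] (f : GaussHom X Y) : ObsHom X Y where
  K := Empty
  f := (GaussHom.reindex (Sum.elim (fun y => y) Empty.elim)).comp f
  o := Empty.elim

protected def id (X : Type) [Fintype X] [DecidableEq X] : ObsHom X X := J (GaussHom.id X)

/-- Composition `(K', f', o') • (K, f, o) = (K' ⊗ K, (f' ⊗ id_K) f, o' ⊗ o)`; the `reindex` is the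
associator `(Z ⊗ K') ⊗ K → Z ⊗ (K' ⊗ K)`. -/
def comp {X Y Z : Type} [Fintype Y] [DecidableEq Y] [Fintype Z] [DecidableEq Z]
    (g : ObsHom Y Z) (f : ObsHom X Y) : ObsHom X Z where
  K := g.K ⊕ f.K
  f := (GaussHom.reindex (Sum.elim (fun z => Sum.inl (Sum.inl z))
      (Sum.elim (fun k => Sum.inl (Sum.inr k)) (fun k => Sum.inr k)))).comp
    ((g.f.tensor (GaussHom.id f.K)).comp f.f)
  o := Sum.elim g.o f.o

/-- Tensor product; the `reindex` is the symmetry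
`(Y ⊗ K) ⊗ (Y' ⊗ K') → (Y ⊗ Y') ⊗ (K ⊗ K')`. -/
def tensor {X Y X' Y' : Type} [Fintype Y] [DecidableEq Y] [Fintype Y'] [DecidableEq Y']
    (f : ObsHom X Y) (g : ObsHom X' Y') : ObsHom (X ⊕ X') (Y ⊕ Y') where
  K := f.K ⊕ g.K
  f := (GaussHom.reindex (Sum.elim
      (Sum.elim (fun y => Sum.inl (Sum.inl y)) (fun y => Sum.inr (Sum.inl y)))
      (Sum.elim (fun k => Sum.inl (Sum.inr k)) (fun k => Sum.inr (Sum.inr k))))).comp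
    (f.f.tensor g.f)
  o := Sum.elim f.o g.o

/-- The conditioning effect `(=:= o) : K ⇝ I`, given by `(K, id_K, o)`. -/
def observe {K : Type} [Fintype K] [DecidableEq K] (o : K → ℝ) : ObsHom K Empty where
  K := K
  f := GaussHom.reindex (Sum.elim Empty.elim (fun k => k))
  o := o

/-- Tupling `(f ⊗ g) • copy`. -/
def tuple {X Y Z : Type} [Fintype X] [DecidableEq X] [Fintype Y] [DecidableEq Y]
    [Fintype Z] [DecidableEq Z] (f : ObsHom X Y) (g : ObsHom X Z) : ObsHom X (Y ⊕ Z) :=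
  (f.tensor g).comp (J (GaussHom.copy X))

/-- A state `(K, ψ, o)` succeeds if `o ≪ ψ_K`. -/
def Succeeds {X : Type} [Fintype X] [DecidableEq X] (s : ObsHom Empty X) : Prop :=
  GaussHom.AbsCont (GaussHom.point s.o) (GaussHom.marginal₂ s.f)

/-- The posterior `ψ|_K(o)` of a state `(K, ψ, o)` (meaningful if the state succeeds). -/
def posterior {X : Type} [Fintype X] [DecidableEq X] (s : ObsHom Empty X) : State X :=
  (GaussHom.conditional s.f).comp (GaussHom.point s.o)

/-- The relation `∼` on states: both fail, or both succeed with equal posterior. -/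
def StateEquiv {X : Type} [Fintype X] [DecidableEq X] (s t : ObsHom Empty X) : Prop :=
  (s.Succeeds ∧ t.Succeeds ∧ s.posterior = t.posterior) ∨ (¬ s.Succeeds ∧ ¬ t.Succeeds)

/-- The relation `≈` on morphisms: `(id_A ⊗ f) • ψ ∼ (id_A ⊗ g) • ψ` for all states
`ψ : I ⇝ A ⊗ X`. -/
def Equivalent {X Y : Type} [Fintype X] [DecidableEq X] [Fintype Y] [DecidableEq Y]
    (f g : ObsHom X Y) : Prop :=
  ∀ (A : Type) [Fintype A] [DecidableEq A] (ψ : ObsHom Empty (A ⊕ X)),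
    StateEquiv (((ObsHom.id A).tensor f).comp ψ) (((ObsHom.id A).tensor g).comp ψ)

instance condSetoid (X Y : Type) [Fintype X] [DecidableEq X] [Fintype Y] [DecidableEq Y] :
    Setoid (ObsHom X Y) where
  r := Equivalent
  iseqv :=
    { refl := fun f A _ _ ψ => by unfold StateEquiv; tauto
      symm := fun h A _ _ ψ => by
        have h' := h A ψ
        unfold StateEquiv at *
        rcases h' with ⟨h1, h2, h3⟩ | h'
        · exact Or.inl ⟨h2, h1, h3.symm⟩
        · exact Or.inr h'.symm
      trans := fun h k A _ _ ψ => by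
        have h' := h A ψ
        have k' := k A ψ
        unfold StateEquiv at *
        rcases h' with ⟨h1, h2, h3⟩ | ⟨h1, h2⟩ <;> rcases k' with ⟨k1, k2, k3⟩ | ⟨k1, k2⟩
        · exact Or.inl ⟨h1, k2, h3.trans k3⟩
        · exact absurd h2 k1
        · exact absurd k1 h2
        · exact Or.inr ⟨h1, k2⟩ }

end ObsHom

/-- The morphisms `X ⇝ Y` of `Cond(Gauss) = Obs(Gauss)/≈`. -/
def CondHom (X Y : Type) [Fintype X] [DecidableEq X] [Fintype Y] [DecidableEq Y] : Type 1 :=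
  Quotient (ObsHom.condSetoid X Y)

/-! ## The Gaussian language

Terms are intrinsically typed, with de Bruijn indices for variables: in a context
`τ :: Γ`, the variable `zero` is the most recently bound one. -/

inductive Ty : Type
  | rv : Ty
  | unit : Ty
  | prod : Ty → Ty → Ty

abbrev Cxt : Type := List Ty

inductive Var : Cxt → Ty → Type
  | zero {Γ : Cxt} {τ : Ty} : Var (τ :: Γ) τ
  | succ {Γ : Cxt} {τ σ : Ty} : Var Γ τ → Var (σ :: Γ) τ

/-- `Tm Γ τ` is the type of terms `Γ ⊢ e : τ`. In `letPair s t`, that is `let (x, y) = s in t`,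
the variable `y` is the most recently bound one in `t`. -/
inductive Tm : Cxt → Ty → Type
  | var {Γ : Cxt} {τ : Ty} : Var Γ τ → Tm Γ τ
  | add {Γ : Cxt} : Tm Γ .rv → Tm Γ .rv → Tm Γ .rv
  | smul {Γ : Cxt} : ℝ → Tm Γ .rv → Tm Γ .rv
  | const {Γ : Cxt} : ℝ → Tm Γ .rv
  | pair {Γ : Cxt} {σ τ : Ty} : Tm Γ σ → Tm Γ τ → Tm Γ (.prod σ τ)
  | star {Γ : Cxt} : Tm Γ .unit
  | letIn {Γ : Cxt} {σ τ : Ty} : Tm Γ σ → Tm (σ :: Γ) τ → Tm Γ τ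
  | letPair {Γ : Cxt} {σ σ' τ : Ty} : Tm Γ (.prod σ σ') → Tm (σ' :: σ :: Γ) τ → Tm Γ τ
  | normal {Γ : Cxt} : Tm Γ .rv
  | cond {Γ : Cxt} : Tm Γ .rv → Tm Γ .rv → Tm Γ .unit

/-- Renamings, in particular weakenings, of variables. -/
def Ren (Γ Δ : Cxt) : Type := ∀ τ : Ty, Var Γ τ → Var Δ τ

def Ren.lift {Γ Δ : Cxt} (ρ : Ren Γ Δ) (σ : Ty) : Ren (σ :: Γ) (σ :: Δ)
  | _, .zero => .zero
  | _, .succ x => .succ (ρ _ x)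

def Ren.weaken (Γ : Cxt) (σ : Ty) : Ren Γ (σ :: Γ) := fun _ x => .succ x

def Tm.rename : {Γ Δ : Cxt} → {τ : Ty} → Ren Γ Δ → Tm Γ τ → Tm Δ τ
  | _, _, _, ρ, .var x => .var (ρ _ x)
  | _, _, _, ρ, .add s t => .add (s.rename ρ) (t.rename ρ)
  | _, _, _, ρ, .smul α t => .smul α (t.rename ρ)
  | _, _, _, _, .const β => .const β
  | _, _, _, ρ, .pair s t => .pair (s.rename ρ) (t.rename ρ)
  | _, _, _, _, .star => .star
  | _, _, _, ρ, .letIn s t => .letIn (s.rename ρ) (t.rename (ρ.lift _))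
  | _, _, _, ρ, .letPair s t => .letPair (s.rename ρ) (t.rename ((ρ.lift _).lift _))
  | _, _, _, _, .normal => .normal
  | _, _, _, ρ, .cond s t => .cond (s.rename ρ) (t.rename ρ)

/-- Simultaneous capture-avoiding substitutions. -/
def Sub (Γ Δ : Cxt) : Type := ∀ τ : Ty, Var Γ τ → Tm Δ τ

def Sub.lift {Γ Δ : Cxt} (θ : Sub Γ Δ) (σ : Ty) : Sub (σ :: Γ) (σ :: Δ)
  | _, .zero => .var .zero
  | _, .succ x => (θ _ x).rename (Ren.weaken Δ σ)

def Sub.id (Γ : Cxt) : Sub Γ Γ := fun _ x => .var x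

/-- The substitution extended by `e` for the most recently bound variable. -/
def Sub.cons {Γ Δ : Cxt} {σ : Ty} (e : Tm Δ σ) (θ : Sub Γ Δ) : Sub (σ :: Γ) Δ
  | _, .zero => e
  | _, .succ x => θ _ x

def Tm.subst : {Γ Δ : Cxt} → {τ : Ty} → Sub Γ Δ → Tm Γ τ → Tm Δ τ
  | _, _, _, θ, .var x => θ _ x
  | _, _, _, θ, .add s t => .add (s.subst θ) (t.subst θ)
  | _, _, _, θ, .smul α t => .smul α (t.subst θ)
  | _, _, _, _, .const β => .const β
  | _, _, _, θ, .pair s t => .pair (s.subst θ) (t.subst θ)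
  | _, _, _, _, .star => .star
  | _, _, _, θ, .letIn s t => .letIn (s.subst θ) (t.subst (θ.lift _))
  | _, _, _, θ, .letPair s t => .letPair (s.subst θ) (t.subst ((θ.lift _).lift _))
  | _, _, _, _, .normal => .normal
  | _, _, _, θ, .cond s t => .cond (s.subst θ) (t.subst θ)

/-- Program contexts `K[-] : τ'` in scope `Δ` with one hole for a term `Γ ⊢ e : τ`. The hole may
lie in a scope `Δ'` with more variables than `Γ`; the renaming `ρ : Ren Γ Δ'` says which of
the variables in that scope the free variables of `e` are. -/
inductive PCxt (Γ : Cxt) (τ : Ty) : Cxt → Ty → Type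
  | hole {Δ' : Cxt} (ρ : Ren Γ Δ') : PCxt Γ τ Δ' τ
  | addL {Δ : Cxt} : PCxt Γ τ Δ .rv → Tm Δ .rv → PCxt Γ τ Δ .rv
  | addR {Δ : Cxt} : Tm Δ .rv → PCxt Γ τ Δ .rv → PCxt Γ τ Δ .rv
  | smul {Δ : Cxt} : ℝ → PCxt Γ τ Δ .rv → PCxt Γ τ Δ .rv
  | pairL {Δ : Cxt} {σ σ' : Ty} : PCxt Γ τ Δ σ → Tm Δ σ' → PCxt Γ τ Δ (.prod σ σ')
  | pairR {Δ : Cxt} {σ σ' : Ty} : Tm Δ σ → PCxt Γ τ Δ σ' → PCxt Γ τ Δ (.prod σ σ')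
  | letInL {Δ : Cxt} {σ τ' : Ty} : PCxt Γ τ Δ σ → Tm (σ :: Δ) τ' → PCxt Γ τ Δ τ'
  | letInR {Δ : Cxt} {σ τ' : Ty} : Tm Δ σ → PCxt Γ τ (σ :: Δ) τ' → PCxt Γ τ Δ τ'
  | letPairL {Δ : Cxt} {σ σ' τ' : Ty} :
      PCxt Γ τ Δ (.prod σ σ') → Tm (σ' :: σ :: Δ) τ' → PCxt Γ τ Δ τ'
  | letPairR {Δ : Cxt} {σ σ' τ' : Ty} :
      Tm Δ (.prod σ σ') → PCxt Γ τ (σ' :: σ :: Δ) τ' → PCxt Γ τ Δ τ'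
  | condL {Δ : Cxt} : PCxt Γ τ Δ .rv → Tm Δ .rv → PCxt Γ τ Δ .unit
  | condR {Δ : Cxt} : Tm Δ .rv → PCxt Γ τ Δ .rv → PCxt Γ τ Δ .unit

/-- `K[e]`. The free variables of `e` are captured by the binders of `K`. -/
def PCxt.plug {Γ : Cxt} {τ : Ty} (e : Tm Γ τ) : {Δ : Cxt} → {τ' : Ty} → PCxt Γ τ Δ τ' → Tm Δ τ'
  | _, _, .hole ρ => e.rename ρ
  | _, _, .addL K t => .add (K.plug e) t
  | _, _, .addR s K => .add s (K.plug e)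
  | _, _, .smul α K => .smul α (K.plug e)
  | _, _, .pairL K t => .pair (K.plug e) t
  | _, _, .pairR s K => .pair s (K.plug e)
  | _, _, .letInL K t => .letIn (K.plug e) t
  | _, _, .letInR s K => .letIn s (K.plug e)
  | _, _, .letPairL K t => .letPair (K.plug e) t
  | _, _, .letPairR s K => .letPair s (K.plug e)
  | _, _, .condL K t => .cond (K.plug e) t
  | _, _, .condR s K => .cond s (K.plug e)

/-! ## Types and contexts as objects of `Gauss` -/

/-- The index set of the object interpreting a type: `R` is `ℝ^1`, the unit type is `ℝ^0`, and
`σ * τ` is the tensor product. -/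
def Ty.Idx : Ty → Type
  | .rv => Unit
  | .unit => Empty
  | .prod σ τ => σ.Idx ⊕ τ.Idx

instance Ty.instFintypeIdx : (τ : Ty) → Fintype τ.Idx
  | .rv => inferInstanceAs (Fintype Unit)
  | .unit => inferInstanceAs (Fintype Empty)
  | .prod σ τ =>
    letI := Ty.instFintypeIdx σ
    letI := Ty.instFintypeIdx τ
    inferInstanceAs (Fintype (σ.Idx ⊕ τ.Idx))

instance Ty.instDecidableEqIdx : (τ : Ty) → DecidableEq τ.Idx
  | .rv => inferInstanceAs (DecidableEq Unit)
  | .unit => inferInstanceAs (DecidableEq Empty)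
  | .prod σ τ =>
    letI := Ty.instDecidableEqIdx σ
    letI := Ty.instDecidableEqIdx τ
    inferInstanceAs (DecidableEq (σ.Idx ⊕ τ.Idx))

/-- The index set of the object interpreting a context, the tensor product of its types. -/
def CIdx : Cxt → Type
  | [] => Empty
  | τ :: Γ => τ.Idx ⊕ CIdx Γ

instance CIdx.instFintype : (Γ : Cxt) → Fintype (CIdx Γ)
  | [] => inferInstanceAs (Fintype Empty)
  | τ :: Γ =>
    letI := CIdx.instFintype Γ
    inferInstanceAs (Fintype (τ.Idx ⊕ CIdx Γ))

instance CIdx.instDecidableEq : (Γ : Cxt) → DecidableEq (CIdx Γ)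
  | [] => inferInstanceAs (DecidableEq Empty)
  | τ :: Γ =>
    letI := CIdx.instDecidableEq Γ
    inferInstanceAs (DecidableEq (τ.Idx ⊕ CIdx Γ))

/-- The coordinates of a variable among those of its context. -/
def Var.coord : {Γ : Cxt} → {τ : Ty} → Var Γ τ → τ.Idx → CIdx Γ
  | _, _, .zero => fun i => Sum.inl i
  | _, _, .succ x => fun i => Sum.inr (x.coord i)

/-! ## Denotational semantics -/

/-- The call-by-value interpretation of terms by the copy-delete structure, the affine maps, the
standard normal state and the conditioning effect `(=:= 0)`; here `s =:= t` is translated as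
`(s - t) =:= 0`. -/
def Tm.interp : {Γ : Cxt} → {τ : Ty} → Tm Γ τ → ObsHom (CIdx Γ) τ.Idx
  | _, _, .var x => .J (GaussHom.reindex x.coord)
  | _, _, .add s t => (ObsHom.J GaussHom.addHom).comp (s.interp.tuple t.interp)
  | _, _, .smul α t => (ObsHom.J (GaussHom.smulHom α)).comp t.interp
  | Γ, _, .const β => .J ((GaussHom.constHom β).comp (GaussHom.del (CIdx Γ)))
  | _, _, .pair s t => s.interp.tuple t.interp
  | Γ, _, .star => .J (GaussHom.del (CIdx Γ))
  | Γ, _, .letIn s t => t.interp.comp (s.interp.tuple (ObsHom.id (CIdx Γ)))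
  | Γ, _, .letPair (σ := σ) (σ' := σ') s t =>
    t.interp.comp ((ObsHom.J (GaussHom.reindex (X := (σ.Idx ⊕ σ'.Idx) ⊕ CIdx Γ)
        (Y := σ'.Idx ⊕ (σ.Idx ⊕ CIdx Γ))
        (Sum.elim (fun j => Sum.inl (Sum.inr j))
          (Sum.elim (fun i => Sum.inl (Sum.inl i)) (fun k => Sum.inr k))))).comp
      (s.interp.tuple (ObsHom.id (CIdx Γ))))
  | Γ, _, .normal => .J (GaussHom.stdNormal.comp (GaussHom.del (CIdx Γ)))
  | _, _, .cond s t =>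
    (ObsHom.observe 0).comp ((ObsHom.J GaussHom.subHom).comp (s.interp.tuple t.interp))

/-- The denotation `⟦e⟧ : ⟦Γ⟧ ⇝ ⟦τ⟧` of a term in `Cond(Gauss)`. All structure of `Cond(Gauss)` is
that of `Obs(Gauss)` on representatives, so `⟦e⟧` is the class of the interpretation of `e` in
`Obs(Gauss)`. -/
def Tm.denote {Γ : Cxt} {τ : Ty} (e : Tm Γ τ) : CondHom (CIdx Γ) τ.Idx :=
  Quotient.mk (ObsHom.condSetoid (CIdx Γ) τ.Idx) e.interp

/-! ## Operational semantics -/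

inductive Val (Γ : Cxt) : Ty → Type
  | var {τ : Ty} : Var Γ τ → Val Γ τ
  | pair {σ τ : Ty} : Val Γ σ → Val Γ τ → Val Γ (.prod σ τ)
  | add : Val Γ .rv → Val Γ .rv → Val Γ .rv
  | smul : ℝ → Val Γ .rv → Val Γ .rv
  | const : ℝ → Val Γ .rv
  | star : Val Γ .unit

def Val.toTm {Γ : Cxt} : {τ : Ty} → Val Γ τ → Tm Γ τ
  | _, .var x => .var x
  | _, .pair v w => .pair v.toTm w.toTm
  | _, .add v w => .add v.toTm w.toTm
  | _, .smul α v => .smul α v.toTm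
  | _, .const β => .const β
  | _, .star => .star

def Val.rename {Γ Δ : Cxt} (ρ : Ren Γ Δ) : {τ : Ty} → Val Γ τ → Val Δ τ
  | _, .var x => .var (ρ _ x)
  | _, .pair v w => .pair (v.rename ρ) (w.rename ρ)
  | _, .add v w => .add (v.rename ρ) (w.rename ρ)
  | _, .smul α v => .smul α (v.rename ρ)
  | _, .const β => .const β
  | _, .star => .star

/-- The affine function `x ↦ A x + b` on `⟦Γ⟧` defined by a value: its linear part `A`. -/
def Val.lin {Γ : Cxt} : {τ : Ty} → Val Γ τ → Matrix τ.Idx (CIdx Γ) ℝ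
  | _, .var x => Matrix.of fun i j => if x.coord i = j then 1 else 0
  | _, .pair v w => fromRows v.lin w.lin
  | _, .add v w => v.lin + w.lin
  | _, .smul α v => α • v.lin
  | _, .const _ => 0
  | _, .star => 0

/-- The affine function `x ↦ A x + b` on `⟦Γ⟧` defined by a value: its offset `b`. -/
def Val.off {Γ : Cxt} : {τ : Ty} → Val Γ τ → τ.Idx → ℝ
  | _, .var _ => 0
  | _, .pair v w => Sum.elim v.off w.off
  | _, .add v w => v.off + w.off
  | _, .smul α v => α • v.off
  | _, .const β => fun _ => β
  | _, .star => 0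

/-- The pushforward `v_* ψ` of a distribution along a value. -/
def Val.pushforward {Γ : Cxt} {τ : Ty} (v : Val Γ τ) (ψ : State (CIdx Γ)) : State τ.Idx :=
  (GaussHom.affine v.lin v.off).comp ψ

/-- The Moore-Penrose pseudoinverse of a `1 × 1` matrix (recall `0⁻¹ = 0`). -/
def pinv (S : Matrix Unit Unit ℝ) : Matrix Unit Unit ℝ := Matrix.of fun i j => (S i j)⁻¹

theorem pinv_spec (S : Matrix Unit Unit ℝ) :
    S * pinv S * S = S ∧ pinv S * S * pinv S = pinv S ∧
      (S * pinv S)ᵀ = S * pinv S ∧ (pinv S * S)ᵀ = pinv S * S := by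
  refine ⟨?_, ?_, ?_, ?_⟩ <;> ext ⟨⟩ ⟨⟩
  · simp [pinv, mul_apply]
  · rcases eq_or_ne (S () ()) 0 with h | h <;> simp [pinv, mul_apply, h]
  · simp
  · simp

theorem conjugate_psd {X : Type} [Fintype X] [DecidableEq X] (S : Matrix (X ⊕ Unit) (X ⊕ Unit) ℝ)
    (hS : S.PosSemidef) :
    (S.toBlocks₁₁ - S.toBlocks₁₂ * pinv S.toBlocks₂₂ * S.toBlocks₂₁).PosSemidef := by
  have hsymm : Sᵀ = S := by
    simpa [conjTranspose_eq_transpose_of_trivial] using hS.1.eq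
  have h12 : S.toBlocks₁₂ᵀ = S.toBlocks₂₁ := by
    ext i j; exact congrFun (congrFun hsymm _) _
  have hp : (pinv S.toBlocks₂₂)ᵀ = pinv S.toBlocks₂₂ := by ext i j; rfl
  have hpsp := (pinv_spec S.toBlocks₂₂).2.1
  have h := hS.mul_mul_conjTranspose_same
    (fromCols (1 : Matrix X X ℝ) (-(S.toBlocks₁₂ * pinv S.toBlocks₂₂)))
  rw [conjTranspose_eq_transpose_of_trivial, ← fromBlocks_toBlocks S,
    fromCols_mul_fromBlocks, transpose_fromCols, fromCols_mul_fromRows] at h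
  convert h using 1
  have hz : S.toBlocks₁₂ * (pinv S.toBlocks₂₂ * (S.toBlocks₂₂ * (pinv S.toBlocks₂₂ * S.toBlocks₂₁)))
      = S.toBlocks₁₂ * (pinv S.toBlocks₂₂ * S.toBlocks₂₁) := by
    rw [← Matrix.mul_assoc S.toBlocks₂₂, ← Matrix.mul_assoc (pinv _), ← Matrix.mul_assoc (pinv _),
      hpsp]
  simp [Matrix.mul_assoc, Matrix.add_mul, hp, h12, hz, sub_eq_add_neg]

/-- The Gaussian conjugacy formula. For `(X₁, X₂) ∼ N(μ, Σ)` with `X₂` one-dimensional, the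
conditional distribution of `X₁` given `X₂ = a` is `N(μ', Σ')` with
`μ' = μ₁ + Σ₁₂ Σ₂₂⁺ (a - μ₂)` and `Σ' = Σ₁₁ - Σ₁₂ Σ₂₂⁺ Σ₂₁`. -/
def conjugate {X : Type} [Fintype X] [DecidableEq X] (ψ : State (X ⊕ Unit)) (a : Unit → ℝ) :
    State X where
  A := 0
  b := ψ.b ∘ Sum.inl + ψ.cov.toBlocks₁₂ *ᵥ (pinv ψ.cov.toBlocks₂₂ *ᵥ (a - ψ.b ∘ Sum.inr))
  cov := ψ.cov.toBlocks₁₁ - ψ.cov.toBlocks₁₂ * pinv ψ.cov.toBlocks₂₂ * ψ.cov.toBlocks₂₁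
  psd := conjugate_psd ψ.cov ψ.psd

/-- The affine function `x ↦ v(x) - w(x)`. -/
def Val.diff {Γ : Cxt} (v w : Val Γ .rv) : GaussHom (CIdx Γ) Unit :=
  GaussHom.affine (v.lin - w.lin) (v.off - w.off)

/-- `ψ|_{v=w}`: for `X ∼ ψ` and `Z = v(X) - w(X)`, the distribution of `X` conditional on
`Z = 0`. -/
def conditionEq {Γ : Cxt} (ψ : State (CIdx Γ)) (v w : Val Γ .rv) : State (CIdx Γ) :=
  conjugate (((GaussHom.id (CIdx Γ)).tuple (v.diff w)).comp ψ) 0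

/-- The context of `r` latent variables of type `R`. -/
def latent (r : ℕ) : Cxt := List.replicate r .rv

/-- Allocation of an independent standard normal latent variable (which becomes the most recent
one). -/
def allocate {r : ℕ} (ψ : State (CIdx (latent r))) : State (CIdx (latent (r + 1))) :=
  (GaussHom.stdNormal.tensor ψ).comp (GaussHom.reindex (X := Empty) (Sum.elim Empty.elim Empty.elim))

/-- Reduction contexts `C[-] : τ'` for a hole of type `τ`; all in scope `Γ`. -/
inductive RCxt (Γ : Cxt) (τ : Ty) : Ty → Type
  | hole : RCxt Γ τ τ
  | addL : RCxt Γ τ .rv → Tm Γ .rv → RCxt Γ τ .rv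
  | addR : Val Γ .rv → RCxt Γ τ .rv → RCxt Γ τ .rv
  | smul : ℝ → RCxt Γ τ .rv → RCxt Γ τ .rv
  | pairL {σ σ' : Ty} : RCxt Γ τ σ → Tm Γ σ' → RCxt Γ τ (.prod σ σ')
  | pairR {σ σ' : Ty} : Val Γ σ → RCxt Γ τ σ' → RCxt Γ τ (.prod σ σ')
  | condL : RCxt Γ τ .rv → Tm Γ .rv → RCxt Γ τ .unit
  | condR : Val Γ .rv → RCxt Γ τ .rv → RCxt Γ τ .unit
  | letIn {σ τ' : Ty} : RCxt Γ τ σ → Tm (σ :: Γ) τ' → RCxt Γ τ τ'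
  | letPair {σ σ' τ' : Ty} : RCxt Γ τ (.prod σ σ') → Tm (σ' :: σ :: Γ) τ' → RCxt Γ τ τ'

def RCxt.plug {Γ : Cxt} {τ : Ty} (e : Tm Γ τ) : {τ' : Ty} → RCxt Γ τ τ' → Tm Γ τ'
  | _, .hole => e
  | _, .addL C t => .add (C.plug e) t
  | _, .addR v C => .add v.toTm (C.plug e)
  | _, .smul α C => .smul α (C.plug e)
  | _, .pairL C t => .pair (C.plug e) t
  | _, .pairR v C => .pair v.toTm (C.plug e)
  | _, .condL C t => .cond (C.plug e) t
  | _, .condR v C => .cond v.toTm (C.plug e)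
  | _, .letIn C t => .letIn (C.plug e) t
  | _, .letPair C t => .letPair (C.plug e) t

def RCxt.rename {Γ Δ : Cxt} (ρ : Ren Γ Δ) {τ : Ty} : {τ' : Ty} → RCxt Γ τ τ' → RCxt Δ τ τ'
  | _, .hole => .hole
  | _, .addL C t => .addL (C.rename ρ) (t.rename ρ)
  | _, .addR v C => .addR (v.rename ρ) (C.rename ρ)
  | _, .smul α C => .smul α (C.rename ρ)
  | _, .pairL C t => .pairL (C.rename ρ) (t.rename ρ)
  | _, .pairR v C => .pairR (v.rename ρ) (C.rename ρ)
  | _, .condL C t => .condL (C.rename ρ) (t.rename ρ)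
  | _, .condR v C => .condR (v.rename ρ) (C.rename ρ)
  | _, .letIn C t => .letIn (C.rename ρ) (t.rename (ρ.lift _))
  | _, .letPair C t => .letPair (C.rename ρ) (t.rename ((ρ.lift _).lift _))

/-- Configurations: a term over `r` latent variables together with a Gaussian distribution on
`ℝ^r`, or failure `⊥`. -/
inductive Config (τ : Ty) : Type
  | run (r : ℕ) (e : Tm (latent r) τ) (ψ : State (CIdx (latent r))) : Config τ
  | fail : Config τ

/-- The reduction relation. -/
inductive Step {τ' : Ty} : Config τ' → Config τ' → Prop
  | normal {r : ℕ} (C : RCxt (latent r) .rv τ') (ψ : State (CIdx (latent r))) :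
      Step (.run r (C.plug .normal) ψ)
        (.run (r + 1) ((C.rename (Ren.weaken (latent r) .rv)).plug (.var .zero)) (allocate ψ))
  | cond {r : ℕ} (C : RCxt (latent r) .unit τ') (v w : Val (latent r) .rv)
      (ψ : State (CIdx (latent r))) (h : 0 ∈ ((v.diff w).comp ψ).support) :
      Step (.run r (C.plug (.cond v.toTm w.toTm)) ψ) (.run r (C.plug .star) (conditionEq ψ v w))
  | condFail {r : ℕ} (C : RCxt (latent r) .unit τ') (v w : Val (latent r) .rv)
      (ψ : State (CIdx (latent r))) (h : 0 ∉ ((v.diff w).comp ψ).support) :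
      Step (.run r (C.plug (.cond v.toTm w.toTm)) ψ) .fail
  | letIn {r : ℕ} {σ τ : Ty} (C : RCxt (latent r) τ τ') (v : Val (latent r) σ)
      (e : Tm (σ :: latent r) τ) (ψ : State (CIdx (latent r))) :
      Step (.run r (C.plug (.letIn v.toTm e)) ψ)
        (.run r (C.plug (e.subst (Sub.cons v.toTm (Sub.id (latent r))))) ψ)
  | letPair {r : ℕ} {σ σ' τ : Ty} (C : RCxt (latent r) τ τ') (v : Val (latent r) σ)
      (w : Val (latent r) σ') (e : Tm (σ' :: σ :: latent r) τ) (ψ : State (CIdx (latent r))) :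
      Step (.run r (C.plug (.letPair (.pair v.toTm w.toTm) e)) ψ)
        (.run r (C.plug (e.subst (Sub.cons w.toTm (Sub.cons v.toTm (Sub.id (latent r)))))) ψ)

/-- The initial configuration `(e, !)` of a closed program. -/
def Config.init {τ : Ty} (e : Tm [] τ) : Config τ := .run 0 e (GaussHom.point (X := Empty) 0)

/-- `c →* (v, ψ)` for a value `v` with `v_* ψ = μ`. -/
def Yields {τ : Ty} (c : Config τ) (μ : State τ.Idx) : Prop :=
  ∃ (r : ℕ) (v : Val (latent r) τ) (ψ : State (CIdx (latent r))),
    Relation.ReflTransGen Step c (.run r v.toTm ψ) ∧ v.pushforward ψ = μ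

/-- `c →* ⊥`. -/
def Fails {τ : Ty} (c : Config τ) : Prop := Relation.ReflTransGen Step c .fail

/-- Contextual equivalence: in every closed program context, both terms have the same observable
behaviour. -/
def CtxEquiv {Γ : Cxt} {τ : Ty} (e₁ e₂ : Tm Γ τ) : Prop :=
  ∀ (τ' : Ty) (K : PCxt Γ τ [] τ'),
    ∀ e ∈ ({e₁, e₂} : Set (Tm Γ τ)), ∀ e' ∈ ({e₁, e₂} : Set (Tm Γ τ)),
      (∀ μ : State τ'.Idx, Yields (Config.init (K.plug e)) μ → Yields (Config.init (K.plug e')) μ) ∧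
      (Fails (Config.init (K.plug e)) → Fails (Config.init (K.plug e')))

end GaussLang

end

set_option linter.unusedSectionVars false

noncomputable section

open Matrix

namespace GaussLang

/-! ## Affine maps -/

/-! Both semantics are compared with a third one. For a law `p` on an auxiliary sample space `ℝ^Z`
and an affine environment `ρ`, `Tm.run` gives the joint law of `z` and of the value of the term at
`ρ z`, conditioned on all observations made on the way, or `none` if one of them misses the support.
The sample `z` stays in the result because an observation inside a term also changes the law of its
inputs.

Conditioning becomes linear algebra. With `G = A Σ Aᵀ` the covariance of the observed quantity `δ x
= A x + b`, the posterior (`Post`) is read off from solutions of `G y = o - δ μ` and `G N = A Σ`.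
The second equation is always solvable (`exists_gain`), the first exactly when `o` lies in the
support, and the posterior does not depend on the solutions (`Post.unique`). The central fact is
`cnd_pair`: joint and successive conditioning agree. Thus the observations that `Obs(Gauss)`
collects can be processed one at a time (`ObsHom.run_comp`, `ObsHom.run_tensor`), and `Tm.run`
computes the denotation (`Tm.run_interp`).

On the denotational side, `absCont_point_iff` and `ObsHom.posterior_eq` identify `∼` with equality
of posteriors or common failure. Testing a morphism on all states of `A ⊗ X` then amounts to running
it on all pairs `(p, ρ)` (`ObsHom.equivalent_iff`), so equality of denotations is equality of all
runs (`denote_eq_iff`).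

On the operational side, reduction preserves the outcome `Config.out` computed by `Tm.run`
(`Step.out_eq`), and every configuration reduces to a value or to failure (`Config.terminates`). The
outcome therefore determines the behaviour, and contextual equivalence is equality of outcomes in
all closed contexts (`ctxEquiv_iff`).

Since `Tm.run` is compositional, equal runs give equal outcomes (`PCxt.run_plug_congr`). Conversely,
each pair `(p, ρ)` is realized by a program context: `p` is an affine image of standard normals,
affine functions of latent variables are values, and a context that returns the latent variables
next to the value of the hole exposes the whole joint law (`PCxt.exists_run_plug`,
`PCxt.out_normals`). -/

/-- The affine map `x ↦ A x + b`. -/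
structure Aff (X Y : Type) where
  A : Matrix Y X ℝ
  b : Y → ℝ

namespace Aff

variable {W X Y Z : Type}

def eval [Fintype X] (f : Aff X Y) (x : X → ℝ) : Y → ℝ := f.A *ᵥ x + f.b

/-- The offset is the value at `0`, and the columns are recovered from the values at the basis
vectors. Identities between affine maps are henceforth checked pointwise, which avoids block matrix
computations. -/
theorem ext_eval [Fintype X] {f g : Aff X Y} (h : ∀ x, f.eval x = g.eval x) : f = g := by
  classical
  have hb : f.b = g.b := by simpa [eval] using h 0
  have hA : f.A = g.A := by
    ext i j
    have := congrFun (h (Pi.single j 1)) i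
    simpa [eval, hb] using this
  cases f; cases g; simp_all

/-- Selection of coordinates of the output. -/
def sel (f : Aff X Y) (σ : Z → Y) : Aff X Z := ⟨f.A.submatrix σ _root_.id, f.b ∘ σ⟩

def pair (f : Aff X Y) (g : Aff X Z) : Aff X (Y ⊕ Z) := ⟨fromRows f.A g.A, Sum.elim f.b g.b⟩

def comp [Fintype Y] (g : Aff Y Z) (f : Aff X Y) : Aff X Z := ⟨g.A * f.A, g.A *ᵥ f.b + g.b⟩

/-- The map `x ↦ x ∘ σ`. -/
def proj [DecidableEq X] (σ : Y → X) : Aff X Y := ⟨Matrix.of fun y x => if σ y = x then 1 else 0, 0⟩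

def add (f g : Aff X Y) : Aff X Y := ⟨f.A + g.A, f.b + g.b⟩

def sub (f g : Aff X Y) : Aff X Y := ⟨f.A - g.A, f.b - g.b⟩

def smul (α : ℝ) (f : Aff X Y) : Aff X Y := ⟨α • f.A, α • f.b⟩

def const (b : Y → ℝ) : Aff X Y := ⟨0, b⟩

@[simp] theorem eval_sel [Fintype X] (f : Aff X Y) (σ : Z → Y) (x : X → ℝ) :
    (f.sel σ).eval x = f.eval x ∘ σ := by
  ext i; simp [eval, sel, mulVec, dotProduct]

@[simp] theorem eval_pair [Fintype X] (f : Aff X Y) (g : Aff X Z) (x : X → ℝ) :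
    (f.pair g).eval x = Sum.elim (f.eval x) (g.eval x) := by
  ext i; rcases i with i | i <;> simp [eval, pair, fromRows_mulVec]

@[simp] theorem eval_comp [Fintype X] [Fintype Y] (g : Aff Y Z) (f : Aff X Y) (x : X → ℝ) :
    (g.comp f).eval x = g.eval (f.eval x) := by
  simp [eval, comp, mulVec_add, add_assoc]

@[simp] theorem eval_proj [Fintype X] [DecidableEq X] (σ : Y → X) (x : X → ℝ) :
    (proj σ).eval x = x ∘ σ := by
  ext i; simp [eval, proj, mulVec, dotProduct]

@[simp] theorem eval_add [Fintype X] (f g : Aff X Y) (x : X → ℝ) :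
    (f.add g).eval x = f.eval x + g.eval x := by
  simp only [eval, add, Matrix.add_mulVec]; abel

@[simp] theorem eval_sub [Fintype X] (f g : Aff X Y) (x : X → ℝ) :
    (f.sub g).eval x = f.eval x - g.eval x := by
  simp only [eval, sub, Matrix.sub_mulVec]; abel

@[simp] theorem eval_smul [Fintype X] (α : ℝ) (f : Aff X Y) (x : X → ℝ) :
    (f.smul α).eval x = α • f.eval x := by
  simp [eval, smul, Matrix.smul_mulVec]

@[simp] theorem eval_const [Fintype X] (b : Y → ℝ) (x : X → ℝ) :
    (const b : Aff X Y).eval x = b := by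
  simp [eval, const]

protected def id (X : Type) [DecidableEq X] : Aff X X := proj fun x => x

@[simp] theorem eval_id [Fintype X] [DecidableEq X] (x : X → ℝ) : (Aff.id X).eval x = x :=
  eval_proj _ _

/-- Parallel composition. -/
def par {X' Y' : Type} [Fintype X] [Fintype X'] [DecidableEq X] [DecidableEq X']
    (f : Aff X Y) (g : Aff X' Y') : Aff (X ⊕ X') (Y ⊕ Y') :=
  (f.comp (proj Sum.inl)).pair (g.comp (proj Sum.inr))

@[simp] theorem eval_par {X' Y' : Type} [Fintype X] [Fintype X'] [DecidableEq X] [DecidableEq X']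
    (f : Aff X Y) (g : Aff X' Y') (x : X ⊕ X' → ℝ) :
    (f.par g).eval x = Sum.elim (f.eval (x ∘ Sum.inl)) (g.eval (x ∘ Sum.inr)) := by
  simp [par]

theorem comp_assoc [Fintype X] [Fintype Y] [Fintype W] (h : Aff Y Z) (g : Aff X Y) (f : Aff W X) :
    (h.comp g).comp f = h.comp (g.comp f) := ext_eval fun x => by simp

@[simp] theorem id_comp [Fintype X] [Fintype Y] [DecidableEq Y] (f : Aff X Y) :
    (Aff.id Y).comp f = f := ext_eval fun x => by simp

@[simp] theorem comp_id [Fintype X] [DecidableEq X] (f : Aff X Y) :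
    f.comp (Aff.id X) = f := ext_eval fun x => by simp

theorem proj_comp [Fintype X] [Fintype Y] [DecidableEq Y] (σ : Z → Y) (f : Aff X Y) :
    (proj σ).comp f = f.sel σ := ext_eval fun x => by simp

theorem sel_comp [Fintype X] [Fintype Y] (g : Aff Y Z) (f : Aff X Y) (σ : W → Z) :
    (g.sel σ).comp f = (g.comp f).sel σ := ext_eval fun x => by simp

end Aff

/-! ## Pushforwards and extensions by independent noise -/

theorem State.ext' {X : Type} {p q : State X} (hb : p.b = q.b) (hc : p.cov = q.cov) : p = q :=
  GaussHom.ext (by ext i j; exact j.elim) hb hc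

theorem State.cov_transpose {X Y : Type} (p : GaussHom X Y) : p.covᵀ = p.cov := by
  simpa [conjTranspose_eq_transpose_of_trivial] using p.psd.1.eq

/-- The law of `f x` for `x ∼ p`. -/
def push {X Y : Type} [Fintype X] [Fintype Y] (p : State X) (f : Aff X Y) : State Y :=
  (GaussHom.affine f.A f.b).comp p

section push

variable {X Y Z N M : Type} [Fintype X] [Fintype Y] [Fintype Z] [Fintype N] [Fintype M]

@[simp] theorem push_b (p : State X) (f : Aff X Y) : (push p f).b = f.eval p.b := rfl

@[simp] theorem push_cov (p : State X) (f : Aff X Y) : (push p f).cov = f.A * p.cov * f.Aᵀ := by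
  simp [push, GaussHom.comp, GaussHom.affine]

theorem push_push (p : State X) (f : Aff X Y) (g : Aff Y Z) :
    push (push p f) g = push p (g.comp f) := by
  apply State.ext'
  · simp
  · simp [Aff.comp, Matrix.mul_assoc]

@[simp] theorem push_id [DecidableEq X] (p : State X) : push p (Aff.id X) = p := by
  have h : (Aff.id X).A = 1 := by ext i j; simp [Aff.id, Aff.proj, Matrix.one_apply]
  apply State.ext'
  · simp
  · simp [h]

/-- The law of `(x, n)` for `x ∼ p` and independent standard normal noise `n`. -/
def noise (p : State X) (N' : Type) [Fintype N'] [DecidableEq N'] : State (X ⊕ N') where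
  A := 0
  b := Sum.elim p.b 0
  cov := fromBlocks p.cov 0 0 1
  psd := GaussHom.posSemidef_fromBlocks p.psd PosSemidef.one

theorem noise_cov [DecidableEq N] (p : State X) :
    (noise p N).cov = fromBlocks p.cov 0 0 1 := rfl

theorem push_noise_cov [DecidableEq N] (p : State X) (f : Aff (X ⊕ N) Y) :
    (push (noise p N) f).cov =
      f.A.toCols₁ * p.cov * f.A.toCols₁ᵀ + f.A.toCols₂ * f.A.toCols₂ᵀ := by
  rw [push_cov, noise]
  conv_lhs => rw [← fromCols_toCols f.A]
  rw [fromCols_mul_fromBlocks, transpose_fromCols, fromCols_mul_fromRows]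
  simp

/-- Standard normal noise enters the covariance only through `T Tᵀ`, where `T` is the noise part of
the matrix. Hence neither the number of noise variables nor the choice of square root matters. -/
theorem push_noise_congr {N' : Type} [Fintype N'] [DecidableEq N] [DecidableEq N'] (p : State X)
    {f : Aff (X ⊕ N) Y} {g : Aff (X ⊕ N') Y} (h1 : f.A.toCols₁ = g.A.toCols₁) (hb : f.b = g.b)
    (h2 : f.A.toCols₂ * f.A.toCols₂ᵀ = g.A.toCols₂ * g.A.toCols₂ᵀ) :
    push (noise p N) f = push (noise p N') g := by
  apply State.ext'
  · simp only [push_b, noise, Aff.eval, hb]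
    rw [← fromCols_toCols f.A, ← fromCols_toCols g.A, fromCols_mulVec, fromCols_mulVec, h1]
    simp
  · rw [push_noise_cov, push_noise_cov, h1, h2]

theorem noise_push [DecidableEq X] [DecidableEq N] (p : State X) (f : Aff X Y) :
    noise (push p f) N = push (noise p N) (f.par (Aff.id N)) := by
  apply State.ext'
  · simp [noise]
  · have h : (f.par (Aff.id N)).A = fromBlocks f.A 0 0 1 := by
      ext (i | i) (j | j) <;>
        simp [Aff.par, Aff.pair, Aff.comp, Aff.proj, Aff.id, Matrix.mul_apply, Matrix.one_apply]
    have e : (noise (push p f) N).cov = fromBlocks (f.A * p.cov * f.Aᵀ) 0 0 1 := by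
      simp [noise]
    rw [e, push_cov, h, noise, fromBlocks_multiply, fromBlocks_transpose, fromBlocks_multiply]
    simp

/-- Distinct coordinates of standard normal noise are again independent standard normals;
injectivity of `σ` is what prevents repeated, hence correlated, coordinates. -/
theorem push_noise_reindex {N' : Type} [Fintype N'] [DecidableEq X] [DecidableEq N]
    [DecidableEq N'] (p : State X) {σ : N' → N} (hσ : Function.Injective σ) :
    push (noise p N) ((Aff.id X).par (Aff.proj σ)) = noise p N' := by
  apply State.ext'
  · simp only [push_b, noise, Aff.eval_par]
    ext (i | i) <;> simp
  · have h : ((Aff.id X).par (Aff.proj σ) : Aff (X ⊕ N) (X ⊕ N')).A =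
        fromBlocks 1 0 0 ((1 : Matrix N N ℝ).submatrix σ _root_.id) := by
      ext (i | i) (j | j) <;>
        simp [Aff.par, Aff.pair, Aff.comp, Aff.proj, Aff.id, Matrix.mul_apply, Matrix.one_apply]
    rw [push_cov, h, noise, noise, fromBlocks_multiply, fromBlocks_transpose, fromBlocks_multiply]
    simp
    ext i j
    simp [Matrix.mul_apply, Matrix.one_apply, hσ.eq_iff]

theorem noise_noise [DecidableEq X] [DecidableEq N] [DecidableEq M] (p : State X) :
    noise (noise p N) M = push (noise p (N ⊕ M))
      (Aff.proj (Sum.elim (Sum.elim Sum.inl (Sum.inr ∘ Sum.inl)) (Sum.inr ∘ Sum.inr))) := by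
  apply State.ext'
  · simp only [push_b, noise, Aff.eval_proj]
    ext ((i | i) | i) <;> simp
  · ext ((i | i) | i) ((j | j) | j) <;>
      simp [noise, Aff.proj, Matrix.mul_apply, Matrix.one_apply]

@[simp] theorem push_noise_fst [DecidableEq X] [DecidableEq N] (p : State X) :
    push (noise p N) (Aff.proj Sum.inl) = p := by
  apply State.ext'
  · simp [noise]
  · ext i j; simp [noise, Aff.proj, Matrix.mul_apply]

end push

/-! ## Conditioning -/

section cnd

variable {X Y Z N K L : Type} [Fintype X] [Fintype Y] [Fintype Z] [Fintype N] [Fintype K]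
  [Fintype L]

/-- `q` is the law of `x ∼ p` conditioned on `δ x = o`. -/
def Post (p : State Z) (δ : Aff Z K) (o : K → ℝ) (q : State Z) : Prop :=
  ∃ (y : K → ℝ) (N : Matrix K Z ℝ), (δ.A * p.cov * δ.Aᵀ) *ᵥ y = o - δ.eval p.b ∧
    (δ.A * p.cov * δ.Aᵀ) * N = δ.A * p.cov ∧
    q.b = p.b + (p.cov * δ.Aᵀ) *ᵥ y ∧ q.cov = p.cov - p.cov * δ.Aᵀ * N

/-- Transposing the equation for the gain `N` gives `Σ Aᵀ = Nᵀ G`. The posterior therefore sees `y`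
and `N` only through `G y` and `G N`, which are prescribed. -/
theorem Post.unique {p : State Z} {δ : Aff Z K} {o : K → ℝ} {q r : State Z}
    (hq : Post p δ o q) (hr : Post p δ o r) : q = r := by
  obtain ⟨y, N, h1, h2, h3, h4⟩ := hq
  obtain ⟨y', N', h1', h2', h3', h4'⟩ := hr
  have hG : (δ.A * p.cov * δ.Aᵀ)ᵀ = δ.A * p.cov * δ.Aᵀ := by
    simp [State.cov_transpose, Matrix.mul_assoc]
  have hN : p.cov * δ.Aᵀ = Nᵀ * (δ.A * p.cov * δ.Aᵀ) := by
    have := congrArg transpose h2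
    rw [transpose_mul, hG, transpose_mul, State.cov_transpose] at this
    exact this.symm
  apply State.ext'
  · rw [h3, h3', hN, ← mulVec_mulVec, ← mulVec_mulVec _ Nᵀ, h1, h1']
  · rw [h4, h4', hN, Matrix.mul_assoc Nᵀ, Matrix.mul_assoc Nᵀ, h2, h2']

/-- This is `GaussHom.exists_mul_eq` for the covariance of the pair `(x, δ x)`, transposed. -/
theorem exists_gain (p : State Z) (δ : Aff Z K) :
    ∃ N : Matrix K Z ℝ, (δ.A * p.cov * δ.Aᵀ) * N = δ.A * p.cov := by
  classical
  have h := p.psd.mul_mul_conjTranspose_same (fromRows (1 : Matrix Z Z ℝ) δ.A)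
  rw [conjTranspose_eq_transpose_of_trivial, fromRows_mul, transpose_fromRows,
    fromRows_mul_fromCols] at h
  obtain ⟨M, hM⟩ := GaussHom.exists_mul_eq _ h
  simp only [toBlocks_fromBlocks₂₂, toBlocks_fromBlocks₁₂] at hM
  refine ⟨Mᵀ, ?_⟩
  have := congrArg transpose hM
  simpa [State.cov_transpose, Matrix.mul_assoc] using this

/-- Only the equation for the mean can fail. The required covariance is always admissible, being the
covariance `(1 - Nᵀ A) Σ (1 - Nᵀ A)ᵀ` of the residual `x - Nᵀ A x`. -/
theorem exists_post_iff (p : State Z) (δ : Aff Z K) (o : K → ℝ) :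
    (∃ q, Post p δ o q) ↔ ∃ y, (δ.A * p.cov * δ.Aᵀ) *ᵥ y = o - δ.eval p.b := by
  classical
  constructor
  · rintro ⟨q, y, N, h, -⟩
    exact ⟨y, h⟩
  · rintro ⟨y, h⟩
    obtain ⟨N, hN⟩ := exists_gain p δ
    have hN' : Nᵀ * (δ.A * p.cov * δ.Aᵀ) = p.cov * δ.Aᵀ := by
      have := congrArg transpose hN
      simpa [State.cov_transpose, Matrix.mul_assoc] using this
    have hp : (p.cov - p.cov * δ.Aᵀ * N).PosSemidef := by
      have h := p.psd.mul_mul_conjTranspose_same (1 - Nᵀ * δ.A)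
      rw [conjTranspose_eq_transpose_of_trivial] at h
      convert h using 1
      have e1 : Nᵀ * (δ.A * p.cov) = p.cov * δ.Aᵀ * N := by rw [← hN, ← Matrix.mul_assoc, hN']
      have e2 : Nᵀ * (δ.A * (p.cov * (δ.Aᵀ * N))) = p.cov * (δ.Aᵀ * N) := by
        rw [← Matrix.mul_assoc δ.A, ← Matrix.mul_assoc (δ.A * _), hN, e1, Matrix.mul_assoc]
      rw [Matrix.mul_assoc] at e1
      simp only [Matrix.sub_mul, Matrix.mul_sub, Matrix.mul_assoc, transpose_sub, transpose_one,
        transpose_mul, transpose_transpose, Matrix.one_mul, Matrix.mul_one, e2]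
      rw [e1]
      abel
    exact ⟨⟨0, p.b + (p.cov * δ.Aᵀ) *ᵥ y, _, hp⟩, y, N, h, hN, rfl, rfl⟩

open Classical in
/-- The law of `x ∼ p` conditioned on `δ x = o`, if `o` is in the support of `δ x`. -/
def cnd (p : State Z) (δ : Aff Z K) (o : K → ℝ) : Option (State Z) :=
  if h : ∃ q, Post p δ o q then some h.choose else none

theorem cnd_eq_some {p : State Z} {δ : Aff Z K} {o : K → ℝ} {q : State Z} :
    cnd p δ o = some q ↔ Post p δ o q := by
  unfold cnd
  split_ifs with h
  · rw [Option.some_inj]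
    exact ⟨fun e => e ▸ h.choose_spec, fun e => h.choose_spec.unique e⟩
  · exact ⟨fun e => by simp at e, fun e => absurd ⟨q, e⟩ h⟩

theorem cnd_eq_none {p : State Z} {δ : Aff Z K} {o : K → ℝ} :
    cnd p δ o = none ↔ ¬ ∃ q, Post p δ o q := by
  unfold cnd
  split_ifs with h <;> simp [h]

/-- Conditioning commutes with a transformation that respects the observed quantity. -/
theorem cnd_map {p : State X} {q : State Y} {δ : Aff X K} {ε : Aff Y K} {o : K → ℝ}
    (f : State X → State Y) (hG : ε.A * q.cov * ε.Aᵀ = δ.A * p.cov * δ.Aᵀ)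
    (hb : ε.eval q.b = δ.eval p.b) (hf : ∀ r, Post p δ o r → Post q ε o (f r)) :
    cnd q ε o = (cnd p δ o).map f := by
  by_cases h : ∃ r, Post p δ o r
  · obtain ⟨r, hr⟩ := h
    rw [cnd_eq_some.2 hr, cnd_eq_some.2 (hf r hr), Option.map_some]
  · rw [cnd_eq_none.2 h, Option.map_none, cnd_eq_none]
    rwa [exists_post_iff, hG, hb, ← exists_post_iff]

/-- Observing `δ` after applying `f` is observing `δ ∘ f` before. The law of the observed quantity
is the same, so the solution `y` is kept and the gain is multiplied by `fᵀ`. -/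
theorem cnd_push (p : State X) (f : Aff X Y) (δ : Aff Y K) (o : K → ℝ) :
    cnd (push p f) δ o = (cnd p (δ.comp f) o).map (push · f) := by
  have hG : δ.A * (push p f).cov * δ.Aᵀ = (δ.comp f).A * p.cov * (δ.comp f).Aᵀ := by
    simp [Aff.comp, Matrix.mul_assoc]
  refine cnd_map _ hG (by simp) ?_
  rintro r ⟨y, N, h1, h2, h3, h4⟩
  refine ⟨y, N * f.Aᵀ, ?_, ?_, ?_, ?_⟩
  · rw [hG, h1]; simp
  · rw [hG, ← Matrix.mul_assoc, h2]; simp [Aff.comp, Matrix.mul_assoc]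
  · simp only [push_b, push_cov, h3, Aff.eval, Aff.comp, mulVec_add, mulVec_mulVec, transpose_mul,
      Matrix.mul_assoc]
    abel
  · simp [h4, Matrix.mul_sub, Matrix.sub_mul, Aff.comp, Matrix.mul_assoc]

/-- Noise independent of the observed quantity is untouched by conditioning: its columns of the gain
are zero. This allows all noise to be drawn before any conditioning. -/
theorem cnd_noise [DecidableEq Z] [DecidableEq N] (p : State Z) (δ : Aff Z K) (o : K → ℝ) :
    cnd (noise p N) (δ.comp (Aff.proj Sum.inl)) o = (cnd p δ o).map (noise · N) := by
  have hA : (δ.comp (Aff.proj Sum.inl) : Aff (Z ⊕ N) K).A = fromCols δ.A 0 := by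
    ext i (j | j) <;> simp [Aff.comp, Aff.proj, Matrix.mul_apply]
  have hG : (fromCols δ.A (0 : Matrix K N ℝ)) * (noise p N).cov *
      (fromCols δ.A (0 : Matrix K N ℝ))ᵀ = δ.A * p.cov * δ.Aᵀ := by
    rw [noise, fromCols_mul_fromBlocks, transpose_fromCols, fromCols_mul_fromRows]
    simp
  have hb : (δ.comp (Aff.proj Sum.inl) : Aff (Z ⊕ N) K).eval (noise p N).b = δ.eval p.b := by
    simp [noise]
  refine cnd_map _ (by rw [hA, hG]) hb ?_
  rintro r ⟨y, M, h1, h2, h3, h4⟩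
  refine ⟨y, fromCols M 0, ?_, ?_, ?_, ?_⟩
  · rw [hA, hG, hb, h1]
  · rw [hA, hG, noise, fromCols_mul_fromBlocks, mul_fromCols, h2]; simp
  · rw [hA, noise, noise, transpose_fromCols, fromBlocks_mul_fromRows, fromRows_mulVec, h3]
    ext (i | i) <;> simp
  · rw [hA, noise_cov, noise_cov, transpose_fromCols, fromBlocks_mul_fromRows,
      fromRows_mul_fromCols, h4]
    ext (i | i) (j | j) <;> simp

theorem cnd_isEmpty [IsEmpty K] (p : State Z) (δ : Aff Z K) (o : K → ℝ) :
    cnd p δ o = some p := by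
  rw [cnd_eq_some]
  refine ⟨0, 0, Subsingleton.elim _ _, ?_, by simp, by simp⟩
  ext i; exact isEmptyElim i

theorem cnd_sel (p : State Z) (δ : Aff Z K) (o : K → ℝ) (e : L ≃ K) :
    cnd p (δ.sel e) (o ∘ e) = cnd p δ o := by
  have key : ∀ {K L : Type} [Fintype K] [Fintype L] (δ : Aff Z K) (o : K → ℝ) (e : L ≃ K) q,
      Post p δ o q → Post p (δ.sel e) (o ∘ e) q := by
    rintro K L _ _ δ o e q ⟨y, N, h1, h2, h3, h4⟩
    have hA : (δ.sel e).A = δ.A.submatrix e _root_.id := rfl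
    have hG : (δ.sel e).A * p.cov * (δ.sel e).Aᵀ =
        (δ.A * p.cov * δ.Aᵀ).submatrix e e := by
      ext i j; simp [hA, Matrix.mul_apply]
    have hC : p.cov * (δ.sel e).Aᵀ = (p.cov * δ.Aᵀ).submatrix _root_.id e := by
      ext i j; simp [hA, Matrix.mul_apply]
    refine ⟨y ∘ e, N.submatrix e _root_.id, ?_, ?_, ?_, ?_⟩
    · rw [hG, submatrix_mulVec_equiv]
      simp only [Function.comp_assoc, Equiv.self_comp_symm, Function.comp_id, h1]
      ext i; simp [Aff.eval, Aff.sel, mulVec, dotProduct]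
    · rw [hG, submatrix_mul_equiv, h2]
      ext i j; simp [hA, Matrix.mul_apply]
    · rw [hC, submatrix_mulVec_equiv, h3]
      simp [Function.comp_assoc]
    · rw [hC, submatrix_mul_equiv, h4]
      simp
  apply Option.ext
  intro q
  rw [cnd_eq_some, cnd_eq_some]
  refine ⟨fun h => ?_, key δ o e q⟩
  have := key _ _ e.symm q h
  have e1 : (δ.sel e).sel e.symm = δ := Aff.ext_eval fun x => by simp [Function.comp_assoc]
  rwa [e1, Function.comp_assoc, Equiv.self_comp_symm, Function.comp_id] at this

/-- Conditioning successively is conditioning jointly. -/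
theorem cnd_pair (p : State Z) (δ : Aff Z K) (ε : Aff Z L) (o : K → ℝ) (o' : L → ℝ) :
    cnd p (δ.pair ε) (Sum.elim o o') = (cnd p δ o).bind fun q => cnd q ε o' := by
  set S := p.cov with hS
  have hG : (δ.pair ε).A * S * (δ.pair ε).Aᵀ =
      fromBlocks (δ.A * S * δ.Aᵀ) (δ.A * S * ε.Aᵀ) (ε.A * S * δ.Aᵀ) (ε.A * S * ε.Aᵀ) := by
    rw [Aff.pair, transpose_fromRows, fromRows_mul, fromRows_mul_fromCols]
  have hC : S * (δ.pair ε).Aᵀ = fromCols (S * δ.Aᵀ) (S * ε.Aᵀ) := by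
    rw [Aff.pair, transpose_fromRows, mul_fromCols]
  have hR : (δ.pair ε).A * S = fromRows (δ.A * S) (ε.A * S) := by
    rw [Aff.pair, fromRows_mul]
  have hv : Sum.elim o o' - (δ.pair ε).eval p.b =
      Sum.elim (o - δ.eval p.b) (o' - ε.eval p.b) := by
    ext (i | i) <;> simp
  by_cases h : ∃ q, Post p δ o q
  swap
  · rw [cnd_eq_none.2 h, Option.bind_none, cnd_eq_none, exists_post_iff, ← hS, hG, hv]
    rintro ⟨y, hy⟩
    obtain ⟨N, hN⟩ := exists_gain p δ
    rw [fromBlocks_mulVec] at hy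
    have hy1 := congrArg (· ∘ Sum.inl) hy
    simp only [Sum.elim_comp_inl] at hy1
    apply h
    rw [exists_post_iff]
    -- Since `G N = δ.A * S`, the cross term in the first block row is `G` applied to `N εᵀ y₂`. A
    -- solution of the joint system thus yields one for `δ` alone.
    refine ⟨y ∘ Sum.inl + N *ᵥ ε.Aᵀ *ᵥ (y ∘ Sum.inr), ?_⟩
    rw [← hS] at hN ⊢
    rw [← hy1, mulVec_add, mulVec_mulVec, hN, mulVec_mulVec]
  obtain ⟨q, hq⟩ := h
  rw [cnd_eq_some.2 hq, Option.bind_some]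
  obtain ⟨y, N, h1, h2, h3, h4⟩ := hq
  rw [← hS] at h1 h2 h3 h4
  have hN' : Nᵀ * (δ.A * S * δ.Aᵀ) = S * δ.Aᵀ := by
    have := congrArg transpose h2
    simpa [hS, State.cov_transpose, Matrix.mul_assoc] using this
  have e1 : S * δ.Aᵀ * N = Nᵀ * (δ.A * S) := by rw [← h2, ← Matrix.mul_assoc, hN']
  have hq : ε.A * q.cov * ε.Aᵀ = ε.A * S * ε.Aᵀ - ε.A * S * δ.Aᵀ * (N * ε.Aᵀ) := by
    rw [h4]; simp [Matrix.mul_sub, Matrix.sub_mul, Matrix.mul_assoc]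
  have hqb : ε.eval q.b = ε.eval p.b + (ε.A * S * δ.Aᵀ) *ᵥ y := by
    rw [h3]; simp only [Aff.eval, mulVec_add, mulVec_mulVec, Matrix.mul_assoc]; abel
  refine Eq.symm ?_
  by_cases h' : ∃ r, Post q ε o' r
  · obtain ⟨r, hr⟩ := h'
    rw [cnd_eq_some.2 hr, eq_comm, cnd_eq_some]
    obtain ⟨y2, N2, g1, g2, g3, g4⟩ := hr
    rw [hq] at g1 g2
    rw [hqb] at g1
    -- Block elimination: the Schur complement of the joint system is the covariance of `ε` under
    -- the intermediate posterior, so its solutions `y2`, `N2` are kept as second blocks and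
    -- back-substituted into the first.
    refine ⟨Sum.elim (y - (N * ε.Aᵀ) *ᵥ y2) y2, fromRows (N - N * ε.Aᵀ * N2) N2, ?_, ?_, ?_, ?_⟩
    · rw [← hS, hG, hv, fromBlocks_mulVec]
      simp only [Sum.elim_comp_inl, Sum.elim_comp_inr]
      congr 1
      · rw [mulVec_sub, mulVec_mulVec, ← Matrix.mul_assoc, h2, h1]; abel
      · rw [sub_mulVec] at g1
        rw [mulVec_sub, mulVec_mulVec]
        have : (ε.A * S * ε.Aᵀ) *ᵥ y2 - (ε.A * S * δ.Aᵀ * (N * ε.Aᵀ)) *ᵥ y2 +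
          (ε.A * S * δ.Aᵀ) *ᵥ y = o' - ε.eval p.b := by rw [g1]; abel
        rw [← this]; abel
    · rw [← hS, hG, hR, fromBlocks_mul_fromRows]
      congr 1
      · rw [Matrix.mul_sub, h2, Matrix.mul_assoc N, ← Matrix.mul_assoc _ N, h2]
        simp [Matrix.mul_assoc]
      · rw [h4] at g2
        rw [Matrix.sub_mul, Matrix.mul_sub] at g2
        rw [Matrix.mul_sub]
        have : ε.A * S * ε.Aᵀ * N2 = ε.A * S - ε.A * (S * δ.Aᵀ * N) +
          ε.A * S * δ.Aᵀ * (N * ε.Aᵀ) * N2 := by rw [← g2]; abel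
        rw [this]
        simp only [Matrix.mul_assoc]; abel
    · rw [g3, h4, h3, ← hS, hC, fromCols_mulVec]
      simp only [Sum.elim_comp_inl, Sum.elim_comp_inr, Matrix.sub_mul, sub_mulVec, mulVec_sub,
        mulVec_mulVec, Matrix.mul_assoc]
      abel
    · rw [g4, h4, ← hS, hC, fromCols_mul_fromRows]
      simp only [Matrix.sub_mul, Matrix.mul_sub, Matrix.mul_assoc]
      abel
  · rw [cnd_eq_none.2 h', eq_comm, cnd_eq_none]
    contrapose! h'
    rw [exists_post_iff, ← hS, hG, hv] at h'
    obtain ⟨z, hz⟩ := h'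
    rw [exists_post_iff]
    refine ⟨z ∘ Sum.inr, ?_⟩
    rw [fromBlocks_mulVec] at hz
    have hz1 := congrArg (· ∘ Sum.inl) hz
    have hz2 := congrArg (· ∘ Sum.inr) hz
    simp only [Sum.elim_comp_inl, Sum.elim_comp_inr] at hz1 hz2
    rw [hq, hqb]
    -- The vectors `y` and `z₁ + N εᵀ z₂` may differ, but the covariance of `δ` sends both to the
    -- same vector, and the cross covariance of `ε` with `δ` factors through it via `Nᵀ`.
    have k : (ε.A * S * δ.Aᵀ) *ᵥ y = (ε.A * S * δ.Aᵀ) *ᵥ (z ∘ Sum.inl) +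
        (ε.A * S * δ.Aᵀ * (N * ε.Aᵀ)) *ᵥ (z ∘ Sum.inr) := by
      rw [Matrix.mul_assoc (ε.A * S), ← Matrix.mul_assoc δ.Aᵀ, ← Matrix.mul_assoc (ε.A * S),
        Matrix.mul_assoc ε.A S (δ.Aᵀ * N), ← Matrix.mul_assoc S, e1, Matrix.mul_assoc ε.A S, ← hN',
        ← Matrix.mul_assoc, ← mulVec_mulVec, h1, ← hz1, mulVec_add, mulVec_mulVec, mulVec_mulVec]
      simp only [Matrix.mul_assoc]
    rw [k, sub_mulVec, ← sub_sub, ← hz2]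
    abel

/-- The order in which the two observations are processed is immaterial: `cnd_pair` after swapping
the blocks. Composition in `Obs(Gauss)` lists the later observation first, whence this form. -/
theorem cnd_pair' (p : State Z) (δ : Aff Z K) (ε : Aff Z L) (o : K → ℝ) (o' : L → ℝ) :
    cnd p (δ.pair ε) (Sum.elim o o') = (cnd p ε o').bind fun q => cnd q δ o := by
  rw [← cnd_pair, ← cnd_sel _ _ _ (Equiv.sumComm K L)]
  congr 1
  · exact Aff.ext_eval fun x => by ext (i | i) <;> simp
  · ext (i | i) <;> simp

end cnd

/-! ## Realizing morphisms of `Gauss` by affine maps with noise -/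

section realizes

variable {W X Y Z X' Y' N M : Type} [Fintype W] [Fintype X] [Fintype Y] [Fintype Z] [Fintype N]
  [Fintype M] [Fintype X'] [Fintype Y']

/-- `f x` is the law of `F (x, n)` for standard normal noise `n`. -/
def Realizes {X Y : Type} (f : GaussHom X Y) (F : Aff (X ⊕ N) Y) : Prop :=
  F.A.toCols₁ = f.A ∧ F.b = f.b ∧ F.A.toCols₂ * F.A.toCols₂ᵀ = f.cov

/-- Writing the covariance as `Bᵀ B`, the map `x ↦ A x + Bᵀ n + b` has the required law. -/
theorem exists_realizes {X : Type} (f : GaussHom X Y) : ∃ F : Aff (X ⊕ Y) Y, Realizes f F := by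
  classical
  obtain ⟨B, hB⟩ : ∃ B : Matrix Y Y ℝ, f.cov = Bᵀ * B := by
    open scoped MatrixOrder ComplexOrder in
    obtain ⟨B, hB⟩ := (CStarAlgebra.nonneg_iff_eq_star_mul_self (a := f.cov)).1 f.psd.nonneg
    exact ⟨B, by rw [hB, star_eq_conjTranspose, conjTranspose_eq_transpose_of_trivial]⟩
  exact ⟨⟨fromCols f.A Bᵀ, f.b⟩, by simp, rfl, by simp [hB]⟩

theorem Realizes.affine [DecidableEq X] [DecidableEq N] (A : Matrix Y X ℝ) (b : Y → ℝ) :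
    Realizes (N := N) (GaussHom.affine A b) ((Aff.mk A b).comp (Aff.proj Sum.inl)) := by
  refine ⟨?_, ?_, ?_⟩
  · ext i j; simp [Aff.comp, Aff.proj, Matrix.mul_apply, GaussHom.affine]
  · simp [Aff.comp, Aff.proj, GaussHom.affine]
  · ext i j; simp [Aff.comp, Aff.proj, Matrix.mul_apply, GaussHom.affine]

theorem Realizes.affine_comp {f : GaussHom X Y} {F : Aff (X ⊕ N) Y} (hf : Realizes f F)
    (A : Matrix Z Y ℝ) (b : Z → ℝ) :
    Realizes ((GaussHom.affine A b).comp f) ((Aff.mk A b).comp F) := by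
  obtain ⟨h1, h2, h3⟩ := hf
  have e1 : (A * F.A).toCols₁ = A * F.A.toCols₁ := by ext i j; simp [Matrix.mul_apply]
  have e2 : (A * F.A).toCols₂ = A * F.A.toCols₂ := by ext i j; simp [Matrix.mul_apply]
  refine ⟨?_, ?_, ?_⟩
  · simp [Aff.comp, e1, h1, GaussHom.comp, GaussHom.affine]
  · simp [Aff.comp, h2, GaussHom.comp, GaussHom.affine]
  · simp [Aff.comp, e2, ← h3, GaussHom.comp, GaussHom.affine, Matrix.mul_assoc]

theorem reindex_eq_affine {X Y : Type} [DecidableEq X] (σ : Y → X) :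
    GaussHom.reindex σ = GaussHom.affine (Aff.proj σ).A (Aff.proj σ).b := rfl

theorem Realizes.reindex [DecidableEq X] [DecidableEq N] (σ : Y → X) :
    Realizes (N := N) (GaussHom.reindex σ) (Aff.proj (Sum.inl ∘ σ)) := by
  have h := Realizes.affine (N := N) (Aff.proj σ).A (Aff.proj σ).b
  rw [reindex_eq_affine]
  convert h using 1
  exact Aff.ext_eval fun x => by
    rw [Aff.eval_comp]
    change _ = (Aff.proj σ).eval _
    simp [Function.comp_assoc]

theorem Realizes.reindex_comp [DecidableEq Y] {f : GaussHom X Y} {F : Aff (X ⊕ N) Y}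
    (hf : Realizes f F) (σ : Z → Y) : Realizes ((GaussHom.reindex σ).comp f) (F.sel σ) := by
  have h := hf.affine_comp (Aff.proj σ).A (Aff.proj σ).b
  rw [reindex_eq_affine]
  convert h using 1
  exact (Aff.proj_comp σ F).symm

/-- The two stages use separate noise, and the noise of the first is transported by the linear part
of the second, giving the covariance `A Ξ Aᵀ + Σ`. -/
theorem Realizes.comp [DecidableEq X] [DecidableEq N] [DecidableEq M]
    {f : GaussHom X Y} {F : Aff (X ⊕ N) Y} (hf : Realizes f F)
    {g : GaussHom Y Z} {G : Aff (Y ⊕ M) Z} (hg : Realizes g G) :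
    Realizes (g.comp f) (G.comp ((F.comp (Aff.proj (Sum.elim Sum.inl (Sum.inr ∘ Sum.inl)))).pair
      (Aff.proj (Sum.inr ∘ Sum.inr))) : Aff (X ⊕ (N ⊕ M)) Z) := by
  obtain ⟨h1, h2, h3⟩ := hf
  obtain ⟨g1, g2, g3⟩ := hg
  set H := (G.comp ((F.comp (Aff.proj (Sum.elim Sum.inl (Sum.inr ∘ Sum.inl)))).pair
      (Aff.proj (Sum.inr ∘ Sum.inr))) : Aff (X ⊕ (N ⊕ M)) Z) with hH
  have e1 : H.A.toCols₁ = G.A.toCols₁ * F.A.toCols₁ := by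
    ext i j; simp [hH, Aff.comp, Aff.proj, Aff.pair, Matrix.mul_apply]
  have e2 : H.A.toCols₂ = fromCols (G.A.toCols₁ * F.A.toCols₂) G.A.toCols₂ := by
    ext i (j | j) <;> simp [hH, Aff.comp, Aff.proj, Aff.pair, Matrix.mul_apply]
  refine ⟨by rw [e1, h1, g1]; rfl, ?_, ?_⟩
  · have : H.b = G.A.toCols₁ *ᵥ F.b + G.b := by
      ext i; simp [hH, Aff.comp, Aff.proj, Aff.pair, mulVec, dotProduct]
    rw [this, g1, h2, g2]; rfl
  · rw [e2, transpose_fromCols, fromCols_mul_fromRows, g3]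
    simp [GaussHom.comp, ← h3, ← g1, Matrix.mul_assoc]

theorem Realizes.tensor [DecidableEq X] [DecidableEq N] [DecidableEq M] [DecidableEq X']
    {f : GaussHom X Y} {F : Aff (X ⊕ N) Y} (hf : Realizes f F)
    {g : GaussHom X' Y'} {G : Aff (X' ⊕ M) Y'} (hg : Realizes g G) :
    Realizes (f.tensor g)
      ((F.comp (Aff.proj (Sum.elim (Sum.inl ∘ Sum.inl) (Sum.inr ∘ Sum.inl)))).pair
        (G.comp (Aff.proj (Sum.elim (Sum.inl ∘ Sum.inr) (Sum.inr ∘ Sum.inr)))) :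
        Aff ((X ⊕ X') ⊕ (N ⊕ M)) (Y ⊕ Y')) := by
  obtain ⟨h1, h2, h3⟩ := hf
  obtain ⟨g1, g2, g3⟩ := hg
  set H := ((F.comp (Aff.proj (Sum.elim (Sum.inl ∘ Sum.inl) (Sum.inr ∘ Sum.inl)))).pair
        (G.comp (Aff.proj (Sum.elim (Sum.inl ∘ Sum.inr) (Sum.inr ∘ Sum.inr)))) :
        Aff ((X ⊕ X') ⊕ (N ⊕ M)) (Y ⊕ Y')) with hH
  have e1 : H.A.toCols₁ = fromBlocks F.A.toCols₁ 0 0 G.A.toCols₁ := by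
    ext (i | i) (j | j) <;> simp [hH, Aff.comp, Aff.proj, Aff.pair, Matrix.mul_apply]
  have e2 : H.A.toCols₂ = fromBlocks F.A.toCols₂ 0 0 G.A.toCols₂ := by
    ext (i | i) (j | j) <;> simp [hH, Aff.comp, Aff.proj, Aff.pair, Matrix.mul_apply]
  refine ⟨by rw [e1, h1, g1]; rfl, ?_, ?_⟩
  · have : H.b = Sum.elim F.b G.b := by
      ext (i | i) <;> simp [hH, Aff.comp, Aff.proj, Aff.pair]
    rw [this, h2, g2]; rfl
  · rw [e2, fromBlocks_transpose, fromBlocks_multiply]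
    simp [GaussHom.tensor, ← h3, ← g3]

end realizes

/-! ## Running morphisms of `Obs(Gauss)` on random inputs -/

section run

variable {W X Y Z X' Y' N M : Type} [Fintype W] [Fintype X] [Fintype Y] [Fintype Z] [Fintype N]
  [Fintype M] [Fintype X'] [Fintype Y'] [DecidableEq W] [DecidableEq X] [DecidableEq Y]
  [DecidableEq Z] [DecidableEq N] [DecidableEq M] [DecidableEq X'] [DecidableEq Y']

/-- The joint law of `z ∼ p` and the output of `F` on input `ρ z`, conditioned on the observation
`o`. -/
def runAff {K : Type} [Fintype K] (F : Aff (X ⊕ N) (Y ⊕ K)) (o : K → ℝ) (p : State Z)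
    (ρ : Aff Z X) : Option (State (Z ⊕ Y)) :=
  (cnd (noise p N) ((F.comp (ρ.par (Aff.id N))).sel Sum.inr) o).map
    (push · ((Aff.proj Sum.inl).pair ((F.comp (ρ.par (Aff.id N))).sel Sum.inl)))

/-- The joint law of `z ∼ p` and the output of `f` on input `ρ z`, conditioned on the observation
of `f`; `none` if the observation fails. -/
def ObsHom.run (f : ObsHom X Y) (p : State Z) (ρ : Aff Z X) : Option (State (Z ⊕ Y)) :=
  runAff (Classical.choose (exists_realizes f.f)) f.o p ρ

/-- A run depends only on the joint law of `z` and the full output of `F`, as conditioning and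
marginalization take place afterwards. By `push_noise_congr` that law depends only on the morphism
being realized. Hence `ObsHom.run` may be computed with any convenient realization. -/
theorem runAff_congr {K : Type} [Fintype K] [DecidableEq K] {f : GaussHom X (Y ⊕ K)}
    {F : Aff (X ⊕ N) (Y ⊕ K)}
    {G : Aff (X ⊕ M) (Y ⊕ K)} (hF : Realizes f F) (hG : Realizes f G) (o : K → ℝ) (p : State Z)
    (ρ : Aff Z X) : runAff F o p ρ = runAff G o p ρ := by
  have key : ∀ {N : Type} [Fintype N] [DecidableEq N] (F : Aff (X ⊕ N) (Y ⊕ K)),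
      runAff F o p ρ = (cnd (push (noise p N) ((Aff.proj Sum.inl).pair (F.comp (ρ.par (Aff.id N)))))
        (Aff.proj (Sum.inr ∘ Sum.inr)) o).map
          (push · (Aff.proj (Sum.elim Sum.inl (Sum.inr ∘ Sum.inl)))) := by
    intro N _ _ F
    rw [cnd_push, Option.map_map, runAff]
    congr 1
    · funext q
      simp only [Function.comp_apply, push_push]
      congr 1
      exact Aff.ext_eval fun x => by ext (i | i) <;> simp
    · congr 1
      exact Aff.ext_eval fun x => by ext i; simp
  rw [key, key]
  congr 2
  have hA : ∀ {N : Type} [Fintype N] [DecidableEq N] (F : Aff (X ⊕ N) (Y ⊕ K)),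
      ((Aff.proj Sum.inl).pair (F.comp (ρ.par (Aff.id N))) : Aff (Z ⊕ N) (Z ⊕ (Y ⊕ K))).A =
        fromBlocks 1 0 (F.A.toCols₁ * ρ.A) F.A.toCols₂ := by
    intro N _ _ F
    ext (i | i) (j | j) <;> simp [Aff.pair, Aff.par, Aff.comp, Aff.proj, Aff.id, Matrix.mul_apply,
      Matrix.one_apply]
  have hb : ∀ {N : Type} [Fintype N] [DecidableEq N] (F : Aff (X ⊕ N) (Y ⊕ K)),
      ((Aff.proj Sum.inl).pair (F.comp (ρ.par (Aff.id N))) : Aff (Z ⊕ N) (Z ⊕ (Y ⊕ K))).b =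
        Sum.elim (0 : Z → ℝ) (F.A.toCols₁ *ᵥ ρ.b + F.b) := by
    intro N _ _ F
    ext (i | i) <;> simp [Aff.pair, Aff.par, Aff.comp, Aff.proj, Aff.id, mulVec, dotProduct]
  have h1 : ∀ {N : Type} (S : Matrix (Y ⊕ K) Z ℝ) (T : Matrix (Y ⊕ K) N ℝ),
      (fromBlocks (1 : Matrix Z Z ℝ) 0 S T).toCols₁ = fromRows 1 S := by
    intro N S T; ext (i | i) j <;> simp
  have h2 : ∀ {N : Type} (S : Matrix (Y ⊕ K) Z ℝ) (T : Matrix (Y ⊕ K) N ℝ),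
      (fromBlocks (1 : Matrix Z Z ℝ) 0 S T).toCols₂ = fromRows 0 T := by
    intro N S T; ext (i | i) j <;> simp
  apply push_noise_congr
  · rw [hA, hA, h1, h1, hF.1, hG.1]
  · rw [hb, hb, hF.1, hG.1, hF.2.1, hG.2.1]
  · rw [hA, hA, h2, h2, transpose_fromRows, transpose_fromRows, fromRows_mul_fromCols,
      fromRows_mul_fromCols, hF.2.2, hG.2.2]
    simp

theorem ObsHom.run_eq (f : ObsHom X Y) {F : Aff (X ⊕ N) (Y ⊕ f.K)} (hF : Realizes f.f F)
    (p : State Z) (ρ : Aff Z X) : f.run p ρ = runAff F f.o p ρ :=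
  runAff_congr (Classical.choose_spec (exists_realizes f.f)) hF _ _ _

theorem ObsHom.run_mk {K : Type} [Fintype K] [DecidableEq K] {f : GaussHom X (Y ⊕ K)}
    {F : Aff (X ⊕ N) (Y ⊕ K)} (hF : Realizes f F) (o : K → ℝ) (p : State Z) (ρ : Aff Z X) :
    (ObsHom.mk K f o).run p ρ =
      (cnd (noise p N) ((F.comp (ρ.par (Aff.id N))).sel Sum.inr) o).map
        (push · ((Aff.proj Sum.inl).pair ((F.comp (ρ.par (Aff.id N))).sel Sum.inl))) :=
  (ObsHom.mk K f o).run_eq hF p ρ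

theorem ObsHom.run_push (f : ObsHom X Y) (p : State W) (g : Aff W Z) (ρ : Aff Z X) :
    f.run (push p g) ρ = (f.run p (ρ.comp g)).map (push · (g.par (Aff.id Y))) := by
  obtain ⟨F, hF⟩ := exists_realizes f.f
  rw [f.run_eq hF, f.run_eq hF, runAff, runAff, noise_push, cnd_push, Option.map_map,
    Option.map_map]
  congr 1
  · funext q
    simp only [Function.comp_apply, push_push]
    congr 1
    exact Aff.ext_eval fun x => by ext (i | i) <;> simp
  · congr 1
    exact Aff.ext_eval fun x => by ext i; simp

theorem ObsHom.run_J_affine (A : Matrix Y X ℝ) (b : Y → ℝ) (p : State Z) (ρ : Aff Z X) :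
    (ObsHom.J (GaussHom.affine A b)).run p ρ =
      some (push p ((Aff.id Z).pair ((Aff.mk A b).comp ρ))) := by
  have h := (Realizes.affine (N := Empty) A b).reindex_comp (Sum.elim (fun y => y) Empty.elim)
  refine (ObsHom.run_mk h _ p ρ).trans ?_
  rw [cnd_isEmpty, Option.map_some]
  conv_rhs => rw [← push_noise_fst (N := Empty) p, push_push]
  congr 2
  exact Aff.ext_eval fun x => by ext (i | i) <;> simp

theorem cnd_bind_noise {K V : Type} [Fintype K] (p : State Z) (δ : Aff Z K) (o : K → ℝ)
    (k : State (Z ⊕ M) → Option V) :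
    (cnd p δ o).bind (fun q => k (noise q M)) =
      (cnd (noise p M) (δ.comp (Aff.proj Sum.inl)) o).bind k := by
  rw [cnd_noise, Option.bind_map]
  rfl

/-- Two successive draws of noise are part of one larger draw. The injection `σ` leaves room for
noise coordinates that are never read. -/
theorem noise_noise_reindex {L : Type} [Fintype L] [DecidableEq L] (p : State Z) {σ : M → L}
    (hσ : Function.Injective σ) :
    noise (noise p N) M = push (noise p (N ⊕ L))
      (Aff.proj (Sum.elim (Sum.elim Sum.inl (Sum.inr ∘ Sum.inl)) (Sum.inr ∘ Sum.inr ∘ σ))) := by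
  rw [noise_noise, ← push_noise_reindex (σ := Sum.map _root_.id σ) p
    (Function.injective_id.sumMap hσ), push_push]
  congr 1
  exact Aff.ext_eval fun x => by ext ((i | i) | i) <;> simp

theorem Option.bind_map_right {A B C : Type*} (x : Option A) (f : A → Option B) (g : B → C) :
    (x.bind fun a => (f a).map g) = (x.bind f).map g := by
  cases x <;> rfl

/-- Normal form of a two-stage run: the noise of the second stage commutes with the first
conditioning, so everything is drawn at the start and two successive conditionings remain. These can
then be merged by `cnd_pair`. -/
theorem cnd_bind_cnd {K L M' U V : Type} [Fintype K] [Fintype L] [Fintype M'] [DecidableEq M']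
    [Fintype U] [Fintype V] [DecidableEq V] (p : State Z) (δ : Aff (Z ⊕ N) K)
    (o : K → ℝ) (h : Aff (Z ⊕ N) V) (ε : Aff (V ⊕ M) L) (o' : L → ℝ) (k : Aff (V ⊕ M) U)
    {σ : M → M'} (hσ : Function.Injective σ) :
    ((cnd (noise p N) δ o).map (push · h)).bind
        (fun q => (cnd (noise q M) ε o').map (push · k)) =
      (cnd (noise p (N ⊕ M')) (δ.comp (Aff.proj (Sum.map _root_.id Sum.inl))) o).bind fun q =>
        (cnd q (ε.comp ((h.comp (Aff.proj (Sum.map _root_.id Sum.inl))).pair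
          (Aff.proj (Sum.inr ∘ Sum.inr ∘ σ)))) o').map
          (push · (k.comp ((h.comp (Aff.proj (Sum.map _root_.id Sum.inl))).pair
            (Aff.proj (Sum.inr ∘ Sum.inr ∘ σ))))) := by
  have e1 : ∀ q, ((fun q => (cnd (noise q M) ε o').map (push · k)) ∘ (push · h)) q =
      (fun r => (cnd r (ε.comp (h.par (Aff.id M))) o').map
        (push · (k.comp (h.par (Aff.id M))))) (noise q M) := by
    intro q
    simp only [Function.comp_apply, noise_push, cnd_push, Option.map_map]
    congr 1
    funext r
    simp [push_push]
  rw [Option.bind_map, funext e1, cnd_bind_noise (noise p N) δ o (fun r =>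
    (cnd r (ε.comp (h.par (Aff.id M))) o').map (push · (k.comp (h.par (Aff.id M))))), noise_noise_reindex p hσ, cnd_push,
    Option.bind_map]
  have e2 : (δ.comp (Aff.proj Sum.inl)).comp
      (Aff.proj (Sum.elim (Sum.elim Sum.inl (Sum.inr ∘ Sum.inl)) (Sum.inr ∘ Sum.inr ∘ σ))) =
      (δ.comp (Aff.proj (Sum.map _root_.id Sum.inl)) : Aff (Z ⊕ (N ⊕ M')) K) := by
    refine Aff.ext_eval fun x => ?_
    simp only [Aff.eval_comp, Aff.eval_proj]
    congr 1
  have e3 : ((h.par (Aff.id M)).comp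
      (Aff.proj (Sum.elim (Sum.elim Sum.inl (Sum.inr ∘ Sum.inl)) (Sum.inr ∘ Sum.inr ∘ σ))) :
        Aff (Z ⊕ (N ⊕ M')) (V ⊕ M)) =
      (h.comp (Aff.proj (Sum.map _root_.id Sum.inl))).pair (Aff.proj (Sum.inr ∘ Sum.inr ∘ σ)) := by
    refine Aff.ext_eval fun x => ?_
    simp only [Aff.eval_comp, Aff.eval_proj, Aff.eval_par, Aff.eval_pair, Aff.eval_id]
    refine congrArg₂ _ (congrArg _ ?_) rfl
    ext (i | i) <;> rfl
  rw [e2]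
  congr 1
  funext r
  simp only [Function.comp_apply, cnd_push, Option.map_map, Aff.comp_assoc, e3]
  congr 1
  funext r
  simp only [Function.comp_apply, push_push, Aff.comp_assoc, e3]

/-- The composite observes the pair of both observations jointly; `cnd_pair'` splits this into
conditioning on the observation of `f` and then on that of `g`. -/
theorem ObsHom.run_comp (g : ObsHom Y W) (f : ObsHom X Y) (p : State Z) (ρ : Aff Z X) :
    (g.comp f).run p ρ = (f.run p ρ).bind fun q => (g.run q (Aff.proj Sum.inr)).map
      (push · (Aff.proj (Sum.elim (Sum.inl ∘ Sum.inl) Sum.inr))) := by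
  obtain ⟨F, hF⟩ := exists_realizes f.f
  obtain ⟨G, hG⟩ := exists_realizes g.f
  have h := (hF.comp (hG.tensor (Realizes.reindex (N := Empty) (fun k : f.K => k)))).reindex_comp
    (Sum.elim (fun z => Sum.inl (Sum.inl z))
      (Sum.elim (fun k => Sum.inl (Sum.inr k)) (fun k => Sum.inr k)))
  refine (ObsHom.run_mk h _ p ρ).trans ?_
  simp only [f.run_eq hF, g.run_eq hG, runAff, Option.map_map, Function.comp_def, push_push]
  -- The identity on the observation space of `f` was realized with empty noise, so the noise of `g`
  -- sits in the left summand.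
  rw [cnd_bind_cnd _ _ _ _ _ _ _ (Sum.inl_injective : Function.Injective
    (Sum.inl : (W ⊕ g.K) → (W ⊕ g.K) ⊕ Empty))]
  rw [Option.bind_map_right, ← cnd_pair']
  congr 1
  · funext q
    congr 1
    refine Aff.ext_eval fun x => ?_
    ext (i | i)
    · simp
    · simp
      exact congrFun (congrArg G.eval (by
        ext (j | j)
        · exact congrFun (congrArg F.eval (by ext (j | j) <;> rfl)) _
        · rfl)) _
  · congr 1
    refine Aff.ext_eval fun x => ?_
    ext (i | i)
    · simp
      exact congrFun (congrArg G.eval (by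
        ext (j | j)
        · exact congrFun (congrArg F.eval (by ext (j | j) <;> rfl)) _
        · rfl)) _
    · simp
      exact congrFun (congrArg F.eval (by ext (j | j) <;> rfl)) _

/-- The factors act on separate inputs but may be correlated through `z`, so the observation of `f`
can change the law of the input of `g`. This is why the second run starts from the posterior of the
first. -/
theorem ObsHom.run_tensor (f : ObsHom X Y) (g : ObsHom X' Y') (p : State Z)
    (ρ : Aff Z (X ⊕ X')) :
    (f.tensor g).run p ρ = (f.run p (ρ.sel Sum.inl)).bind fun q =>
      (g.run q ((ρ.sel Sum.inr).comp (Aff.proj Sum.inl))).map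
        (push · (Aff.proj (Sum.elim (Sum.inl ∘ Sum.inl) (Sum.map Sum.inr _root_.id)))) := by
  obtain ⟨F, hF⟩ := exists_realizes f.f
  obtain ⟨G, hG⟩ := exists_realizes g.f
  have h := (hF.tensor hG).reindex_comp (Sum.elim
      (Sum.elim (fun y => Sum.inl (Sum.inl y)) (fun y => Sum.inr (Sum.inl y)))
      (Sum.elim (fun k => Sum.inl (Sum.inr k)) (fun k => Sum.inr (Sum.inr k))))
  refine (ObsHom.run_mk h _ p ρ).trans ?_
  simp only [f.run_eq hF, g.run_eq hG, runAff, Option.map_map, Function.comp_def, push_push]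
  rw [cnd_bind_cnd _ _ _ _ _ _ _ Function.injective_id, Option.bind_map_right, ← cnd_pair]
  congr 1
  · funext q
    congr 1
    refine Aff.ext_eval fun x => ?_
    ext (i | (i | i))
    · simp
    · simp
      exact congrFun (congrArg F.eval (by ext (j | j) <;> rfl)) _
    · simp
      exact congrFun (congrArg G.eval (by ext (j | j) <;> rfl)) _
  · congr 1
    refine Aff.ext_eval fun x => ?_
    ext (i | i)
    · simp
      exact congrFun (congrArg F.eval (by ext (j | j) <;> rfl)) _
    · simp
      exact congrFun (congrArg G.eval (by ext (j | j) <;> rfl)) _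

theorem ObsHom.run_observe (o : X → ℝ) (p : State Z) (ρ : Aff Z X) :
    (ObsHom.observe o).run p ρ =
      (cnd p ρ o).map (push · ((Aff.id Z).pair (Aff.const Empty.elim))) := by
  refine (ObsHom.run_mk (Realizes.reindex (N := Empty) _) _ p ρ).trans ?_
  conv_rhs => rw [← push_noise_fst (N := Empty) p, cnd_push, Option.map_map]
  congr 1
  · funext q
    simp only [Function.comp_apply, push_push]
    congr 1
    refine Aff.ext_eval fun x => ?_
    ext (i | i)
    · simp
    · exact i.elim
  · congr 1
    refine Aff.ext_eval fun x => ?_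
    ext i
    simp

theorem Realizes.comp_eq {f : GaussHom X Y} {F : Aff (X ⊕ N) Y} (hf : Realizes f F) (p : State X) :
    f.comp p = push (noise p N) F := by
  apply State.ext'
  · simp only [push_b, noise, Aff.eval, GaussHom.comp]
    rw [← fromCols_toCols F.A, fromCols_mulVec, hf.1, hf.2.1]
    simp
  · rw [push_noise_cov, hf.1, hf.2.2]; rfl

/-- The posterior law denoted by a state, `none` if the observation fails. -/
def ObsHom.out (s : ObsHom Empty W) : Option (State W) :=
  (s.run (GaussHom.point 0) (Aff.id Empty)).map (push · (Aff.proj Sum.inr))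

theorem ObsHom.out_eq (s : ObsHom Empty W) :
    s.out = (cnd s.f (Aff.proj Sum.inr) s.o).map (push · (Aff.proj Sum.inl)) := by
  obtain ⟨F, hF⟩ := exists_realizes s.f
  -- A state is a morphism applied to the only point of `ℝ^0`, so its law is the pushforward of pure
  -- noise along a realization.
  have e : s.f = s.f.comp (GaussHom.point 0) := by
    apply State.ext'
    all_goals
      simp [GaussHom.comp, GaussHom.point, GaussHom.affine]
  rw [e, hF.comp_eq, cnd_push, Option.map_map, ObsHom.out, s.run_eq hF, runAff, Option.map_map]
  congr 1
  · funext q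
    simp only [Function.comp_apply, push_push]
    congr 1
    refine Aff.ext_eval fun x => ?_
    have : Sum.elim (x ∘ Sum.inl) (x ∘ Sum.inr) = x := Sum.elim_comp_inl_inr x
    ext i <;> simp [this]
  · congr 1
    refine Aff.ext_eval fun x => ?_
    have : Sum.elim (x ∘ Sum.inl) (x ∘ Sum.inr) = x := Sum.elim_comp_inl_inr x
    ext i; simp [this]

end run

/-! ## Equivalence of states and of morphisms in terms of posteriors -/

section equiv

variable {W X Y Z K : Type} [Fintype W] [Fintype X] [Fintype Y] [Fintype Z] [Fintype K]
  [DecidableEq W] [DecidableEq X] [DecidableEq Y] [DecidableEq Z] [DecidableEq K]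

/-- The three conditions compare the cross covariance with `x`, the mean, and the covariance of the
second component of the joint law of `(x, f x)`. -/
theorem aeEq_iff (μ : State X) (f g : GaussHom X Y) :
    GaussHom.AEEq μ f g ↔ f.A * μ.cov = g.A * μ.cov ∧ f.A *ᵥ μ.b + f.b = g.A *ᵥ μ.b + g.b ∧
      f.A * μ.cov * f.Aᵀ + f.cov = g.A * μ.cov * g.Aᵀ + g.cov := by
  have hid : (GaussHom.id X).A = 1 := by
    ext i j; simp [GaussHom.id, GaussHom.reindex, GaussHom.affine, Matrix.one_apply]
  have hb : ∀ f : GaussHom X Y, (((GaussHom.id X).tuple f).comp μ).b =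
      Sum.elim μ.b (f.A *ᵥ μ.b + f.b) := by
    intro f
    rw [GaussHom.tuple_eq]
    simp only [GaussHom.comp, hid, fromRows_mulVec]
    ext (i | i) <;> simp [GaussHom.id, GaussHom.reindex, GaussHom.affine]
  have hc : ∀ f : GaussHom X Y, (((GaussHom.id X).tuple f).comp μ).cov =
      fromBlocks μ.cov (μ.cov * f.Aᵀ) (f.A * μ.cov) (f.A * μ.cov * f.Aᵀ + f.cov) := by
    intro f
    rw [GaussHom.tuple_eq]
    simp only [GaussHom.comp, hid]
    rw [fromRows_mul, transpose_fromRows, fromRows_mul_fromCols, fromBlocks_add]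
    simp [GaussHom.id, GaussHom.reindex, GaussHom.affine]
  constructor
  · intro h
    have h1 := congrArg GaussHom.b h
    have h2 := congrArg GaussHom.cov h
    rw [hb, hb] at h1
    rw [hc, hc, fromBlocks_inj] at h2
    exact ⟨h2.2.2.1, by simpa using congrArg (· ∘ Sum.inr) h1, h2.2.2.2⟩
  · rintro ⟨h1, h2, h3⟩
    have h1' := congrArg transpose h1
    rw [transpose_mul, transpose_mul, State.cov_transpose] at h1'
    apply State.ext'
    · rw [hb, hb, h2]
    · rw [hc, hc, h3, h1, h1']

/-- Absolute continuity of a point mass is membership in the affine support. Off the support, a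
linear functional separates the point. On it, almost surely equal morphisms have linear parts
agreeing on the range of the covariance and equal noise, hence agree at the point. -/
theorem absCont_point_iff (ν : State X) (o : X → ℝ) :
    GaussHom.AbsCont (GaussHom.point o) ν ↔ ∃ y, ν.cov *ᵥ y = o - ν.b := by
  constructor
  · intro h
    by_contra hy
    have hm : o - ν.b ∉ LinearMap.range ν.cov.mulVecLin := by
      rintro ⟨y, e⟩
      exact hy ⟨y, e⟩
    -- The functional `φ`, with coefficient vector `t`, kills the range of the covariance, so `t ⬝ᵥ
    -- x` is almost surely constant under `ν`; yet it takes a different value at `o`.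
    obtain ⟨φ, hφ, hr⟩ := Submodule.exists_le_ker_of_notMem hm
    set t : X → ℝ := fun i => φ (Pi.single i 1) with ht
    have hφt : ∀ x, φ x = t ⬝ᵥ x := by
      intro x
      rw [LinearMap.pi_apply_eq_sum_univ φ x]
      refine Finset.sum_congr rfl fun i _ => ?_
      rw [ht, smul_eq_mul, mul_comm]
      congr 2
      ext j; simp [Pi.single_apply, eq_comm]
    have hker : ∀ y, t ⬝ᵥ (ν.cov *ᵥ y) = 0 := by
      intro y
      rw [← hφt]
      exact hr ⟨y, rfl⟩
    have hv : t ᵥ* ν.cov = 0 := by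
      apply dotProduct_eq
      intro y
      rw [← dotProduct_mulVec, hker]; simp
    have hA : (Matrix.of fun (_ : Unit) => t) * ν.cov = 0 := by
      ext i j
      exact congrFun hv j
    have := h Unit (GaussHom.affine (Matrix.of fun _ => t) 0)
      (GaussHom.affine 0 (fun _ => t ⬝ᵥ ν.b)) (by
        rw [aeEq_iff]
        refine ⟨?_, ?_, ?_⟩
        · simp [GaussHom.affine, hA]
        · ext i; simp [GaussHom.affine, mulVec]
        · simp [GaussHom.affine, hA])
    rw [aeEq_iff] at this
    have h2 := congrFun this.2.1 ()
    simp [GaussHom.affine, GaussHom.point, mulVec] at h2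
    apply hφ
    rw [hφt, dotProduct_sub, h2, sub_self]
  · rintro ⟨y, hy⟩ Y _ f g h
    classical
    rw [aeEq_iff] at h ⊢
    obtain ⟨h1, h2, h3⟩ := h
    have hc : f.cov = g.cov := by
      have h1' := congrArg transpose h1
      rw [transpose_mul, transpose_mul, State.cov_transpose] at h1'
      rw [h1, Matrix.mul_assoc, h1', ← Matrix.mul_assoc] at h3
      exact add_left_cancel h3
    refine ⟨by simp [GaussHom.point, GaussHom.affine], ?_, by
      simp [GaussHom.point, GaussHom.affine, hc]⟩
    have ho : o = ν.b + ν.cov *ᵥ y := by rw [hy]; abel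
    change f.A *ᵥ o + f.b = g.A *ᵥ o + g.b
    rw [ho, mulVec_add, mulVec_add, mulVec_mulVec, mulVec_mulVec, h1, add_right_comm, h2]
    abel

theorem proj_inr_mul_cov (S : Matrix (X ⊕ K) (X ⊕ K) ℝ) :
    (Aff.proj Sum.inr : Aff (X ⊕ K) K).A * S = fromCols S.toBlocks₂₁ S.toBlocks₂₂ := by
  ext i (j | j) <;> simp [Aff.proj, Matrix.mul_apply, toBlocks₂₁, toBlocks₂₂]

theorem cov_mul_proj_inr (S : Matrix (X ⊕ K) (X ⊕ K) ℝ) :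
    S * (Aff.proj Sum.inr : Aff (X ⊕ K) K).Aᵀ = fromRows S.toBlocks₁₂ S.toBlocks₂₂ := by
  ext (i | i) j <;> simp [Aff.proj, Matrix.mul_apply, toBlocks₁₂, toBlocks₂₂]

theorem proj_inr_cov_proj_inr (S : Matrix (X ⊕ K) (X ⊕ K) ℝ) :
    (Aff.proj Sum.inr : Aff (X ⊕ K) K).A * S * (Aff.proj Sum.inr : Aff (X ⊕ K) K).Aᵀ =
      S.toBlocks₂₂ := by
  ext i j; simp [Aff.proj, Matrix.mul_apply, toBlocks₂₂]

theorem ObsHom.succeeds_iff (s : ObsHom Empty X) :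
    s.Succeeds ↔ ∃ q, Post s.f (Aff.proj Sum.inr) s.o q := by
  rw [ObsHom.Succeeds, absCont_point_iff, exists_post_iff, GaussHom.marginal₂_b,
    GaussHom.marginal₂_cov, proj_inr_cov_proj_inr, Aff.eval_proj]

/-- Any conditional `c` satisfies `c.A Σ₂₂ = Σ₁₂`, has mean `b₁` at `b₂`, and has noise covariance
`Σ₁₁ - c.A Σ₂₁`. At a point `o = b₂ + Σ₂₂ y` of the support, these relations determine its value,
which is that of `Post`. The arbitrary choice in `GaussHom.conditional` is thereby harmless. -/
theorem ObsHom.posterior_eq (s : ObsHom Empty X) {q : State (X ⊕ s.K)}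
    (hq : Post s.f (Aff.proj Sum.inr) s.o q) : push q (Aff.proj Sum.inl) = s.posterior := by
  obtain ⟨y, N, h1, h2, h3, h4⟩ := hq
  have hc : GaussHom.IsConditional s.f (GaussHom.conditional s.f) :=
    Classical.choose_spec (GaussHom.exists_isConditional s.f)
  rw [ObsHom.posterior]
  set c := GaussHom.conditional s.f
  set S := s.f.cov with hS
  rw [proj_inr_cov_proj_inr] at h1 h2
  rw [proj_inr_mul_cov] at h2
  rw [cov_mul_proj_inr] at h3 h4
  have hid : (GaussHom.id s.K).A = 1 := by
    ext i j; simp [GaussHom.id, GaussHom.reindex, GaussHom.affine, Matrix.one_apply]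
  rw [GaussHom.IsConditional, GaussHom.tuple_eq] at hc
  have e1 := congrArg GaussHom.b hc
  have e2 := congrArg GaussHom.cov hc
  simp only [GaussHom.comp, hid, fromRows_mulVec, GaussHom.marginal₂_b] at e1
  simp only [GaussHom.comp, hid, GaussHom.marginal₂_cov] at e2
  rw [fromRows_mul, transpose_fromRows, fromRows_mul_fromCols, fromBlocks_add, ← hS] at e2
  conv_rhs at e2 => rw [← fromBlocks_toBlocks S]
  rw [fromBlocks_inj] at e2
  simp only [transpose_one, Matrix.mul_one, Matrix.one_mul, add_zero] at e2
  obtain ⟨c11, c12, c21, -⟩ := e2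
  have e3 : c.A *ᵥ (s.f.b ∘ Sum.inr) + c.b = s.f.b ∘ Sum.inl := by
    ext i; simpa using congrFun e1 (Sum.inl i)
  have hN : S.toBlocks₂₂ * N.toCols₁ = S.toBlocks₂₁ := by
    have := congrArg toCols₁ h2
    rw [toCols₁_fromCols] at this
    rw [← this]; ext i j; simp [Matrix.mul_apply]
  apply State.ext'
  · rw [push_b, Aff.eval_proj, h3, fromRows_mulVec]
    simp only [GaussHom.comp, GaussHom.point, GaussHom.affine]
    rw [Aff.eval_proj] at h1
    have : s.o = s.f.b ∘ Sum.inr + S.toBlocks₂₂ *ᵥ y := by rw [h1]; abel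
    rw [this, mulVec_add, mulVec_mulVec, c12, add_right_comm, e3]
    ext i; simp
  · have hq : (push q (Aff.proj Sum.inl)).cov = q.cov.toBlocks₁₁ := by
      ext i j; simp [Aff.proj, Matrix.mul_apply, toBlocks₁₁]
    have hs : (S.toBlocks₁₂.fromRows S.toBlocks₂₂ * N).toBlocks₁₁ = S.toBlocks₁₂ * N.toCols₁ := by
      ext i j; simp [Matrix.mul_apply, toBlocks₁₁]
    have : q.cov.toBlocks₁₁ = S.toBlocks₁₁ - S.toBlocks₁₂ * N.toCols₁ := by
      rw [← hs, h4]; rfl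
    rw [hq, this, ← c12, Matrix.mul_assoc, hN, ← c11, ← c21]
    simp [GaussHom.comp, GaussHom.point, GaussHom.affine, Matrix.mul_assoc]

theorem ObsHom.stateEquiv_iff (s t : ObsHom Empty X) : StateEquiv s t ↔ s.out = t.out := by
  have key : ∀ s : ObsHom Empty X, (s.Succeeds ∧ s.out = some s.posterior) ∨
      (¬ s.Succeeds ∧ s.out = none) := by
    intro s
    rw [s.succeeds_iff, s.out_eq]
    by_cases h : ∃ q, Post s.f (Aff.proj Sum.inr) s.o q
    · obtain ⟨q, hq⟩ := h
      refine Or.inl ⟨⟨q, hq⟩, ?_⟩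
      rw [cnd_eq_some.2 hq, Option.map_some, s.posterior_eq hq]
    · refine Or.inr ⟨h, ?_⟩
      rw [cnd_eq_none.2 h, Option.map_none]
  unfold StateEquiv
  rcases key s with ⟨h1, h2⟩ | ⟨h1, h2⟩ <;> rcases key t with ⟨k1, k2⟩ | ⟨k1, k2⟩ <;>
    simp [h1, h2, k1, k2]

theorem map_push_push (q : Option (State X)) (f : Aff X Y) (g : Aff Y Z) :
    (q.map (push · f)).map (push · g) = q.map (push · (g.comp f)) := by
  cases q <;> simp [push_push]

theorem map_push_congr {q r : Option (State X)} {f g : Aff X Y} (h : q = r) (hf : f = g) :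
    q.map (push · f) = r.map (push · g) := by rw [h, hf]

theorem ObsHom.run_id (p : State Z) (ρ : Aff Z X) :
    (ObsHom.id X).run p ρ = some (push p ((Aff.id Z).pair ρ)) := by
  have h := ObsHom.run_J_affine (Aff.id X).A (Aff.id X).b p ρ
  rw [show (Aff.mk (Aff.id X).A (Aff.id X).b : Aff X X) = Aff.id X from rfl, Aff.id_comp] at h
  exact h

/-- Composing with `id ⊗ f` is a run of `f` on the posterior of `ψ`, with the `A` coordinates kept
and the inputs in `X` forgotten. -/
theorem ObsHom.out_tensor_id_comp {A : Type} [Fintype A] [DecidableEq A] (f : ObsHom X Y)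
    (ψ : ObsHom Empty (A ⊕ X)) :
    (((ObsHom.id A).tensor f).comp ψ).out =
      ψ.out.bind fun p => (f.run p (Aff.proj Sum.inr)).map
        (push · (Aff.proj (Sum.map Sum.inl _root_.id))) := by
  rw [ObsHom.out, ObsHom.run_comp, ObsHom.out, Option.bind_map, Option.map_bind]
  congr 1
  funext q
  rw [Function.comp_apply, Function.comp_apply, ObsHom.run_tensor, ObsHom.run_id,
    Option.bind_some]
  rw [ObsHom.run_push f _ (Aff.proj Sum.inr), ObsHom.run_push f q ((Aff.id _).pair _)]
  simp only [map_push_push]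
  refine map_push_congr (congrArg _ ?_) ?_
  · refine Aff.ext_eval fun x => ?_
    simp only [Aff.eval_comp, Aff.eval_sel, Aff.eval_proj, Aff.eval_pair, Aff.eval_id]
    rfl
  · refine Aff.ext_eval fun x => ?_
    simp only [Aff.eval_comp, Aff.eval_sel, Aff.eval_proj, Aff.eval_par, Aff.eval_pair, Aff.eval_id]
    ext (i | i) <;> rfl

theorem ObsHom.out_J (p : State X) : (ObsHom.J p).out = some p := by
  rw [ObsHom.out_eq]
  refine (congrArg _ (cnd_isEmpty (K := Empty) _ _ _)).trans ?_
  rw [Option.map_some]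
  refine congrArg some ?_
  change push (push p (Aff.proj (Sum.elim (fun y => y) Empty.elim))) (Aff.proj Sum.inl) = p
  rw [push_push]
  convert push_id p using 2
  exact Aff.ext_eval fun x => by ext i; simp

/-- Only states of the form `J` of the joint law of `(z, ρ z)` need be tested, since an arbitrary
state enters only through its posterior. Taking `A = Z` retains the sample itself. -/
theorem ObsHom.equivalent_iff (f g : ObsHom X Y) :
    Equivalent f g ↔ ∀ (Z : Type) [Fintype Z] [DecidableEq Z] (p : State Z) (ρ : Aff Z X),
      f.run p ρ = g.run p ρ := by
  constructor
  · intro h Z _ _ p ρ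
    have key : ∀ f : ObsHom X Y, (((ObsHom.id Z).tensor f).comp
        (ObsHom.J (push p ((Aff.id Z).pair ρ)))).out = f.run p ρ := by
      intro f
      rw [ObsHom.out_tensor_id_comp, ObsHom.out_J, Option.bind_some, ObsHom.run_push,
        Option.map_map]
      have e1 : (Aff.proj Sum.inr).comp ((Aff.id Z).pair ρ) = ρ :=
        Aff.ext_eval fun x => by ext i; simp
      have e2 : ((push · (Aff.proj (Sum.map Sum.inl _root_.id))) ∘
          (push · (((Aff.id Z).pair ρ).par (Aff.id Y)))) = (_root_.id : State (Z ⊕ Y) → _) := by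
        funext q
        simp only [Function.comp_apply, push_push, id_eq]
        convert push_id q using 2
        exact Aff.ext_eval fun x => by ext (i | i) <;> simp
      rw [e1, e2, Option.map_id, _root_.id]
    rw [← key f, ← key g, ← ObsHom.stateEquiv_iff]
    exact h Z _
  · intro h A _ _ ψ
    rw [ObsHom.stateEquiv_iff, ObsHom.out_tensor_id_comp, ObsHom.out_tensor_id_comp]
    simp only [h]

end equiv

/-! ## Denotation of terms on random inputs -/

section runops

variable {W X Y Z N : Type} [Fintype W] [Fintype X] [Fintype Y] [Fintype Z] [Fintype N]
  [DecidableEq W] [DecidableEq X] [DecidableEq Y] [DecidableEq Z] [DecidableEq N]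

theorem Aff.eval_mk (A : Matrix Y X ℝ) (b : Y → ℝ) (x : X → ℝ) :
    (Aff.mk A b).eval x = A *ᵥ x + b := rfl

theorem ObsHom.run_J {f : GaussHom X Y} {F : Aff (X ⊕ N) Y} (hf : Realizes f F) (p : State Z)
    (ρ : Aff Z X) : (ObsHom.J f).run p ρ =
      some (push (noise p N) ((Aff.proj Sum.inl).pair (F.comp (ρ.par (Aff.id N))))) := by
  have h := hf.reindex_comp (Sum.elim (fun y => y) Empty.elim)
  refine (ObsHom.run_mk h _ p ρ).trans ?_
  rw [cnd_isEmpty, Option.map_some]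
  rfl

theorem ObsHom.run_J_reindex (σ : Y → X) (p : State Z) (ρ : Aff Z X) :
    (ObsHom.J (GaussHom.reindex σ)).run p ρ = some (push p ((Aff.id Z).pair (ρ.sel σ))) := by
  have h := ObsHom.run_J_affine (Aff.proj σ).A (Aff.proj σ).b p ρ
  rw [show (Aff.mk (Aff.proj σ).A (Aff.proj σ).b : Aff X Y) = Aff.proj σ from rfl,
    Aff.proj_comp] at h
  exact h

theorem ObsHom.run_J_affine_comp (A : Matrix W Y ℝ) (b : W → ℝ) (f : ObsHom X Y) (p : State Z)
    (ρ : Aff Z X) : ((ObsHom.J (GaussHom.affine A b)).comp f).run p ρ =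
      (f.run p ρ).map (push · ((Aff.proj Sum.inl).pair ((Aff.mk A b).comp (Aff.proj Sum.inr)))) := by
  rw [ObsHom.run_comp]
  cases f.run p ρ with
  | none => rfl
  | some q =>
  rw [Option.bind_some, ObsHom.run_J_affine, Option.map_some, Option.map_some, push_push]
  refine congrArg some (congrArg _ (Aff.ext_eval fun x => ?_))
  ext (i | i) <;> simp

/-- Copying gives both components the same environment, but the second runs on the sample space
already conditioned by the first. This left-to-right threading of laws is what matches call-by-value
evaluation. -/
theorem ObsHom.run_tuple (f : ObsHom X Y) (g : ObsHom X W) (p : State Z) (ρ : Aff Z X) :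
    (f.tuple g).run p ρ = ((f.run p ρ).bind fun q => g.run q (ρ.comp (Aff.proj Sum.inl))).map
      (push · (Aff.proj (Sum.elim (Sum.inl ∘ Sum.inl) (Sum.map Sum.inr _root_.id)))) := by
  have hl : (Aff.proj Sum.inr).comp ((Aff.id Z).pair
      (ρ.sel (Sum.elim (fun x => x) (fun x => x)))) = ρ.sel (Sum.elim (fun x => x) (fun x => x)) :=
    Aff.ext_eval fun x => by ext i; simp
  have h1 : (ρ.sel (Sum.elim (fun x => x) (fun x => x)) : Aff Z (X ⊕ X)).sel Sum.inl = ρ :=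
    Aff.ext_eval fun x => by ext i; simp
  have h2 : (ρ.sel (Sum.elim (fun x => x) (fun x => x)) : Aff Z (X ⊕ X)).sel Sum.inr = ρ :=
    Aff.ext_eval fun x => by ext i; simp
  rw [ObsHom.tuple, ObsHom.run_comp, GaussHom.copy, ObsHom.run_J_reindex, Option.bind_some,
    ObsHom.run_push, hl, ObsHom.run_tensor, h1, h2, Option.bind_map_right, map_push_push,
    map_push_push]
  refine map_push_congr rfl (Aff.ext_eval fun x => ?_)
  simp only [Aff.eval_comp, Aff.eval_sel, Aff.eval_proj, Aff.eval_par, Aff.eval_pair, Aff.eval_id]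
  ext (i | (i | i)) <;> rfl

theorem Aff.proj_assoc : (Aff.proj (Sum.elim (Sum.inl ∘ Sum.inl) (Sum.map Sum.inr _root_.id)) :
      Aff ((Z ⊕ X) ⊕ Y) (Z ⊕ (X ⊕ Y))) =
    (Aff.proj (Sum.inl ∘ Sum.inl)).pair ((Aff.proj (Sum.inl ∘ Sum.inr)).pair (Aff.proj Sum.inr)) :=
  Aff.ext_eval fun x => by ext (i | (i | i)) <;> simp

theorem ObsHom.run_add (f g : ObsHom X Unit) (p : State Z) (ρ : Aff Z X) :
    ((ObsHom.J GaussHom.addHom).comp (f.tuple g)).run p ρ =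
      ((f.run p ρ).bind fun q => g.run q (ρ.comp (Aff.proj Sum.inl))).map
        (push · ((Aff.proj (Sum.inl ∘ Sum.inl)).pair
          ((Aff.proj (Sum.inl ∘ Sum.inr)).add (Aff.proj Sum.inr)))) := by
  rw [GaussHom.addHom, ObsHom.run_J_affine_comp, ObsHom.run_tuple, map_push_push]
  refine map_push_congr rfl (Aff.ext_eval fun x => ?_)
  ext (i | i)
  · simp
  · simp [Aff.eval_mk, fromCols_mulVec]

theorem ObsHom.run_sub (f g : ObsHom X Unit) (p : State Z) (ρ : Aff Z X) :
    ((ObsHom.J GaussHom.subHom).comp (f.tuple g)).run p ρ =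
      ((f.run p ρ).bind fun q => g.run q (ρ.comp (Aff.proj Sum.inl))).map
        (push · ((Aff.proj (Sum.inl ∘ Sum.inl)).pair
          ((Aff.proj (Sum.inl ∘ Sum.inr)).sub (Aff.proj Sum.inr)))) := by
  rw [GaussHom.subHom, ObsHom.run_J_affine_comp, ObsHom.run_tuple, map_push_push]
  refine map_push_congr rfl (Aff.ext_eval fun x => ?_)
  ext (i | i)
  · simp
  · simp [Aff.eval_mk, fromCols_mulVec, sub_eq_add_neg, neg_mulVec]

theorem ObsHom.run_cond (f g : ObsHom X Unit) (p : State Z) (ρ : Aff Z X) :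
    ((ObsHom.observe 0).comp ((ObsHom.J GaussHom.subHom).comp (f.tuple g))).run p ρ =
      (((f.run p ρ).bind fun q => g.run q (ρ.comp (Aff.proj Sum.inl))).bind fun r =>
        cnd r ((Aff.proj (Sum.inl ∘ Sum.inr)).sub (Aff.proj Sum.inr)) 0).map
          (push · ((Aff.proj (Sum.inl ∘ Sum.inl)).pair (Aff.const Empty.elim))) := by
  rw [ObsHom.run_comp, ObsHom.run_sub, Option.bind_map, Option.map_bind]
  refine congrArg _ (funext fun q => ?_)
  rw [Function.comp_apply, Function.comp_apply, ObsHom.run_observe, cnd_push, map_push_push,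
    map_push_push]
  refine map_push_congr (congrArg (cnd q · 0) (Aff.ext_eval fun x => ?_))
    (Aff.ext_eval fun x => ?_)
  · simp
  · ext (i | i)
    · simp
    · exact i.elim

theorem ObsHom.run_smul (α : ℝ) (f : ObsHom X Unit) (p : State Z) (ρ : Aff Z X) :
    ((ObsHom.J (GaussHom.smulHom α)).comp f).run p ρ =
      (f.run p ρ).map (push · ((Aff.proj Sum.inl).pair ((Aff.proj Sum.inr).smul α))) := by
  rw [GaussHom.smulHom, ObsHom.run_J_affine_comp]
  refine map_push_congr rfl (Aff.ext_eval fun x => ?_)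
  ext (i | i)
  · simp
  · simp [Aff.eval_mk, smul_mulVec]

theorem ObsHom.run_const (β : ℝ) (p : State Z) (ρ : Aff Z X) :
    (ObsHom.J ((GaussHom.constHom β).comp (GaussHom.del X))).run p ρ =
      some (push p ((Aff.id Z).pair (Aff.const fun _ => β))) := by
  have e : (GaussHom.constHom β).comp (GaussHom.del X) = GaussHom.affine 0 (fun _ => β) := by
    ext <;> simp [GaussHom.comp, GaussHom.constHom, GaussHom.point, GaussHom.affine, GaussHom.del,
      GaussHom.reindex]
  rw [e, ObsHom.run_J_affine]
  refine congrArg some (congrArg _ (Aff.ext_eval fun x => ?_))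
  ext (i | i)
  · simp
  · simp [Aff.eval, Aff.comp, Aff.pair, Aff.const]

theorem ObsHom.run_normal (p : State Z) (ρ : Aff Z X) :
    (ObsHom.J (GaussHom.stdNormal.comp (GaussHom.del X))).run p ρ = some (noise p Unit) := by
  have h : Realizes (GaussHom.stdNormal.comp (GaussHom.del X))
      (Aff.proj Sum.inr : Aff (X ⊕ Unit) Unit) := by
    refine ⟨?_, ?_, ?_⟩
    · ext i j; simp [GaussHom.comp, GaussHom.stdNormal, Aff.proj]
    · simp [GaussHom.comp, GaussHom.stdNormal, Aff.proj]
    · ext i j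
      simp [GaussHom.comp, GaussHom.stdNormal, Aff.proj, Matrix.mul_apply]
  rw [ObsHom.run_J h]
  refine congrArg some ?_
  conv_rhs => rw [← push_id (noise p Unit)]
  refine congrArg _ (Aff.ext_eval fun x => ?_)
  ext (i | i) <;> simp

theorem ObsHom.run_star (p : State Z) (ρ : Aff Z X) :
    (ObsHom.J (GaussHom.del X)).run p ρ =
      some (push p ((Aff.id Z).pair (Aff.const Empty.elim))) := by
  rw [GaussHom.del, ObsHom.run_J_reindex]
  refine congrArg some (congrArg _ (Aff.ext_eval fun x => ?_))
  ext (i | i)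
  · simp
  · exact i.elim

theorem ObsHom.run_comp_tuple_id (f : ObsHom X Y) (g : ObsHom (Y ⊕ X) W) (p : State Z)
    (ρ : Aff Z X) : (g.comp (f.tuple (ObsHom.id X))).run p ρ =
      ((f.run p ρ).bind fun q => g.run q ((Aff.proj Sum.inr).pair (ρ.comp (Aff.proj Sum.inl)))).map
        (push · (Aff.proj (Sum.elim (Sum.inl ∘ Sum.inl) Sum.inr))) := by
  rw [ObsHom.run_comp, ObsHom.run_tuple]
  cases f.run p ρ with
  | none => rfl
  | some q =>
  rw [Option.bind_some, ObsHom.run_id, Option.map_some, Option.bind_some, Option.bind_some,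
    push_push, ObsHom.run_push, map_push_push]
  refine map_push_congr (congrArg _ (Aff.ext_eval fun x => ?_)) (Aff.ext_eval fun x => ?_)
  · ext (i | i) <;> simp
  · ext (i | i) <;> simp

theorem ObsHom.run_comp_reindex_comp {V : Type} [Fintype V] [DecidableEq V] (f : ObsHom X Y)
    (σ : V → Y) (g : ObsHom V W) (p : State Z) (ρ : Aff Z X) :
    (g.comp ((ObsHom.J (GaussHom.reindex σ)).comp f)).run p ρ =
      ((f.run p ρ).bind fun q => g.run q (Aff.proj (Sum.inr ∘ σ))).map
        (push · (Aff.proj (Sum.elim (Sum.inl ∘ Sum.inl) Sum.inr))) := by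
  rw [ObsHom.run_comp, ObsHom.run_comp]
  cases f.run p ρ with
  | none => rfl
  | some q =>
  rw [Option.bind_some, ObsHom.run_J_reindex, Option.map_some, Option.bind_some, Option.bind_some,
    push_push, ObsHom.run_push, map_push_push]
  refine map_push_congr (congrArg _ (Aff.ext_eval fun x => ?_)) (Aff.ext_eval fun x => ?_)
  · ext i; simp
  · ext (i | i) <;> simp

theorem ObsHom.run_letPair {Y' : Type} [Fintype Y'] [DecidableEq Y'] (f : ObsHom X (Y ⊕ Y'))
    (g : ObsHom (Y' ⊕ (Y ⊕ X)) W) (p : State Z) (ρ : Aff Z X) :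
    (g.comp ((ObsHom.J (GaussHom.reindex (Sum.elim (fun j => Sum.inl (Sum.inr j))
          (Sum.elim (fun i => Sum.inl (Sum.inl i)) (fun k => Sum.inr k))))).comp
      (f.tuple (ObsHom.id X)))).run p ρ =
      ((f.run p ρ).bind fun q => g.run q ((Aff.proj (Sum.inr ∘ Sum.inr)).pair
        ((Aff.proj (Sum.inr ∘ Sum.inl)).pair (ρ.comp (Aff.proj Sum.inl))))).map
        (push · (Aff.proj (Sum.elim (Sum.inl ∘ Sum.inl) Sum.inr))) := by
  rw [ObsHom.run_comp_reindex_comp, ObsHom.run_tuple]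
  cases f.run p ρ with
  | none => rfl
  | some q =>
  rw [Option.bind_some, ObsHom.run_id, Option.map_some, Option.bind_some, Option.bind_some,
    push_push, ObsHom.run_push, map_push_push]
  refine map_push_congr (congrArg _ (Aff.ext_eval fun x => ?_)) (Aff.ext_eval fun x => ?_)
  · ext (i | (i | i)) <;> simp
  · ext (i | i) <;> simp

end runops

/-- The environment `ρ` extended by a value for the most recently bound variable. -/
def Aff.cons {Z : Type} {Γ : Cxt} {σ : Ty} (f : Aff Z σ.Idx) (ρ : Aff Z (CIdx Γ)) :
    Aff Z (CIdx (σ :: Γ)) := f.pair ρ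

/-- The coordinates of the components of a pair. -/
def Ty.fst {σ τ : Ty} (i : σ.Idx) : (Ty.prod σ τ).Idx := Sum.inl i
def Ty.snd {σ τ : Ty} (i : τ.Idx) : (Ty.prod σ τ).Idx := Sum.inr i

/-- The pair of two points. -/
def Ty.mkPair {σ τ : Ty} (x : σ.Idx → ℝ) (y : τ.Idx → ℝ) : (Ty.prod σ τ).Idx → ℝ := Sum.elim x y

@[simp] theorem Ty.mkPair_comp_fst {σ τ : Ty} (x : σ.Idx → ℝ) (y : τ.Idx → ℝ) :
    Ty.mkPair x y ∘ Ty.fst = x := rfl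

@[simp] theorem Ty.mkPair_comp_snd {σ τ : Ty} (x : σ.Idx → ℝ) (y : τ.Idx → ℝ) :
    Ty.mkPair x y ∘ Ty.snd = y := rfl

/-- The pair of two affine maps whose values are the components of a pair. -/
def Aff.mkPair {Z : Type} {σ τ : Ty} (f : Aff Z σ.Idx) (g : Aff Z τ.Idx) :
    Aff Z (Ty.prod σ τ).Idx := f.pair g

@[simp] theorem Aff.eval_mkPair {Z : Type} [Fintype Z] {σ τ : Ty} (f : Aff Z σ.Idx)
    (g : Aff Z τ.Idx) (x : Z → ℝ) : (f.mkPair g).eval x = Ty.mkPair (f.eval x) (g.eval x) :=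
  Aff.eval_pair f g x

/-- The joint law of `z ∼ p` and of the value of `e` in the environment `ρ z`, conditioned on the
observations made by `e`. -/
def Tm.run : {Γ : Cxt} → {τ : Ty} → Tm Γ τ → {Z : Type} → [Fintype Z] → [DecidableEq Z] →
    State Z → Aff Z (CIdx Γ) → Option (State (Z ⊕ τ.Idx))
  | _, _, .var x, Z, _, _, p, ρ => some (push p ((Aff.id Z).pair (ρ.sel x.coord)))
  | _, _, .add s t, _, _, _, p, ρ =>
    ((s.run p ρ).bind fun q => t.run q (ρ.comp (Aff.proj Sum.inl))).map
      (push · ((Aff.proj (Sum.inl ∘ Sum.inl)).pair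
        ((Aff.proj (Sum.inl ∘ Sum.inr)).add (Aff.proj Sum.inr))))
  | _, _, .smul α t, _, _, _, p, ρ =>
    (t.run p ρ).map (push · ((Aff.proj Sum.inl).pair ((Aff.proj Sum.inr).smul α)))
  | _, _, .const β, Z, _, _, p, _ => some (push p ((Aff.id Z).pair (Aff.const fun _ => β)))
  | _, _, .pair s t, _, _, _, p, ρ =>
    ((s.run p ρ).bind fun q => t.run q (ρ.comp (Aff.proj Sum.inl))).map
      (push · ((Aff.proj (Sum.inl ∘ Sum.inl)).pair
        ((Aff.proj (Sum.inl ∘ Sum.inr)).mkPair (Aff.proj Sum.inr))))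
  | _, _, .star, Z, _, _, p, _ => some (push p ((Aff.id Z).pair (Aff.const Empty.elim)))
  | _, _, .letIn s t, _, _, _, p, ρ =>
    ((s.run p ρ).bind fun q => t.run q ((Aff.proj Sum.inr).cons (ρ.comp (Aff.proj Sum.inl)))).map
      (push · (Aff.proj (Sum.elim (Sum.inl ∘ Sum.inl) Sum.inr)))
  | _, _, .letPair s t, _, _, _, p, ρ =>
    ((s.run p ρ).bind fun q => t.run q ((Aff.proj (Sum.inr ∘ Ty.snd)).cons
        ((Aff.proj (Sum.inr ∘ Ty.fst)).cons (ρ.comp (Aff.proj Sum.inl))))).map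
      (push · (Aff.proj (Sum.elim (Sum.inl ∘ Sum.inl) Sum.inr)))
  | _, _, .normal, _, _, _, p, _ => some (noise p Ty.rv.Idx)
  | _, _, .cond s t, _, _, _, p, ρ =>
    (((s.run p ρ).bind fun q => t.run q (ρ.comp (Aff.proj Sum.inl))).bind fun r =>
      cnd r ((Aff.proj (Sum.inl ∘ Sum.inr)).sub (Aff.proj Sum.inr)) 0).map
        (push · ((Aff.proj (Sum.inl ∘ Sum.inl)).pair (Aff.const Empty.elim)))

theorem Tm.run_interp {Γ : Cxt} {τ : Ty} (e : Tm Γ τ) {Z : Type} [Fintype Z] [DecidableEq Z]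
    (p : State Z) (ρ : Aff Z (CIdx Γ)) : e.interp.run p ρ = e.run p ρ := by
  induction e generalizing Z with
  | var x => exact ObsHom.run_J_reindex _ _ _
  | add s t ihs iht =>
    rw [Tm.run]
    simp only [← ihs, ← iht]
    exact ObsHom.run_add s.interp t.interp p ρ
  | smul α t ih =>
    rw [Tm.run, ← ih]
    exact ObsHom.run_smul α t.interp p ρ
  | const β => exact ObsHom.run_const β p ρ
  | pair s t ihs iht =>
    rw [Tm.run]
    simp only [← ihs, ← iht]
    refine (ObsHom.run_tuple s.interp t.interp p ρ).trans ?_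
    exact map_push_congr rfl Aff.proj_assoc
  | star => exact ObsHom.run_star p ρ
  | letIn s t ihs iht =>
    rw [Tm.run]
    simp only [← ihs, ← iht]
    exact ObsHom.run_comp_tuple_id s.interp t.interp p ρ
  | letPair s t ihs iht =>
    rw [Tm.run]
    rw [← ihs]
    refine (ObsHom.run_letPair s.interp t.interp p ρ).trans ?_
    exact congrArg _ (congrArg _ (funext fun q => iht _ _))
  | normal => exact ObsHom.run_normal p ρ
  | cond s t ihs iht =>
    rw [Tm.run]
    simp only [← ihs, ← iht]
    exact ObsHom.run_cond s.interp t.interp p ρ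

theorem Tm.run_push {Γ : Cxt} {τ : Ty} (e : Tm Γ τ) {W Z : Type} [Fintype W] [DecidableEq W]
    [Fintype Z] [DecidableEq Z] (p : State W) (g : Aff W Z) (ρ : Aff Z (CIdx Γ)) :
    e.run (push p g) ρ = (e.run p (ρ.comp g)).map (push · (g.par (Aff.id τ.Idx))) := by
  rw [← e.run_interp, ← e.run_interp, ObsHom.run_push]

/-- The quotient is eliminated here: all later arguments concern `Tm.run` only. -/
theorem denote_eq_iff {Γ : Cxt} {τ : Ty} (e₁ e₂ : Tm Γ τ) :
    e₁.denote = e₂.denote ↔ ∀ (Z : Type) [Fintype Z] [DecidableEq Z] (p : State Z)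
      (ρ : Aff Z (CIdx Γ)), e₁.run p ρ = e₂.run p ρ := by
  refine (Quotient.eq (r := ObsHom.condSetoid _ _)).trans
    ((ObsHom.equivalent_iff e₁.interp e₂.interp).trans ?_)
  simp only [Tm.run_interp]

/-! ## Renaming, substitution and values -/

section subst

variable {W X Y Z N : Type} [Fintype W] [Fintype X] [Fintype Y] [Fintype Z] [Fintype N]
  [DecidableEq W] [DecidableEq X] [DecidableEq Y] [DecidableEq Z] [DecidableEq N]

theorem Aff.pair_comp (f : Aff Y X) (g : Aff Y Z) (h : Aff W Y) :
    (f.pair g).comp h = (f.comp h).pair (g.comp h) := Aff.ext_eval fun x => by simp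

theorem Aff.cons_comp {Γ : Cxt} {σ : Ty} (f : Aff Z σ.Idx) (ρ : Aff Z (CIdx Γ)) (g : Aff W Z) :
    (f.cons ρ).comp g = (f.comp g).cons (ρ.comp g) := Aff.pair_comp _ _ _

theorem Aff.cons_sel_zero {Γ : Cxt} {σ : Ty} (f : Aff Z σ.Idx) (ρ : Aff Z (CIdx Γ)) :
    (f.cons ρ).sel (Var.zero : Var (σ :: Γ) σ).coord = f := rfl

theorem Aff.cons_sel_succ {Γ : Cxt} {σ τ : Ty} (f : Aff Z σ.Idx) (ρ : Aff Z (CIdx Γ))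
    (x : Var Γ τ) : (f.cons ρ).sel (Var.succ x).coord = ρ.sel x.coord := rfl

theorem Ren.comp_sel {Γ Δ : Cxt} {r : Ren Γ Δ} {ρ : Aff Z (CIdx Δ)} {ρ' : Aff Z (CIdx Γ)}
    (g : Aff W Z) (h : ∀ σ (x : Var Γ σ), ρ.sel (r σ x).coord = ρ'.sel x.coord) :
    ∀ σ (x : Var Γ σ), (ρ.comp g).sel (r σ x).coord = (ρ'.comp g).sel x.coord := by
  intro σ x
  rw [← Aff.sel_comp, ← Aff.sel_comp, h]

theorem Ren.lift_sel {Γ Δ : Cxt} {υ : Ty} {r : Ren Γ Δ} {ρ : Aff Z (CIdx Δ)} {ρ' : Aff Z (CIdx Γ)}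
    (f : Aff Z υ.Idx) (h : ∀ σ (x : Var Γ σ), ρ.sel (r σ x).coord = ρ'.sel x.coord) :
    ∀ σ (x : Var (υ :: Γ) σ), (f.cons ρ).sel ((r.lift υ) σ x).coord = (f.cons ρ').sel x.coord := by
  intro σ x
  cases x with
  | zero => rfl
  | succ x => exact h σ x

theorem Tm.run_rename {Γ Δ : Cxt} {τ : Ty} (e : Tm Γ τ) (r : Ren Γ Δ) {Z : Type} [Fintype Z]
    [DecidableEq Z] (p : State Z) (ρ : Aff Z (CIdx Δ)) (ρ' : Aff Z (CIdx Γ))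
    (h : ∀ σ (x : Var Γ σ), ρ.sel (r σ x).coord = ρ'.sel x.coord) :
    (e.rename r).run p ρ = e.run p ρ' := by
  induction e generalizing Δ Z with
  | var x => rw [Tm.rename, Tm.run, Tm.run, h]
  | add s t ihs iht =>
    rw [Tm.rename, Tm.run, Tm.run, ihs r p ρ ρ' h]
    simp only [iht r _ _ _ (Ren.comp_sel _ h)]
  | smul α t ih => rw [Tm.rename, Tm.run, Tm.run, ih r p ρ ρ' h]
  | const β => rfl
  | pair s t ihs iht =>
    rw [Tm.rename, Tm.run, Tm.run, ihs r p ρ ρ' h]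
    simp only [iht r _ _ _ (Ren.comp_sel _ h)]
  | star => rfl
  | letIn s t ihs iht =>
    rw [Tm.rename, Tm.run, Tm.run, ihs r p ρ ρ' h]
    simp only [iht (r.lift _) _ _ _ (Ren.lift_sel _ (Ren.comp_sel _ h))]
  | letPair s t ihs iht =>
    rw [Tm.rename, Tm.run, Tm.run, ihs r p ρ ρ' h]
    simp only [iht ((r.lift _).lift _) _ _ _ (Ren.lift_sel _ (Ren.lift_sel _ (Ren.comp_sel _ h)))]
  | normal => rfl
  | cond s t ihs iht =>
    rw [Tm.rename, Tm.run, Tm.run, ihs r p ρ ρ' h]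
    simp only [iht r _ _ _ (Ren.comp_sel _ h)]

theorem Tm.run_rename_weaken {Γ : Cxt} {σ τ : Ty} (e : Tm Γ τ) (p : State Z) (f : Aff Z σ.Idx)
    (ρ : Aff Z (CIdx Γ)) : (e.rename (Ren.weaken Γ σ)).run p (f.cons ρ) = e.run p ρ :=
  e.run_rename _ _ _ _ fun _ _ => rfl

/-- The terms of `θ` evaluate in the environment `ρ` to the values given by `ρ'`. -/
def Sub.Evals {Γ Δ : Cxt} (θ : Sub Γ Δ) (ρ : Aff Z (CIdx Δ)) (ρ' : Aff Z (CIdx Γ)) : Prop :=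
  ∀ (σ : Ty) (x : Var Γ σ) (W : Type) [Fintype W] [DecidableEq W] (p : State W) (g : Aff W Z),
    (θ σ x).run p (ρ.comp g) = some (push p ((Aff.id W).pair ((ρ'.sel x.coord).comp g)))

/-- Evaluating a subterm enlarges the sample space, so the induction for substitution requires
stability under precomposition; the quantifier over `g` in `Sub.Evals` is there to supply it. -/
theorem Sub.Evals.comp {Γ Δ : Cxt} {θ : Sub Γ Δ} {ρ : Aff Z (CIdx Δ)} {ρ' : Aff Z (CIdx Γ)}
    (h : θ.Evals ρ ρ') (g : Aff W Z) : θ.Evals (ρ.comp g) (ρ'.comp g) := by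
  intro σ x V _ _ p k
  rw [Aff.comp_assoc, h, ← Aff.sel_comp, Aff.comp_assoc]

theorem Sub.Evals.lift {Γ Δ : Cxt} {θ : Sub Γ Δ} {ρ : Aff Z (CIdx Δ)} {ρ' : Aff Z (CIdx Γ)}
    (h : θ.Evals ρ ρ') {υ : Ty} (f : Aff Z υ.Idx) : (θ.lift υ).Evals (f.cons ρ) (f.cons ρ') := by
  intro σ x V _ _ p k
  cases x with
  | zero => rw [Sub.lift, Tm.run, ← Aff.sel_comp]; rfl
  | succ x =>
    rw [Sub.lift, Aff.cons_comp, Tm.run_rename_weaken, h, Aff.cons_sel_succ]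

/-- Under `Sub.Evals` the substituted terms are deterministic affine functions of the environment,
without noise or observations. They may thus be duplicated, discarded or moved under binders freely.
-/
theorem Tm.run_subst {Γ Δ : Cxt} {τ : Ty} (e : Tm Γ τ) (θ : Sub Γ Δ) {Z : Type} [Fintype Z]
    [DecidableEq Z] (p : State Z) (ρ : Aff Z (CIdx Δ)) (ρ' : Aff Z (CIdx Γ))
    (h : θ.Evals ρ ρ') : (e.subst θ).run p ρ = e.run p ρ' := by
  induction e generalizing Δ Z with
  | var x =>
    have := h _ x Z p (Aff.id Z)
    rw [Aff.comp_id, Aff.comp_id] at this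
    exact this
  | add s t ihs iht =>
    rw [Tm.subst, Tm.run, Tm.run, ihs θ p ρ ρ' h]
    simp only [iht θ _ _ _ (h.comp _)]
  | smul α t ih => rw [Tm.subst, Tm.run, Tm.run, ih θ p ρ ρ' h]
  | const β => rfl
  | pair s t ihs iht =>
    rw [Tm.subst, Tm.run, Tm.run, ihs θ p ρ ρ' h]
    simp only [iht θ _ _ _ (h.comp _)]
  | star => rfl
  | letIn s t ihs iht =>
    rw [Tm.subst, Tm.run, Tm.run, ihs θ p ρ ρ' h]
    simp only [iht (θ.lift _) _ _ _ ((h.comp _).lift _)]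
  | letPair s t ihs iht =>
    rw [Tm.subst, Tm.run, Tm.run, ihs θ p ρ ρ' h]
    simp only [iht ((θ.lift _).lift _) _ _ _ (((h.comp _).lift _).lift _)]
  | normal => rfl
  | cond s t ihs iht =>
    rw [Tm.subst, Tm.run, Tm.run, ihs θ p ρ ρ' h]
    simp only [iht θ _ _ _ (h.comp _)]

@[simp] theorem Ty.mkPair_fst {σ τ : Ty} (x : σ.Idx → ℝ) (y : τ.Idx → ℝ) (i : σ.Idx) :
    Ty.mkPair x y (Ty.fst i) = x i := rfl

@[simp] theorem Ty.mkPair_snd {σ τ : Ty} (x : σ.Idx → ℝ) (y : τ.Idx → ℝ) (i : τ.Idx) :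
    Ty.mkPair x y (Ty.snd i) = y i := rfl

/-- The affine map defined by a value. -/
def Val.aff {Γ : Cxt} {τ : Ty} (v : Val Γ τ) : Aff (CIdx Γ) τ.Idx := ⟨v.lin, v.off⟩

theorem Val.aff_var {Γ : Cxt} {τ : Ty} (x : Var Γ τ) : (Val.var x).aff = Aff.proj x.coord := rfl

theorem Val.aff_pair {Γ : Cxt} {σ τ : Ty} (v : Val Γ σ) (w : Val Γ τ) :
    (Val.pair v w).aff = v.aff.mkPair w.aff := rfl

theorem Val.aff_add {Γ : Cxt} (v w : Val Γ .rv) : (Val.add v w).aff = v.aff.add w.aff := rfl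

theorem Val.aff_smul {Γ : Cxt} (α : ℝ) (v : Val Γ .rv) : (Val.smul α v).aff = v.aff.smul α := rfl

theorem Val.aff_const {Γ : Cxt} (β : ℝ) : (Val.const β : Val Γ .rv).aff = Aff.const fun _ => β :=
  rfl

theorem Val.run_toTm {Γ : Cxt} {τ : Ty} (v : Val Γ τ) {Z : Type} [Fintype Z] [DecidableEq Z]
    (p : State Z) (ρ : Aff Z (CIdx Γ)) :
    v.toTm.run p ρ = some (push p ((Aff.id Z).pair (v.aff.comp ρ))) := by
  induction v generalizing Z with
  | var x => rw [Val.toTm, Tm.run, Val.aff_var, Aff.proj_comp]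
  | pair v w ihv ihw =>
    rw [Val.toTm, Tm.run, ihv, Option.bind_some, ihw, Option.map_some, push_push, push_push]
    refine congrArg some (congrArg _ (Aff.ext_eval fun x => ?_))
    rw [Val.aff_pair]
    ext (i | i)
    · simp
    · simp
      rfl
  | add v w ihv ihw =>
    rw [Val.toTm, Tm.run, ihv, Option.bind_some, ihw, Option.map_some, push_push, push_push]
    refine congrArg some (congrArg _ (Aff.ext_eval fun x => ?_))
    rw [Val.aff_add]
    ext (i | i) <;> simp
  | smul α v ih =>
    rw [Val.toTm, Tm.run, ih, Option.map_some, push_push]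
    refine congrArg some (congrArg _ (Aff.ext_eval fun x => ?_))
    rw [Val.aff_smul]
    ext (i | i) <;> simp
  | const β =>
    rw [Val.toTm, Tm.run, Val.aff_const]
    refine congrArg some (congrArg _ (Aff.ext_eval fun x => ?_))
    simp
  | star =>
    rw [Val.toTm, Tm.run]
    refine congrArg some (congrArg _ (Aff.ext_eval fun x => ?_))
    ext (i | i)
    · simp
    · exact Empty.elim i

theorem Val.run_rename_toTm {Γ Δ : Cxt} {τ : Ty} (v : Val Γ τ) (r : Ren Γ Δ) :
    (v.rename r).toTm = v.toTm.rename r := by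
  induction v <;> simp_all [Val.rename, Val.toTm, Tm.rename]

theorem Sub.id_evals {Γ : Cxt} (ρ : Aff Z (CIdx Γ)) : (Sub.id Γ).Evals ρ ρ := by
  intro σ x W _ _ p g
  rw [Sub.id, Tm.run, Aff.sel_comp]

theorem Sub.Evals.cons {Γ Δ : Cxt} {θ : Sub Γ Δ} {ρ : Aff Z (CIdx Δ)} {ρ' : Aff Z (CIdx Γ)}
    (h : θ.Evals ρ ρ') {σ : Ty} (v : Val Δ σ) :
    (Sub.cons v.toTm θ).Evals ρ ((v.aff.comp ρ).cons ρ') := by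
  intro τ x W _ _ p g
  cases x with
  | zero => rw [Sub.cons, Val.run_toTm, Aff.cons_sel_zero, Aff.comp_assoc]
  | succ x => exact h τ x W p g

theorem Tm.run_letIn_val {Γ : Cxt} {σ τ : Ty} (v : Val Γ σ) (e : Tm (σ :: Γ) τ) (p : State Z)
    (ρ : Aff Z (CIdx Γ)) : (Tm.letIn v.toTm e).run p ρ = e.run p ((v.aff.comp ρ).cons ρ) := by
  rw [Tm.run, Val.run_toTm, Option.bind_some, Tm.run_push, map_push_push, Aff.cons_comp,
    Aff.comp_assoc]
  have e1 : (Aff.proj Sum.inr).comp ((Aff.id Z).pair (v.aff.comp ρ)) = v.aff.comp ρ :=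
    Aff.ext_eval fun x => by ext i; simp
  have e2 : (Aff.proj Sum.inl).comp ((Aff.id Z).pair (v.aff.comp ρ)) = Aff.id Z :=
    Aff.ext_eval fun x => by ext i; simp
  rw [e1, e2, Aff.comp_id]
  cases e.run p ((v.aff.comp ρ).cons ρ) with
  | none => rfl
  | some q =>
  rw [Option.map_some]
  conv_rhs => rw [← push_id q]
  refine congrArg some (congrArg _ (Aff.ext_eval fun x => ?_))
  ext (i | i) <;> simp

theorem Tm.run_letPair_val {Γ : Cxt} {σ σ' τ : Ty} (v : Val Γ σ) (w : Val Γ σ')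
    (e : Tm (σ' :: σ :: Γ) τ) (p : State Z) (ρ : Aff Z (CIdx Γ)) :
    (Tm.letPair (.pair v.toTm w.toTm) e).run p ρ =
      e.run p ((w.aff.comp ρ).cons ((v.aff.comp ρ).cons ρ)) := by
  have h := Val.run_toTm (Val.pair v w) p ρ
  rw [Val.toTm, Val.aff_pair] at h
  rw [Tm.run, h, Option.bind_some, Tm.run_push, map_push_push, Aff.cons_comp,
    Aff.cons_comp, Aff.comp_assoc]
  have e1 : (Aff.proj (Sum.inr ∘ Ty.snd)).comp ((Aff.id Z).pair
      ((v.aff.mkPair w.aff).comp ρ)) = w.aff.comp ρ :=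
    Aff.ext_eval fun x => by ext i; simp
  have e3 : (Aff.proj (Sum.inr ∘ Ty.fst)).comp ((Aff.id Z).pair
      ((v.aff.mkPair w.aff).comp ρ)) = v.aff.comp ρ :=
    Aff.ext_eval fun x => by ext i; simp
  have e2 : (Aff.proj Sum.inl).comp ((Aff.id Z).pair
      ((v.aff.mkPair w.aff).comp ρ)) = Aff.id Z :=
    Aff.ext_eval fun x => by ext i; simp
  rw [e1, e2, e3, Aff.comp_id]
  cases e.run p ((w.aff.comp ρ).cons ((v.aff.comp ρ).cons ρ)) with
  | none => rfl
  | some q =>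
  rw [Option.map_some]
  conv_rhs => rw [← push_id q]
  refine congrArg some (congrArg _ (Aff.ext_eval fun x => ?_))
  ext (i | i) <;> simp

end subst

/-! ## Reduction preserves the denotation -/

section reduction

variable {W X Y Z N : Type} [Fintype W] [Fintype X] [Fintype Y] [Fintype Z] [Fintype N]
  [DecidableEq W] [DecidableEq X] [DecidableEq Y] [DecidableEq Z] [DecidableEq N]

/-- A value only adds a coordinate that is a function of `z`. Skipping its evaluation and inserting
that coordinate afterwards gives the same joint law. -/
theorem Val.run_bind {Γ Δ : Cxt} {σ τ : Ty} (v : Val Γ σ) (t : Tm Δ τ) (p : State Z)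
    (ρ : Aff Z (CIdx Γ)) (ρ' : Aff Z (CIdx Δ)) :
    ((v.toTm.run p ρ).bind fun q => t.run q (ρ'.comp (Aff.proj Sum.inl))) =
      (t.run p ρ').map (push · (((Aff.id Z).pair (v.aff.comp ρ)).par (Aff.id τ.Idx))) := by
  rw [Val.run_toTm, Option.bind_some, Tm.run_push, Aff.comp_assoc]
  rw [show (Aff.proj Sum.inl).comp ((Aff.id Z).pair (v.aff.comp ρ)) = Aff.id Z from
    Aff.ext_eval fun x => by ext i; simp, Aff.comp_id]

/-- In a reduction context only values are evaluated before the hole, and these have no effect. An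
effect `o` on the law of the latent variables can thus be pulled in front of the whole term. It is
`some ψ` for pure steps and a conditioning for observations. -/
theorem RCxt.run_plug_bind {Γ : Cxt} {τ τ' : Ty} (C : RCxt Γ τ τ') {e e' : Tm Γ τ} {p : State Z}
    {ρ : Aff Z (CIdx Γ)} {o : Option (State Z)} (h : e.run p ρ = o.bind fun q => e'.run q ρ) :
    (C.plug e).run p ρ = o.bind fun q => (C.plug e').run q ρ := by
  induction C with
  | hole => exact h
  | addL C t ih => rw [plug, Tm.run, ih]; cases o <;> rfl
  | addR v C ih =>
    simp only [plug, Tm.run, Val.run_bind, ih]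
    cases o <;> rfl
  | smul α C ih => rw [plug, Tm.run, ih]; cases o <;> rfl
  | pairL C t ih => rw [plug, Tm.run, ih]; cases o <;> rfl
  | pairR v C ih =>
    simp only [plug, Tm.run, Val.run_bind, ih]
    cases o <;> rfl
  | condL C t ih => rw [plug, Tm.run, ih]; cases o <;> rfl
  | condR v C ih =>
    simp only [plug, Tm.run, Val.run_bind, ih]
    cases o <;> rfl
  | letIn C t ih => rw [plug, Tm.run, ih]; cases o <;> rfl
  | letPair C t ih => rw [plug, Tm.run, ih]; cases o <;> rfl

theorem Tm.run_rename_push {Γ Δ : Cxt} {τ : Ty} (t : Tm Γ τ) (r : Ren Γ Δ) {g : Aff W Z}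
    {ρ : Aff Z (CIdx Γ)} {ρ' : Aff W (CIdx Δ)}
    (hρ : ∀ σ (x : Var Γ σ), ρ'.sel (r σ x).coord = (ρ.comp g).sel x.coord) (q : State (W ⊕ X)) :
    t.run (push q (g.par (Aff.id X))) (ρ.comp (Aff.proj Sum.inl)) =
      ((t.rename r).run q (ρ'.comp (Aff.proj Sum.inl))).map
        (push · ((g.par (Aff.id X)).par (Aff.id τ.Idx))) := by
  rw [Tm.run_push, t.run_rename r q _ ((ρ.comp (Aff.proj Sum.inl)).comp (g.par (Aff.id X)))]
  intro σ x
  rw [← Aff.sel_comp, hρ]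
  exact Aff.ext_eval fun x => by ext i; simp

/-- An environment extended by a value for the most recently bound variable. -/
def CIdx.cons {Γ : Cxt} {σ : Ty} (x : σ.Idx → ℝ) (y : CIdx Γ → ℝ) : CIdx (σ :: Γ) → ℝ :=
  Sum.elim x y

theorem Aff.eval_cons {Γ : Cxt} {σ : Ty} (f : Aff Z σ.Idx) (ρ : Aff Z (CIdx Γ)) (x : Z → ℝ) :
    (f.cons ρ).eval x = CIdx.cons (f.eval x) (ρ.eval x) := Aff.eval_pair f ρ x

/-- The counterpart of `RCxt.run_plug_bind` when the sample space grows: `g` forgets the new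
coordinates, and the two sides agree after forgetting. It serves the allocation of a normal
variable. -/
theorem RCxt.run_plug_rename {Γ Δ : Cxt} {τ τ' : Ty} (C : RCxt Γ τ τ') (r : Ren Γ Δ) {e : Tm Γ τ}
    {e' : Tm Δ τ} {p : State Z} {q : State W} {ρ : Aff Z (CIdx Γ)} {ρ' : Aff W (CIdx Δ)}
    {g : Aff W Z} (hρ : ∀ σ (x : Var Γ σ), ρ'.sel (r σ x).coord = (ρ.comp g).sel x.coord)
    (h : e.run p ρ = (e'.run q ρ').map (push · (g.par (Aff.id τ.Idx)))) :
    (C.plug e).run p ρ = (((C.rename r).plug e').run q ρ').map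
      (push · (g.par (Aff.id τ'.Idx))) := by
  have hv : ∀ {σ υ : Ty} (v : Val Γ σ) (t : Tm Δ υ),
      (((v.rename r).toTm.run q ρ').bind fun q => t.run q (ρ'.comp (Aff.proj Sum.inl))) =
      (t.run q ρ').map (push · (((Aff.id W).pair (v.aff.comp (ρ.comp g))).par
        (Aff.id υ.Idx))) := by
    intro σ υ v t
    rw [Val.run_rename_toTm, v.toTm.run_rename r q ρ' _ hρ, Val.run_bind]
  induction C with
  | hole => exact h
  | addL C t ih =>
    rw [plug, Tm.run, ih, rename, plug, Tm.run]
    cases ((C.rename r).plug e').run q ρ' with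
    | none => rfl
    | some q' =>
    rw [Option.map_some, Option.bind_some, Option.bind_some, t.run_rename_push r hρ,
      map_push_push, map_push_push]
    refine map_push_congr rfl (Aff.ext_eval fun x => ?_)
    ext (i | i)
    · simp
      rfl
    · simp
  | addR v C ih =>
    rw [rename]
    simp only [plug, Tm.run, Val.run_bind, ih, hv, map_push_push]
    refine map_push_congr rfl (Aff.ext_eval fun x => ?_)
    ext (i | i)
    · simp
      rfl
    · simp
  | smul α C ih =>
    rw [rename]
    simp only [plug, Tm.run, ih, map_push_push]
    refine map_push_congr rfl (Aff.ext_eval fun x => ?_)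
    ext (i | i)
    · simp
    · simp
  | pairL C t ih =>
    rw [plug, Tm.run, ih, rename, plug, Tm.run]
    cases ((C.rename r).plug e').run q ρ' with
    | none => rfl
    | some q' =>
    rw [Option.map_some, Option.bind_some, Option.bind_some, t.run_rename_push r hρ,
      map_push_push, map_push_push]
    refine map_push_congr rfl (Aff.ext_eval fun x => ?_)
    ext (i | i)
    · simp
      rfl
    · simp
      rfl
  | pairR v C ih =>
    rw [rename]
    simp only [plug, Tm.run, Val.run_bind, ih, hv, map_push_push]
    refine map_push_congr rfl (Aff.ext_eval fun x => ?_)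
    ext (i | i)
    · simp
      rfl
    · simp
      rfl
  | condL C t ih =>
    rw [plug, Tm.run, ih, rename, plug, Tm.run]
    cases ((C.rename r).plug e').run q ρ' with
    | none => rfl
    | some q' =>
    rw [Option.map_some, Option.bind_some, Option.bind_some, t.run_rename_push r hρ]
    cases (t.rename r).run q' (ρ'.comp (Aff.proj Sum.inl)) with
    | none => rfl
    | some q'' =>
    rw [Option.map_some, Option.bind_some, Option.bind_some, cnd_push, map_push_push, map_push_push]
    refine map_push_congr (congrArg (cnd _ · _) (Aff.ext_eval fun x => ?_))
      (Aff.ext_eval fun x => ?_)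
    · ext i; simp
    · ext (i | i)
      · simp
        rfl
      · exact Empty.elim i
  | condR v C ih =>
    rw [rename]
    simp only [plug, Tm.run, Val.run_bind, ih, hv, map_push_push]
    cases ((C.rename r).plug e').run q ρ' with
    | none => rfl
    | some q' =>
    rw [Option.map_some, Option.map_some, Option.bind_some, Option.bind_some, cnd_push, cnd_push]
    simp only [map_push_push]
    refine map_push_congr (congrArg (cnd _ · _) (Aff.ext_eval fun x => ?_))
      (Aff.ext_eval fun x => ?_)
    · ext i; simp
    · ext (i | i)
      · simp
        rfl
      · exact Empty.elim i
  | letIn C t ih =>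
    rw [plug, Tm.run, ih, rename, plug, Tm.run]
    cases ((C.rename r).plug e').run q ρ' with
    | none => rfl
    | some q' =>
    rw [Option.map_some, Option.bind_some, Option.bind_some, Tm.run_push, map_push_push,
      map_push_push, t.run_rename (r.lift _) q' _ _ (Ren.lift_sel _ (Ren.comp_sel _ hρ))]
    refine map_push_congr (congrArg (t.run q') (Aff.ext_eval fun x => ?_))
      (Aff.ext_eval fun x => ?_)
    · rw [Aff.cons_comp, Aff.eval_cons, Aff.eval_cons]
      simp
    · ext (i | i)
      · simp
        rfl
      · simp
  | letPair C t ih =>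
    rw [plug, Tm.run, ih, rename, plug, Tm.run]
    cases ((C.rename r).plug e').run q ρ' with
    | none => rfl
    | some q' =>
    rw [Option.map_some, Option.bind_some, Option.bind_some, Tm.run_push, map_push_push,
      map_push_push, t.run_rename ((r.lift _).lift _) q' _ _
        (Ren.lift_sel _ (Ren.lift_sel _ (Ren.comp_sel _ hρ)))]
    refine map_push_congr (congrArg (t.run q') (Aff.ext_eval fun x => ?_))
      (Aff.ext_eval fun x => ?_)
    · rw [Aff.cons_comp, Aff.cons_comp, Aff.eval_cons, Aff.eval_cons, Aff.eval_cons, Aff.eval_cons]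
      simp only [Aff.eval_comp, Aff.eval_proj, Aff.eval_par, Aff.eval_id]
      rfl
    · ext (i | i)
      · simp
        rfl
      · simp

/-! ### Conditioning in configurations -/

/-- Solvability says that the right-hand sides lie in the range of `G`, on which `G G⁺` is the
identity by `G G⁺ G = G`. Hence the pseudoinverse provides solutions of both equations of `Post`. -/
theorem conjugate_post (ψ : State X) (d : Aff X Unit)
    (h : ∃ y, (d.A * ψ.cov * d.Aᵀ) *ᵥ y = 0 - d.eval ψ.b) :
    Post ψ d 0 (conjugate (((GaussHom.id X).tuple (GaussHom.affine d.A d.b)).comp ψ) 0) := by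
  set G := d.A * ψ.cov * d.Aᵀ with hG
  have hid : (GaussHom.id X).A = 1 := by
    ext i j; simp [GaussHom.id, GaussHom.reindex, GaussHom.affine, one_apply]
  set j := ((GaussHom.id X).tuple (GaussHom.affine d.A d.b)).comp ψ with hj
  have hb : j.b = Sum.elim ψ.b (d.eval ψ.b) := by
    rw [hj, GaussHom.tuple_eq]
    simp only [GaussHom.comp, hid, fromRows_mulVec]
    ext (i | i) <;> simp [GaussHom.id, GaussHom.reindex, GaussHom.affine, Aff.eval]
  have hc : j.cov = fromBlocks ψ.cov (ψ.cov * d.Aᵀ) (d.A * ψ.cov) G := by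
    rw [hj, GaussHom.tuple_eq]
    simp only [GaussHom.comp, hid]
    rw [fromRows_mul, transpose_fromRows, fromRows_mul_fromCols]
    simp [GaussHom.id, GaussHom.reindex, GaussHom.affine, hG]
  have hp := (pinv_spec G).1
  obtain ⟨y, hy⟩ := h
  obtain ⟨N, hN⟩ := exists_gain ψ d
  refine ⟨pinv G *ᵥ (0 - d.eval ψ.b), pinv G * (d.A * ψ.cov), ?_, ?_, ?_, ?_⟩
  · rw [← hy, mulVec_mulVec, mulVec_mulVec, hp]
  · rw [← hG] at hN ⊢
    rw [← hN, ← Matrix.mul_assoc, ← Matrix.mul_assoc, hp]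
  · simp only [conjugate, hb, hc, toBlocks_fromBlocks₁₂, toBlocks_fromBlocks₂₂, Sum.elim_comp_inl,
      Sum.elim_comp_inr]
  · simp only [conjugate, hc, toBlocks_fromBlocks₁₁, toBlocks_fromBlocks₁₂, toBlocks_fromBlocks₂₁,
      toBlocks_fromBlocks₂₂, Matrix.mul_assoc]

theorem mem_support_iff (ψ : State X) (d : Aff X Unit) :
    0 ∈ ((GaussHom.affine d.A d.b).comp ψ).support ↔ ∃ q, Post ψ d 0 q := by
  rw [exists_post_iff]
  have h1 : ((GaussHom.affine d.A d.b).comp ψ).cov = d.A * ψ.cov * d.Aᵀ := push_cov ψ d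
  have h2 : ((GaussHom.affine d.A d.b).comp ψ).b = d.eval ψ.b := rfl
  rw [GaussHom.support, Set.mem_ofPred_eq, h1, h2]
  refine exists_congr fun y => ?_
  rw [zero_sub, eq_neg_iff_add_eq_zero, add_comm, eq_comm]

theorem cnd_eq_conditionEq {Γ : Cxt} {ψ : State (CIdx Γ)} {v w : Val Γ .rv}
    (h : 0 ∈ ((v.diff w).comp ψ).support) :
    cnd ψ (v.aff.sub w.aff) 0 = some (conditionEq ψ v w) := by
  rw [cnd_eq_some]
  exact conjugate_post ψ (v.aff.sub w.aff)
    ((exists_post_iff _ _ _).1 ((mem_support_iff ψ (v.aff.sub w.aff)).1 h))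

theorem cnd_eq_none_of_notMem {Γ : Cxt} {ψ : State (CIdx Γ)} {v w : Val Γ .rv}
    (h : 0 ∉ ((v.diff w).comp ψ).support) : cnd ψ (v.aff.sub w.aff) 0 = none := by
  rw [cnd_eq_none]
  exact fun hq => h ((mem_support_iff ψ (v.aff.sub w.aff)).2 hq)

theorem Tm.run_cond_val {Γ : Cxt} (v w : Val Γ .rv) (p : State Z) (ρ : Aff Z (CIdx Γ)) :
    (Tm.cond v.toTm w.toTm).run p ρ =
      (cnd p ((v.aff.sub w.aff).comp ρ) 0).bind fun q => Tm.star.run q ρ := by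
  simp only [Tm.run, Val.run_toTm, Option.bind_some, push_push, cnd_push, map_push_push]
  refine Eq.trans ?_ (Option.map_eq_bind 
    (f := (push · ((Aff.id Z).pair (Aff.const (Y := Ty.unit.Idx) Empty.elim)))))
  refine map_push_congr (congrArg (cnd _ · _) (Aff.ext_eval fun x => ?_)) (Aff.ext_eval fun x => ?_)
  · ext i; simp
  · ext (i | i)
    · simp
    · exact Empty.elim i

theorem push_noise_eq_allocate {r : ℕ} (ψ : State (CIdx (latent r))) :
    allocate ψ = push (noise ψ Ty.rv.Idx)
      ((Aff.proj Sum.inr).cons (Γ := latent r) (Aff.proj Sum.inl)) := by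
  have key : ∀ {X : Type} [Fintype X] [DecidableEq X] (ψ : State X),
      (GaussHom.stdNormal.tensor ψ).comp
        (GaussHom.reindex (X := Empty) (Sum.elim Empty.elim Empty.elim)) =
      push (noise ψ Unit) ((Aff.proj Sum.inr).pair (Aff.proj Sum.inl)) := by
    intro X _ _ ψ
    apply State.ext'
    · simp only [push_b, Aff.eval_pair, Aff.eval_proj]
      ext (i | i) <;> simp [GaussHom.comp, GaussHom.tensor, GaussHom.reindex, GaussHom.affine,
        GaussHom.stdNormal, noise]
    · ext (i | i) (j | j) <;> simp [GaussHom.comp, GaussHom.tensor, GaussHom.reindex,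
        GaussHom.affine, GaussHom.stdNormal, noise, Aff.pair, Aff.proj, Matrix.mul_apply]
  exact key ψ

end reduction

/-! ## Evaluation of configurations -/

/-- The distribution of the result of a configuration, or `none` if its observations fail. -/
def Config.out {τ : Ty} : Config τ → Option (State τ.Idx)
  | .run r e ψ => (e.run ψ (Aff.id (CIdx (latent r)))).map (push · (Aff.proj Sum.inr))
  | .fail => none

theorem Config.out_val {τ : Ty} {r : ℕ} (v : Val (latent r) τ) (ψ : State (CIdx (latent r))) :
    (Config.run r v.toTm ψ).out = some (v.pushforward ψ) := by
  rw [out, Val.run_toTm, Option.map_some, push_push]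
  refine congrArg some (congrArg (push ψ) (show _ = v.aff from Aff.ext_eval fun x => ?_))
  ext i
  simp

theorem Config.out_plug_val {r : ℕ} {σ τ : Ty} (C : RCxt (latent r) σ τ) {e e' : Tm (latent r) σ}
    {ψ : State (CIdx (latent r))} (h : e.run ψ (Aff.id _) = e'.run ψ (Aff.id _)) :
    (Config.run r (C.plug e) ψ).out = (Config.run r (C.plug e') ψ).out := by
  rw [out, C.run_plug_bind (o := some ψ) h, Option.bind_some, out]

theorem Tm.run_push_id {Γ : Cxt} {τ : Ty} {Z : Type} [Fintype Z] [DecidableEq Z] (e : Tm Γ τ)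
    (p : State Z) (ρ : Aff Z (CIdx Γ)) :
    (e.run (push p ρ) (Aff.id _)).map (push · (Aff.proj Sum.inr)) =
      (e.run p ρ).map (push · (Aff.proj Sum.inr)) := by
  rw [Tm.run_push, Aff.id_comp, map_push_push]
  refine map_push_congr rfl (Aff.ext_eval fun x => ?_)
  ext i
  simp

/-- Soundness of reduction: allocation enlarges the sample space by noise, an observation conditions
the law of the latent variables, and the `let` steps are substitution of values. -/
theorem Step.out_eq {τ : Ty} {c c' : Config τ} (h : Step c c') : c.out = c'.out := by
  cases h with
  | @normal r C ψ =>
    -- The new sample space is `ψ` with one independent normal, which the environment places in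
    -- front; `g` projects back to the old latent variables.
    have hn := C.run_plug_rename (Ren.weaken (latent r) .rv) (e := .normal) (e' := .var .zero)
      (p := ψ) (q := noise ψ Ty.rv.Idx) (ρ := Aff.id _)
      (ρ' := (Aff.proj Sum.inr).cons (Γ := latent r) (Aff.proj Sum.inl)) (g := Aff.proj Sum.inl)
      (fun σ x => by rw [Aff.id_comp]; rfl) (by
        rw [Tm.run, Tm.run, Option.map_some, push_push, Aff.cons_sel_zero]
        conv_lhs => rw [← push_id (noise ψ Ty.rv.Idx)]
        refine congrArg some (congrArg _ (Aff.ext_eval fun x => ?_))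
        ext (i | i) <;> simp)
    change Option.map (push · (Aff.proj Sum.inr)) ((C.plug .normal).run ψ (Aff.id _)) =
      Option.map (push · (Aff.proj Sum.inr)) (Tm.run (Γ := .rv :: latent r)
        ((C.rename (Ren.weaken (latent r) .rv)).plug (.var .zero)) (allocate ψ)
        (Aff.id (CIdx (.rv :: latent r))))
    rw [hn, push_noise_eq_allocate, map_push_push]
    refine (map_push_congr rfl (Aff.ext_eval fun x => ?_)).trans
      (Tm.run_push_id (Γ := .rv :: latent r) _ (noise ψ Ty.rv.Idx) _).symm
    ext i
    simp
  | @cond r C v w ψ h =>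
    rw [Config.out, C.run_plug_bind (Tm.run_cond_val v w ψ _), Aff.comp_id, cnd_eq_conditionEq h,
      Option.bind_some, Config.out]
  | @condFail r C v w ψ h =>
    rw [Config.out, C.run_plug_bind (Tm.run_cond_val v w ψ _), Aff.comp_id,
      cnd_eq_none_of_notMem h, Option.bind_none, Option.map_none, Config.out]
  | @letIn r σ τ C v e ψ =>
    refine Config.out_plug_val C ?_
    rw [Tm.run_letIn_val, e.run_subst _ ψ _ _ ((Sub.id_evals _).cons v)]
  | @letPair r σ σ' τ C v w e ψ =>
    refine Config.out_plug_val C ?_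
    rw [Tm.run_letPair_val, e.run_subst _ ψ _ _ (((Sub.id_evals _).cons v).cons w)]

theorem Config.out_eq_of_reflTransGen {τ : Ty} {c c' : Config τ}
    (h : Relation.ReflTransGen Step c c') : c.out = c'.out := by
  induction h with
  | refl => rfl
  | tail _ h ih => exact ih.trans h.out_eq

/-! ### Progress -/

/-- Terms that reduce in every reduction context. -/
inductive Redex {Γ : Cxt} : {τ : Ty} → Tm Γ τ → Prop
  | normal : Redex .normal
  | cond (v w : Val Γ .rv) : Redex (.cond v.toTm w.toTm)
  | letIn {σ τ : Ty} (v : Val Γ σ) (e : Tm (σ :: Γ) τ) : Redex (.letIn v.toTm e)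
  | letPair {σ σ' τ : Ty} (v : Val Γ σ) (w : Val Γ σ') (e : Tm (σ' :: σ :: Γ) τ) :
      Redex (.letPair (.pair v.toTm w.toTm) e)

theorem Val.eq_pair {Γ : Cxt} (hΓ : ∀ σ, Var Γ σ → σ = .rv) {σ τ : Ty} (v : Val Γ (.prod σ τ)) :
    ∃ (v₁ : Val Γ σ) (v₂ : Val Γ τ), v = .pair v₁ v₂ := by
  cases v with
  | var x => cases hΓ _ x
  | pair v₁ v₂ => exact ⟨v₁, v₂, rfl⟩

/-- The scope contains only variables of type `R`. A value of product type is then a literal pair,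
so a pair-`let` on a value is never stuck. -/
theorem Tm.val_or_redex {Γ : Cxt} {τ : Ty} (e : Tm Γ τ) (hΓ : ∀ σ, Var Γ σ → σ = .rv) :
    (∃ v : Val Γ τ, e = v.toTm) ∨
      ∃ (σ : Ty) (C : RCxt Γ σ τ) (t : Tm Γ σ), Redex t ∧ e = C.plug t := by
  induction e with
  | var x => exact Or.inl ⟨.var x, rfl⟩
  | add s t ihs iht =>
    obtain ⟨v, rfl⟩ | ⟨σ, C, u, hu, rfl⟩ := ihs hΓ
    · obtain ⟨w, rfl⟩ | ⟨σ, C, u, hu, rfl⟩ := iht hΓ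
      · exact Or.inl ⟨.add v w, rfl⟩
      · exact Or.inr ⟨σ, .addR v C, u, hu, rfl⟩
    · exact Or.inr ⟨σ, .addL C t, u, hu, rfl⟩
  | smul α t ih =>
    obtain ⟨v, rfl⟩ | ⟨σ, C, u, hu, rfl⟩ := ih hΓ
    · exact Or.inl ⟨.smul α v, rfl⟩
    · exact Or.inr ⟨σ, .smul α C, u, hu, rfl⟩
  | const β => exact Or.inl ⟨.const β, rfl⟩
  | pair s t ihs iht =>
    obtain ⟨v, rfl⟩ | ⟨σ, C, u, hu, rfl⟩ := ihs hΓ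
    · obtain ⟨w, rfl⟩ | ⟨σ, C, u, hu, rfl⟩ := iht hΓ
      · exact Or.inl ⟨.pair v w, rfl⟩
      · exact Or.inr ⟨σ, .pairR v C, u, hu, rfl⟩
    · exact Or.inr ⟨σ, .pairL C t, u, hu, rfl⟩
  | star => exact Or.inl ⟨.star, rfl⟩
  | letIn s t ihs iht =>
    obtain ⟨v, rfl⟩ | ⟨σ, C, u, hu, rfl⟩ := ihs hΓ
    · exact Or.inr ⟨_, .hole, _, .letIn v t, rfl⟩
    · exact Or.inr ⟨σ, .letIn C t, u, hu, rfl⟩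
  | letPair s t ihs iht =>
    obtain ⟨v, rfl⟩ | ⟨σ, C, u, hu, rfl⟩ := ihs hΓ
    · obtain ⟨v₁, v₂, rfl⟩ := v.eq_pair hΓ
      exact Or.inr ⟨_, .hole, _, .letPair v₁ v₂ t, rfl⟩
    · exact Or.inr ⟨σ, .letPair C t, u, hu, rfl⟩
  | normal => exact Or.inr ⟨_, .hole, _, .normal, rfl⟩
  | cond s t ihs iht =>
    obtain ⟨v, rfl⟩ | ⟨σ, C, u, hu, rfl⟩ := ihs hΓ
    · obtain ⟨w, rfl⟩ | ⟨σ, C, u, hu, rfl⟩ := iht hΓ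
      · exact Or.inr ⟨_, .hole, _, .cond v w, rfl⟩
      · exact Or.inr ⟨σ, .condR v C, u, hu, rfl⟩
    · exact Or.inr ⟨σ, .condL C t, u, hu, rfl⟩

theorem latent_eq_rv : ∀ (r : ℕ) (σ : Ty), Var (latent r) σ → σ = .rv
  | _ + 1, _, .zero => rfl
  | r + 1, σ, .succ x => latent_eq_rv r σ x

/-! ### Termination -/

/-- The number of steps that the evaluation of a term takes if no observation fails. -/
def Tm.cost : {Γ : Cxt} → {τ : Ty} → Tm Γ τ → ℕ
  | _, _, .var _ => 0
  | _, _, .add s t => s.cost + t.cost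
  | _, _, .smul _ t => t.cost
  | _, _, .const _ => 0
  | _, _, .pair s t => s.cost + t.cost
  | _, _, .star => 0
  | _, _, .letIn s t => s.cost + t.cost + 1
  | _, _, .letPair s t => s.cost + t.cost + 1
  | _, _, .normal => 1
  | _, _, .cond s t => s.cost + t.cost + 1

def RCxt.cost {Γ : Cxt} {σ : Ty} : {τ : Ty} → RCxt Γ σ τ → ℕ
  | _, .hole => 0
  | _, .addL C t => C.cost + t.cost
  | _, .addR _ C => C.cost
  | _, .smul _ C => C.cost
  | _, .pairL C t => C.cost + t.cost
  | _, .pairR _ C => C.cost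
  | _, .condL C t => C.cost + t.cost + 1
  | _, .condR _ C => C.cost + 1
  | _, .letIn C t => C.cost + t.cost + 1
  | _, .letPair C t => C.cost + t.cost + 1

theorem Tm.cost_rename {Γ Δ : Cxt} {τ : Ty} (e : Tm Γ τ) (r : Ren Γ Δ) :
    (e.rename r).cost = e.cost := by
  induction e generalizing Δ <;> simp_all [Tm.rename, Tm.cost]

theorem Sub.cost_lift {Γ Δ : Cxt} {θ : Sub Γ Δ} (h : ∀ σ (x : Var Γ σ), (θ σ x).cost = 0) (υ : Ty) :
    ∀ σ (x : Var (υ :: Γ) σ), ((θ.lift υ) σ x).cost = 0 := by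
  intro σ x
  cases x with
  | zero => rfl
  | succ x => rw [Sub.lift, Tm.cost_rename, h]

/-- Values cost nothing, so duplicating them by substitution does not raise the cost. A `let` step
therefore strictly lowers it. -/
theorem Tm.cost_subst {Γ Δ : Cxt} {τ : Ty} (e : Tm Γ τ) {θ : Sub Γ Δ}
    (h : ∀ σ (x : Var Γ σ), (θ σ x).cost = 0) : (e.subst θ).cost = e.cost := by
  induction e generalizing Δ with
  | var x => exact h _ x
  | letIn s t ihs iht => rw [subst, cost, ihs h, iht (Sub.cost_lift h _), cost]
  | letPair s t ihs iht =>
    rw [subst, cost, ihs h, iht (Sub.cost_lift (Sub.cost_lift h _) _), cost]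
  | _ => simp_all [Tm.subst, Tm.cost]

theorem Val.cost_toTm {Γ : Cxt} {τ : Ty} (v : Val Γ τ) : v.toTm.cost = 0 := by
  induction v <;> simp_all [Val.toTm, Tm.cost]

theorem RCxt.cost_plug {Γ : Cxt} {σ τ : Ty} (C : RCxt Γ σ τ) (e : Tm Γ σ) :
    (C.plug e).cost = C.cost + e.cost := by
  induction C <;> simp_all [RCxt.plug, RCxt.cost, Tm.cost, Val.cost_toTm] <;> omega

theorem RCxt.cost_rename {Γ Δ : Cxt} {σ τ : Ty} (C : RCxt Γ σ τ) (r : Ren Γ Δ) :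
    (C.rename r).cost = C.cost := by
  induction C <;> simp_all [RCxt.rename, RCxt.cost, Tm.cost_rename]

theorem Sub.cost_cons {Γ Δ : Cxt} {θ : Sub Γ Δ} (h : ∀ σ (x : Var Γ σ), (θ σ x).cost = 0) {υ : Ty}
    (v : Val Δ υ) : ∀ σ (x : Var (υ :: Γ) σ), ((Sub.cons v.toTm θ) σ x).cost = 0 := by
  intro σ x
  cases x with
  | zero => exact v.cost_toTm
  | succ x => exact h σ x

theorem Redex.exists_step {r : ℕ} {σ τ : Ty} {t : Tm (latent r) σ} (h : Redex t)
    (C : RCxt (latent r) σ τ) (ψ : State (CIdx (latent r))) :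
    Step (.run r (C.plug t) ψ) .fail ∨ ∃ (r' : ℕ) (e' : Tm (latent r') τ)
      (ψ' : State (CIdx (latent r'))), Step (.run r (C.plug t) ψ) (.run r' e' ψ') ∧
        e'.cost < (C.plug t).cost := by
  have h0 : ∀ σ (x : Var (latent r) σ), ((Sub.id (latent r)) σ x).cost = 0 := fun _ _ => rfl
  cases h with
  | normal =>
    refine Or.inr ⟨_, _, _, .normal C ψ, ?_⟩
    change ((C.rename (Ren.weaken (latent r) .rv)).plug (.var .zero)).cost < _
    rw [RCxt.cost_plug, RCxt.cost_plug, RCxt.cost_rename]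
    simp [Tm.cost]
  | cond v w =>
    by_cases h : 0 ∈ ((v.diff w).comp ψ).support
    · refine Or.inr ⟨_, _, _, .cond C v w ψ h, ?_⟩
      rw [RCxt.cost_plug, RCxt.cost_plug]
      simp [Tm.cost]
    · exact Or.inl (.condFail C v w ψ h)
  | letIn v e =>
    refine Or.inr ⟨_, _, _, .letIn C v e ψ, ?_⟩
    rw [RCxt.cost_plug, RCxt.cost_plug, e.cost_subst (Sub.cost_cons h0 v), Tm.cost, v.cost_toTm]
    omega
  | letPair v w e =>
    refine Or.inr ⟨_, _, _, .letPair C v w e ψ, ?_⟩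
    rw [RCxt.cost_plug, RCxt.cost_plug, e.cost_subst (Sub.cost_cons (Sub.cost_cons h0 v) w),
      Tm.cost, Tm.cost, v.cost_toTm, w.cost_toTm]
    omega

/-- Progress together with the decrease of `Tm.cost` along every step that does not fail. -/
theorem Config.terminates {r : ℕ} {τ : Ty} (e : Tm (latent r) τ) (ψ : State (CIdx (latent r))) :
    Fails (.run r e ψ) ∨ ∃ μ, Yields (.run r e ψ) μ := by
  induction h : e.cost using Nat.strong_induction_on generalizing r with
  | _ n ih =>
  obtain ⟨v, rfl⟩ | ⟨σ, C, t, ht, rfl⟩ := e.val_or_redex (latent_eq_rv r)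
  · exact Or.inr ⟨_, r, v, ψ, .refl, rfl⟩
  obtain hs | ⟨r', e', ψ', hs, hc⟩ := ht.exists_step C ψ
  · exact Or.inl (.single hs)
  · obtain hf | ⟨μ, s, v, χ, hy, hμ⟩ := ih _ (h ▸ hc) e' ψ' rfl
    · exact Or.inl (hf.head hs)
    · exact Or.inr ⟨μ, s, v, χ, hy.head hs, hμ⟩

/-! ### Adequacy: outcomes determine the operational behaviour -/

theorem Yields.out_eq {τ : Ty} {c : Config τ} {μ : State τ.Idx} (h : Yields c μ) :
    c.out = some μ := by
  obtain ⟨r, v, ψ, hc, rfl⟩ := h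
  rw [Config.out_eq_of_reflTransGen hc, Config.out_val]

theorem Fails.out_eq {τ : Ty} {c : Config τ} (h : Fails c) : c.out = none :=
  Config.out_eq_of_reflTransGen h

/-- Although reduction is not shown to be deterministic, its outcome is: some terminal configuration
is reached, and invariance of `Config.out` leaves no other result possible. -/
theorem yields_iff {r : ℕ} {τ : Ty} (e : Tm (latent r) τ) (ψ : State (CIdx (latent r)))
    (μ : State τ.Idx) : Yields (.run r e ψ) μ ↔ (Config.run r e ψ).out = some μ := by
  refine ⟨Yields.out_eq, fun h => ?_⟩
  obtain hf | ⟨ν, hν⟩ := Config.terminates e ψ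
  · rw [hf.out_eq] at h
    cases h
  · rw [hν.out_eq, Option.some_inj] at h
    exact h ▸ hν

theorem fails_iff {r : ℕ} {τ : Ty} (e : Tm (latent r) τ) (ψ : State (CIdx (latent r))) :
    Fails (.run r e ψ) ↔ (Config.run r e ψ).out = none := by
  refine ⟨Fails.out_eq, fun h => ?_⟩
  obtain hf | ⟨ν, hν⟩ := Config.terminates e ψ
  · exact hf
  · rw [hν.out_eq] at h
    cases h

theorem ctxEquiv_iff {Γ : Cxt} {τ : Ty} (e₁ e₂ : Tm Γ τ) : CtxEquiv e₁ e₂ ↔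
    ∀ (τ' : Ty) (K : PCxt Γ τ [] τ'),
      (Config.init (K.plug e₁)).out = (Config.init (K.plug e₂)).out := by
  have hy : ∀ {τ' : Ty} (e : Tm [] τ') μ, Yields (Config.init e) μ ↔ (Config.init e).out = some μ :=
    fun e μ => yields_iff (r := 0) e _ μ
  have hf : ∀ {τ' : Ty} (e : Tm [] τ'), Fails (Config.init e) ↔ (Config.init e).out = none :=
    fun e => fails_iff (r := 0) e _
  simp only [CtxEquiv, hy, hf]
  refine forall_congr' fun τ' => forall_congr' fun K => ⟨fun h => ?_, ?_⟩
  · exact Option.ext fun μ => ⟨(h e₁ (by simp) e₂ (by simp)).1 μ, (h e₂ (by simp) e₁ (by simp)).1 μ⟩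
  · rintro h e (rfl | rfl) e' (rfl | rfl) <;> simp [h]

/-! ## Program contexts -/

section contexts

variable {Z : Type} [Fintype Z] [DecidableEq Z]

/-- The environment seen through a renaming. -/
def Ren.pull {Δ : Cxt} (ρ : Aff Z (CIdx Δ)) : {Γ : Cxt} → Ren Γ Δ → Aff Z (CIdx Γ)
  | [], _ => Aff.const Empty.elim
  | _ :: _, r => (ρ.sel (r _ .zero).coord).cons (Ren.pull ρ fun _ x => r _ (.succ x))

theorem Ren.sel_pull {Δ : Cxt} (ρ : Aff Z (CIdx Δ)) {Γ : Cxt} (r : Ren Γ Δ) {σ : Ty}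
    (x : Var Γ σ) : ρ.sel (r σ x).coord = (r.pull ρ).sel x.coord := by
  induction x with
  | zero => rfl
  | succ x ih => exact ih fun _ y => r _ (.succ y)

/-- The run of a compound term is built from runs of its subterms, possibly on larger sample spaces
and extended environments; hence the quantification over all of these in the hypothesis. -/
theorem PCxt.run_plug_congr {Γ Δ : Cxt} {τ τ' : Ty} {e₁ e₂ : Tm Γ τ}
    (h : ∀ (Z : Type) [Fintype Z] [DecidableEq Z] (p : State Z) (ρ : Aff Z (CIdx Γ)),
      e₁.run p ρ = e₂.run p ρ) (K : PCxt Γ τ Δ τ') (p : State Z) (ρ : Aff Z (CIdx Δ)) :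
    (K.plug e₁).run p ρ = (K.plug e₂).run p ρ := by
  induction K generalizing Z with
  | hole r =>
    have hr := fun σ (x : Var Γ σ) => r.sel_pull ρ x
    rw [plug, plug, e₁.run_rename r p ρ _ hr, e₂.run_rename r p ρ _ hr, h]
  | _ => simp_all only [plug, Tm.run]

theorem Val.aff_rename_comp {Γ Δ : Cxt} {τ : Ty} (v : Val Γ τ) {r : Ren Γ Δ} {ρ : Aff Z (CIdx Δ)}
    {ρ' : Aff Z (CIdx Γ)} (h : ∀ σ (x : Var Γ σ), ρ.sel (r σ x).coord = ρ'.sel x.coord) :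
    (v.rename r).aff.comp ρ = v.aff.comp ρ' := by
  have hc : ∀ {σ : Ty} (f : Aff (CIdx Δ) σ.Idx) (f' : Aff (CIdx Γ) σ.Idx),
      f.comp ρ = f'.comp ρ' → ∀ x, f.eval (ρ.eval x) = f'.eval (ρ'.eval x) := by
    intro σ f f' hf x
    rw [← Aff.eval_comp, hf, Aff.eval_comp]
  induction v with
  | var x => rw [rename, aff_var, aff_var, Aff.proj_comp, Aff.proj_comp, h]
  | pair v w ihv ihw =>
    refine Aff.ext_eval fun x => ?_
    rw [rename, aff_pair, aff_pair]
    simp [hc _ _ ihv, hc _ _ ihw]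
  | add v w ihv ihw =>
    refine Aff.ext_eval fun x => ?_
    rw [rename, aff_add, aff_add]
    simp [hc _ _ ihv, hc _ _ ihw]
  | smul α v ih =>
    refine Aff.ext_eval fun x => ?_
    rw [rename, aff_smul, aff_smul]
    simp [hc _ _ ih]
  | const β =>
    refine Aff.ext_eval fun x => ?_
    rw [rename, aff_const, aff_const]
    simp
  | star =>
    refine Aff.ext_eval fun x => ?_
    ext i
    exact Empty.elim i

theorem Val.aff_rename_weaken {Γ : Cxt} {σ τ : Ty} (v : Val Γ τ) (x : σ.Idx → ℝ) (y : CIdx Γ → ℝ) :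
    (v.rename (Ren.weaken Γ σ)).aff.eval (CIdx.cons x y) = v.aff.eval y := by
  -- Constant environments on the one-point space `ℝ^0` turn the identity of affine maps into an
  -- identity at the given points.
  have h := v.aff_rename_comp (r := Ren.weaken Γ σ) (Z := Empty)
    (ρ := (Aff.const x).cons (Aff.const y)) (ρ' := Aff.const y) fun _ _ => rfl
  have := congrArg (Aff.eval · 0) h
  simpa [Aff.eval_cons] using this

theorem Val.exists_aff_rv_cons {Γ : Cxt}
    (h : ∀ (a : CIdx Γ → ℝ) (c : ℝ), ∃ v : Val Γ .rv, ∀ x, v.aff.eval x = fun _ => a ⬝ᵥ x + c)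
    (a : CIdx (.rv :: Γ) → ℝ) (c : ℝ) :
    ∃ v : Val (.rv :: Γ) .rv, ∀ x, v.aff.eval x = fun _ => a ⬝ᵥ x + c := by
  obtain ⟨u⟩ : Nonempty Ty.rv.Idx := ⟨()⟩
  obtain ⟨v, hv⟩ := h (fun i => a (Sum.inr i)) c
  refine ⟨.add (.smul (a (Sum.inl u)) (.var .zero)) (v.rename (Ren.weaken Γ .rv)), fun x => ?_⟩
  obtain ⟨y, z, rfl⟩ : ∃ (y : Ty.rv.Idx → ℝ) (z : CIdx Γ → ℝ), x = CIdx.cons y z :=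
    ⟨fun i => x (Sum.inl i), fun i => x (Sum.inr i), by ext (i | i) <;> rfl⟩
  rw [Val.aff_add, Aff.eval_add, Val.aff_smul, Aff.eval_smul, Val.aff_rename_weaken, hv,
    Val.aff_var, Aff.eval_proj]
  ext i
  have h : a ⬝ᵥ CIdx.cons y z = a (Sum.inl u) * y i + (fun i => a (Sum.inr i)) ⬝ᵥ z := by
    let : Unique Ty.rv.Idx := inferInstanceAs (Unique Unit)
    refine (Fintype.sum_sum_type _).trans ?_
    exact congrArg (· + _) (Fintype.sum_unique _)
  rw [h, add_assoc]
  rfl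

theorem Val.exists_aff_rv : ∀ (r : ℕ) (a : CIdx (latent r) → ℝ) (c : ℝ),
    ∃ v : Val (latent r) .rv, ∀ x, v.aff.eval x = fun _ => a ⬝ᵥ x + c
  | 0, a, c => ⟨.const c, fun x => by
      rw [Val.aff_const, Aff.eval_const]
      have : a ⬝ᵥ x = 0 := Finset.sum_eq_zero fun i _ => Empty.elim i
      rw [this, zero_add]⟩
  | r + 1, a, c => Val.exists_aff_rv_cons (Val.exists_aff_rv r) a c

/-- Definability: variables, sums, scalings and constants give every affine functional of the latent
variables, and pairing gives the vector-valued maps. -/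
theorem Val.exists_aff {r : ℕ} : ∀ {τ : Ty} (f : Aff (CIdx (latent r)) τ.Idx),
    ∃ v : Val (latent r) τ, v.aff = f
  | .rv, f => by
    obtain ⟨v, hv⟩ := Val.exists_aff_rv r (f.A ()) (f.b ())
    exact ⟨v, Aff.ext_eval fun x => (hv x).trans (funext fun _ => rfl)⟩
  | .unit, f => ⟨.star, Aff.ext_eval fun x => funext fun i => Empty.elim i⟩
  | .prod σ τ, f => by
    obtain ⟨v, hv⟩ := Val.exists_aff (f.sel Ty.fst)
    obtain ⟨w, hw⟩ := Val.exists_aff (f.sel Ty.snd)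
    refine ⟨.pair v w, ?_⟩
    rw [Val.aff_pair, hv, hw]
    refine Aff.ext_eval fun x => ?_
    ext (i | i)
    · simp; rfl
    · simp; rfl

/-- The tuple of all variables. -/
theorem Val.exists_leftInverse : ∀ Γ : Cxt, ∃ (υ : Ty) (v : Val Γ υ) (g : Aff υ.Idx (CIdx Γ)),
    g.comp v.aff = Aff.id (CIdx Γ)
  | [] => ⟨.unit, .star, Aff.const Empty.elim,
      Aff.ext_eval fun _ => funext fun i => Empty.elim i⟩
  | σ :: Γ => by
    obtain ⟨υ, v, g, h⟩ := Val.exists_leftInverse Γ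
    refine ⟨.prod σ υ, .pair (.var .zero) (v.rename (Ren.weaken Γ σ)),
      (Aff.proj Ty.fst).cons (g.comp (Aff.proj Ty.snd)), Aff.ext_eval fun x => ?_⟩
    obtain ⟨y, z, rfl⟩ : ∃ (y : σ.Idx → ℝ) (z : CIdx Γ → ℝ), x = CIdx.cons y z :=
      ⟨fun i => x (Sum.inl i), fun i => x (Sum.inr i), by ext (i | i) <;> rfl⟩
    have hz : g.eval (v.aff.eval z) = z := by rw [← Aff.eval_comp, h, Aff.eval_id]
    rw [Aff.eval_comp, Aff.eval_cons, Val.aff_pair, Aff.eval_mkPair, Val.aff_rename_weaken]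
    simp only [Aff.eval_proj, Aff.eval_comp, Ty.mkPair_comp_fst, Ty.mkPair_comp_snd, hz,
      Val.aff_var, Aff.eval_id]
    rfl

/-! ### Binding all variables -/

def Ren.appendLeft : (Γ : Cxt) → {Δ : Cxt} → Ren Γ (Γ ++ Δ)
  | [], _ => fun _ x => nomatch x
  | _ :: Γ, _ => fun _ x => match x with
    | .zero => .zero
    | .succ x => .succ (Ren.appendLeft Γ _ x)

def Ren.appendRight : (Γ : Cxt) → {Δ : Cxt} → Ren Δ (Γ ++ Δ)
  | [], _ => fun _ x => x
  | _ :: Γ, _ => fun _ x => .succ (Ren.appendRight Γ _ x)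

/-- `let xₙ = vₙ in … let x₁ = v₁ in K`. -/
def PCxt.lets {Γ₀ : Cxt} {τ₀ υ : Ty} {Δ : Cxt} : (Γ : Cxt) → (∀ σ, Var Γ σ → Val Δ σ) →
    PCxt Γ₀ τ₀ (Γ ++ Δ) υ → PCxt Γ₀ τ₀ Δ υ
  | [], _, K => K
  | _ :: Γ, θ, K => PCxt.lets Γ (fun _ x => θ _ (.succ x))
      (.letInR ((θ _ .zero).toTm.rename (Ren.appendRight Γ)) K)

/-- The environment of the body of `PCxt.lets`. -/
def Aff.append {Δ : Cxt} (ρ : Aff Z (CIdx Δ)) : (Γ : Cxt) → (∀ σ, Var Γ σ → Val Δ σ) →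
    Aff Z (CIdx (Γ ++ Δ))
  | [], _ => ρ
  | _ :: Γ, θ => ((θ _ .zero).aff.comp ρ).cons (Aff.append ρ Γ fun _ x => θ _ (.succ x))

theorem Aff.append_sel_right {Δ : Cxt} (ρ : Aff Z (CIdx Δ)) : (Γ : Cxt) →
    (θ : ∀ σ, Var Γ σ → Val Δ σ) → (σ : Ty) → (x : Var Δ σ) →
    (ρ.append Γ θ).sel (Ren.appendRight Γ σ x).coord = ρ.sel x.coord
  | [], _, _, _ => rfl
  | _ :: Γ, θ, σ, x => Aff.append_sel_right ρ Γ (fun _ x => θ _ (.succ x)) σ x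

theorem Aff.append_sel_left {Δ : Cxt} (ρ : Aff Z (CIdx Δ)) {Γ : Cxt}
    (θ : ∀ σ, Var Γ σ → Val Δ σ) {σ : Ty} (x : Var Γ σ) :
    (ρ.append Γ θ).sel (Ren.appendLeft Γ σ x).coord = (θ σ x).aff.comp ρ := by
  induction x with
  | zero => rfl
  | succ x ih => exact ih fun _ y => θ _ (.succ y)

theorem PCxt.run_lets {Γ₀ : Cxt} {τ₀ υ : Ty} {Δ : Cxt} (e : Tm Γ₀ τ₀) (p : State Z)
    (ρ : Aff Z (CIdx Δ)) : (Γ : Cxt) → (θ : ∀ σ, Var Γ σ → Val Δ σ) →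
    (K : PCxt Γ₀ τ₀ (Γ ++ Δ) υ) →
    ((PCxt.lets Γ θ K).plug e).run p ρ = (K.plug e).run p (ρ.append Γ θ)
  | [], _, _ => rfl
  | σ :: Γ, θ, K => by
    -- Each bound value lives over `Δ` and is weakened past the variables bound further out, so it
    -- still evaluates as in `ρ`.
    rw [PCxt.lets, PCxt.run_lets e p ρ Γ, PCxt.plug, ← Val.run_rename_toTm, Tm.run_letIn_val,
      Val.aff_rename_comp _ (Aff.append_sel_right ρ Γ _)]
    rfl

/-- The testing context: it binds each variable of the hole to a value defining the corresponding
component of `F`, and pairs the hole with `w`. For an injective `w` no information on the latent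
variables is lost. -/
theorem PCxt.exists_run_plug {Γ : Cxt} {τ υ : Ty} {r : ℕ} (w : Val (latent r) υ)
    (F : Aff (CIdx (latent r)) (CIdx Γ)) : ∃ K : PCxt Γ τ (latent r) (.prod υ τ),
    ∀ (e : Tm Γ τ) (p : State (CIdx (latent r))), (K.plug e).run p (Aff.id _) =
      (e.run p F).map (push · ((Aff.proj Sum.inl).pair
        ((w.aff.comp (Aff.proj Sum.inl)).mkPair (Aff.proj Sum.inr)))) := by
  have hθ : ∀ σ (x : Var Γ σ), ∃ v : Val (latent r) σ, v.aff = F.sel x.coord :=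
    fun σ x => Val.exists_aff _
  choose θ hθ using hθ
  refine ⟨.lets Γ θ (.pairR (w.toTm.rename (Ren.appendRight Γ)) (.hole (Ren.appendLeft Γ))),
    fun e p => ?_⟩
  have hl : ∀ σ (x : Var Γ σ), ((Aff.id _).append Γ θ).sel (Ren.appendLeft Γ σ x).coord =
      F.sel x.coord := fun σ x => by rw [Aff.append_sel_left, Aff.comp_id, hθ]
  rw [PCxt.run_lets, PCxt.plug, PCxt.plug, Tm.run, ← Val.run_rename_toTm, Val.run_bind,
    e.run_rename _ p _ F hl, map_push_push, Val.aff_rename_comp _ (Aff.append_sel_right _ Γ _)]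
  refine map_push_congr rfl (Aff.ext_eval fun x => ?_)
  ext (i | i)
  · simp
  · simp; rfl

/-! ### Closing with normal variables -/

/-- `let z₁ = normal () in … let zᵣ = normal () in K`. -/
def PCxt.normals {Γ : Cxt} {τ υ : Ty} : (r : ℕ) → PCxt Γ τ (latent r) υ → PCxt Γ τ [] υ
  | 0, K => K
  | r + 1, K => PCxt.normals r (.letInR .normal K)

/-- The standard normal distribution on `ℝ^X`. -/
def stdState (X : Type) [Fintype X] [DecidableEq X] : State X := ⟨0, 0, 1, PosSemidef.one⟩

theorem push_noise_stdState {X Y : Type} [Fintype X] [Fintype Y] [DecidableEq X]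
    [DecidableEq Y] : push (noise (stdState X) Y)
      ((Aff.proj Sum.inr).pair (Aff.proj Sum.inl)) = stdState (Y ⊕ X) := by
  apply State.ext'
  · simp only [push_b, Aff.eval_pair, Aff.eval_proj]
    ext (i | i) <;> simp [stdState, noise]
  · rw [push_cov, noise_cov]
    ext (i | i) (j | j) <;>
      simp [stdState, Aff.pair, Aff.proj, Matrix.mul_apply, Matrix.one_apply]

theorem Tm.run_letIn_normal {Γ : Cxt} {τ : Ty} (e : Tm (.rv :: Γ) τ) :
    ((Tm.letIn .normal e).run (stdState (CIdx Γ)) (Aff.id _)).map (push · (Aff.proj Sum.inr)) =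
      (e.run (stdState (CIdx (.rv :: Γ))) (Aff.id _)).map (push · (Aff.proj Sum.inr)) := by
  rw [Tm.run, Tm.run, Option.bind_some, map_push_push, Aff.id_comp]
  have h : push (noise (stdState (CIdx Γ)) Ty.rv.Idx) ((Aff.proj Sum.inr).cons (Aff.proj Sum.inl)) =
      stdState (CIdx (.rv :: Γ)) := push_noise_stdState
  rw [← h, Tm.run_push_id]
  refine map_push_congr rfl (Aff.ext_eval fun x => ?_)
  ext i
  simp

/-- Each enclosing binding of a normal variable adds one standard normal coordinate, so the body is
run on `r` independent ones. -/
theorem PCxt.out_normals {Γ : Cxt} {τ υ : Ty} (e : Tm Γ τ) : ∀ (r : ℕ) (K : PCxt Γ τ (latent r) υ),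
    (Config.init ((PCxt.normals r K).plug e)).out =
      ((K.plug e).run (stdState (CIdx (latent r))) (Aff.id _)).map (push · (Aff.proj Sum.inr))
  | 0, K => by
    have h : GaussHom.point (X := Empty) 0 = stdState (CIdx []) :=
      State.ext' rfl (by ext i; exact i.elim)
    rw [Config.init, h]
    rfl
  | r + 1, K => by
    rw [PCxt.normals, PCxt.out_normals e r]
    exact Tm.run_letIn_normal _

/-- With `Σ = Bᵀ B`, as many standard normals as there are coordinates suffice; the coordinates of
the latent context are identified with `Z` by counting. -/
theorem exists_push_stdState (p : State Z) :
    ∃ (r : ℕ) (G : Aff (CIdx (latent r)) Z), push (stdState _) G = p := by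
  have hcard : ∀ r : ℕ, Fintype.card (CIdx (latent r)) = r := by
    intro r
    induction r with
    | zero => rfl
    | succ r ih =>
      refine (Fintype.card_sum (α := Ty.rv.Idx)).trans ?_
      exact (congrArg (_ + ·) ih).trans (add_comm 1 r)
  obtain ⟨B, hB⟩ : ∃ B : Matrix Z Z ℝ, p.cov = Bᵀ * B := by
    open scoped MatrixOrder ComplexOrder in
    obtain ⟨B, hB⟩ := (CStarAlgebra.nonneg_iff_eq_star_mul_self (a := p.cov)).1 p.psd.nonneg
    exact ⟨B, by rw [hB, star_eq_conjTranspose, conjTranspose_eq_transpose_of_trivial]⟩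
  have u : CIdx (latent (Fintype.card Z)) ≃ Z := Fintype.equivOfCardEq (hcard _)
  refine ⟨Fintype.card Z, ⟨Bᵀ.submatrix _root_.id u, p.b⟩, State.ext' ?_ ?_⟩
  · simp [Aff.eval, stdState]
  · rw [push_cov, hB, stdState]
    simp only [Matrix.mul_one, transpose_submatrix, transpose_transpose]
    rw [submatrix_mul_equiv]
    rfl

end contexts

/-! ### Full abstraction -/

theorem denote_eq_iff_ctxEquiv {Γ : Cxt} {τ : Ty} (e₁ e₂ : Tm Γ τ) :
    e₁.denote = e₂.denote ↔ CtxEquiv e₁ e₂ := by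
  rw [denote_eq_iff, ctxEquiv_iff]
  constructor
  · intro h τ' K
    exact congrArg (Option.map _) (K.run_plug_congr h _ (Aff.id (CIdx [])))
  · intro h Z _ _ p ρ
    -- It suffices to compare runs on standard normals in the environment `ρ ∘ G`, since
    -- `Tm.run_push` carries equality over to `p`.
    obtain ⟨r, G, rfl⟩ := exists_push_stdState p
    obtain ⟨υ, w, g, hg⟩ := Val.exists_leftInverse (latent r)
    obtain ⟨K, hK⟩ := PCxt.exists_run_plug (τ := τ) w (ρ.comp G)
    have hw : ∀ x, g.eval (w.aff.eval x) = x := fun x => by rw [← Aff.eval_comp, hg, Aff.eval_id]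
    have h1 := h _ (PCxt.normals r K)
    rw [PCxt.out_normals, PCxt.out_normals, hK, hK, map_push_push, map_push_push] at h1
    -- Applying the left inverse `g` of `w` to the first component of the observed output restores
    -- the latent variables.
    have h2 := congrArg (Option.map (push · ((g.comp (Aff.proj Ty.fst)).pair
      (Aff.proj Ty.snd)))) h1
    rw [map_push_push, map_push_push] at h2
    rw [Tm.run_push, Tm.run_push]
    -- Encoding the latent variables by `w` and decoding them by `g` is the identity on the joint
    -- law, so the runs can be recovered from the outcomes of the test.
    have key : ∀ o : Option (State (CIdx (latent r) ⊕ τ.Idx)), o = o.map (push ·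
        (((g.comp (Aff.proj Ty.fst)).pair (Aff.proj Ty.snd)).comp
          ((Aff.proj Sum.inr).comp ((Aff.proj Sum.inl).pair
            ((w.aff.comp (Aff.proj Sum.inl)).mkPair (Aff.proj Sum.inr)))))) := by
      intro o
      cases o with
      | none => rfl
      | some q =>
      rw [Option.map_some]
      conv_lhs => rw [← push_id q]
      refine congrArg some (congrArg _ (Aff.ext_eval fun x => ?_))
      ext (i | i)
      · simp [hw]
      · simp
    rw [key (e₁.run _ _), key (e₂.run _ _), h2]

end GaussLang

end

theorem mainTheorem1 {Γ : GaussLang.Cxt} {τ : GaussLang.Ty} (e₁ e₂ : GaussLang.Tm Γ τ) :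
    e₁.denote = e₂.denote ↔ GaussLang.CtxEquiv e₁ e₂ :=
  GaussLang.denote_eq_iff_ctxEquiv e₁ e₂
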